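/- **Setting.** Let $s,\alpha,\beta>0$. Let $0\le U\in L^1\cap L^2(\mathbb R)$ be even with $\int_{\mathbb R} U=1$, and let $0\le W\in L^1\cap L^\infty(\mathbb R^2)$ satisfy $\iint W=1$, $W(x,y)=W(y,x)$ and $W(x-y,x-z)=W(y-x,y-z)=W(z-y,z-x)$ (almost everywhere). Put $U_N(x)=N^\alpha U(N^\alpha x)$ and $W_N(x,y)=N^{2\beta}W(N^\beta x,N^\beta y)$. For complex-valued $u\in H^1(\mathbb R)$ let $$\mathcal E^{\mathrm H,N}_{a,b}(u)=\int_{\mathbb R}\big(|u'|^2+|x|^s|u|^2\big)dx+\frac a2\iint U_N(x-y)|u(x)|^2|u(y)|^2dxdy-\frac b6\iiint W_N(x-y,x-z)|u(x)|^2|u(y)|^2|u(z)|^2dxdydz,$$ $$\mathcal E^{\mathrm{NLS}}_{a,b}(u)=\int_{\mathbb R}\Big(|u'|^2+|x|^s|u|^2+\frac a2|u|^4-\frac b6|u|^6\Big)dx,$$ with value $+\infty$ if $\int|x|^s|u|^2=\infty$, and let $E^{\mathrm H,N}_{a,b}$, $E^{\mathrm{NLS}}_{a,b}$ be their infima over $u\in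 H^1(\mathbb R)$ with $\|u\|_2=1$; an NLS ground state is a minimizer of the latter. Let $\mathfrak b=3\pi^2/2$, $Q_0(x)=(\cosh \pi x)^{-1/2}$ and $\mathcal Q_s=s\int|x|^s|Q_0(x)|^2dx$. Sequences are indexed by integers $N$, conditions for all $N$ being imposed for $N\ge3$. **(i)** Let $a\in\mathbb R$ and either $0<b<\mathfrak b$, or $b=\mathfrak b$, $a>0$ and $\alpha>\beta$. Let $u_N\in H^1(\mathbb R)$, $\|u_N\|_2=1$, be approximate Hartree ground states, i.e. $\mathcal E^{\mathrm H,N}_{a,b}(u_N)\le E^{\mathrm H,N}_{a,b}+o(1)$ as $N\to\infty$. Then every subsequence of $\{u_N\}$ has a further subsequence that converges strongly in $H^1(\mathbb R)$ to an NLS ground state. Moreover, $E^{\mathrm{NLS}}_{a,b}$ is finite and $\lim_{N\to\infty}E^{\mathrm H,N}_{a,b}=E^{\mathrm{NLS}}_{a,b}$. **(ii)** Assume $xU(x)\in L^1(\mathbb R)$ and $xW(x,y)\in L^1(\mathbb R^2)$. Let $\zeta\ge0$, $a_N\in\mathbb R$, $0<b_N\le\mathfrak b$, $a_N\to0$, $b_N\to\mathfrak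 b$, $\max\{0,a_N\}+(\mathfrak b-b_N)>0$, and $$\lim_{N\to\infty}a_N(\mathfrak b-b_N)^{-\frac{s+1}{s+2}}=\pi\,\frac{6-\zeta}{6}\,\zeta^{-\frac{s+1}{s+2}}\,\mathcal Q_s^{\frac1{s+2}}\in(-\infty,+\infty],$$ where $0^{-\frac{s+1}{s+2}}=+\infty$. Let $\ell_N$ be given by $\ell_N=\big(\tfrac{6a_N}{(6-\zeta)\pi\mathcal Q_s}\big)^{1/(s+1)}$ (allowed if $\zeta\ne6$) or by $\ell_N=\big(\tfrac{\mathfrak b-b_N}{\zeta\mathcal Q_s}\big)^{1/(s+2)}$ (allowed if $\zeta\ne0$), and suppose that $\ell_N\sim N^{-\eta}$ (comparable up to positive multiplicative constants for large $N$) for some $0<\eta<\min\{\beta/(s+3),\alpha\}$. If $\zeta=0$, assume also $\alpha>\beta$. Let $u_N\in H^1(\mathbb R)$, $\|u_N\|_2=1$, be Hartree ground states, or more generally approximate ones with $\mathcal E^{\mathrm H,N}_{a_N,b_N}(u_N)\le E^{\mathrm H,N}_{a_N,b_N}+o(\ell_N^s)$. Then there are phases $\theta_N\in\mathbb R$ such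 that $$e^{i\theta_N}\,\ell_N^{1/2}u_N(\ell_N\,\cdot)\to Q_0\quad\text{strongly in }H^1(\mathbb R),$$ and one can take $\theta_N=0$ if $u_N\ge0$ for all $N$. Moreover, $$E^{\mathrm H,N}_{a_N,b_N}=\Big(\frac{s+1}{s}-\frac{\zeta}{12}+o(1)\Big)\mathcal Q_s\ell_N^s,\qquad E^{\mathrm{NLS}}_{a_N,b_N}=\Big(\frac{s+1}{s}-\frac{\zeta}{12}+o(1)\Big)\mathcal Q_s\ell_N^s,$$ and, if $\zeta\ne 12(s+1)/s$, $E^{\mathrm H,N}_{a_N,b_N}=E^{\mathrm{NLS}}_{a_N,b_N}(1+o(1))$. -/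

import Mathlib

open MeasureTheory Filter Topology Asymptotics
open scoped ENNReal ContDiff

noncomputable section

namespace HartreeNLS

/-- `g` is the weak (distributional) derivative of `f` on the real line. -/
def HasWeakDeriv (f g : ℝ → ℂ) : Prop :=
  ∀ φ : ℝ → ℝ, ContDiff ℝ ∞ φ → HasCompactSupport φ →
    ∫ x, deriv φ x • f x = -∫ x, φ x • g x

/-- A complex-valued function in `H¹(ℝ)`, together with its weak derivative
(which is determined by the function up to null sets). -/
structure H1 where
  /-- the function `u` -/
  toFun : ℝ → ℂ
  /-- its weak derivative `u'` -/
  weakDeriv : ℝ → ℂ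
  memLp_toFun : MemLp toFun 2
  memLp_weakDeriv : MemLp weakDeriv 2
  hasWeakDeriv : HasWeakDeriv toFun weakDeriv

instance : CoeFun H1 (fun _ => ℝ → ℂ) := ⟨H1.toFun⟩

/-- Strong convergence `v n → w` in `H¹(ℝ)`: the functions `v n` (for all large `n`) and `w`
belong to `H¹(ℝ)`, and both `v n - w` and its weak derivative tend to `0` in `L²(ℝ)`. -/
def TendstoInH1 (v : ℕ → ℝ → ℂ) (w : ℝ → ℂ) : Prop :=
  ∃ (v' : ℕ → ℝ → ℂ) (w' : ℝ → ℂ),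
    (∀ᶠ n in atTop, MemLp (v n) 2 ∧ MemLp (v' n) 2 ∧ HasWeakDeriv (v n) (v' n)) ∧
    (MemLp w 2 ∧ MemLp w' 2 ∧ HasWeakDeriv w w') ∧
    Tendsto (fun n => eLpNorm (v n - w) 2) atTop (𝓝 0) ∧
    Tendsto (fun n => eLpNorm (v' n - w') 2) atTop (𝓝 0)

/-- `∫ |u|²`. -/
def mass (u : H1) : ℝ := ∫ x, ‖u x‖ ^ 2

/-- `∫ |u'|²`. -/
def kinetic (u : H1) : ℝ := ∫ x, ‖u.weakDeriv x‖ ^ 2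

/-- `∫ |x|^s |u|²`, which may be infinite. -/
def trapping (s : ℝ) (u : H1) : ℝ≥0∞ := ∫⁻ x, ENNReal.ofReal (|x| ^ s * ‖u x‖ ^ 2)

/-- The scaled two-body potential `U_N(x) = N^α U(N^α x)`. -/
def scaledU (U : ℝ → ℝ) (α : ℝ) (N : ℕ) (x : ℝ) : ℝ := (N : ℝ) ^ α * U ((N : ℝ) ^ α * x)

/-- The scaled three-body potential `W_N(x, y) = N^(2β) W(N^β x, N^β y)`. -/
def scaledW (W : ℝ × ℝ → ℝ) (β : ℝ) (N : ℕ) (x y : ℝ) : ℝ :=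
  (N : ℝ) ^ (2 * β) * W ((N : ℝ) ^ β * x, (N : ℝ) ^ β * y)

/-- `∬ U_N(x-y) |u(x)|² |u(y)|² dx dy`. -/
def twoBody (U : ℝ → ℝ) (α : ℝ) (N : ℕ) (u : H1) : ℝ :=
  ∫ p : ℝ × ℝ, scaledU U α N (p.1 - p.2) * ‖u p.1‖ ^ 2 * ‖u p.2‖ ^ 2

/-- `∭ W_N(x-y, x-z) |u(x)|² |u(y)|² |u(z)|² dx dy dz`. -/
def threeBody (W : ℝ × ℝ → ℝ) (β : ℝ) (N : ℕ) (u : H1) : ℝ :=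
  ∫ p : ℝ × ℝ × ℝ, scaledW W β N (p.1 - p.2.1) (p.1 - p.2.2) *
    ‖u p.1‖ ^ 2 * ‖u p.2.1‖ ^ 2 * ‖u p.2.2‖ ^ 2

/-- The Hartree functional, with value `+∞` where the trapping energy is infinite. -/
def hartree (U : ℝ → ℝ) (W : ℝ × ℝ → ℝ) (s α β a b : ℝ) (N : ℕ) (u : H1) : EReal :=
  (trapping s u : EReal) +
    ((kinetic u + a / 2 * twoBody U α N u - b / 6 * threeBody W β N u : ℝ) : EReal)

/-- The NLS functional, with value `+∞` where the trapping energy is infinite. -/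
def nls (s a b : ℝ) (u : H1) : EReal :=
  (trapping s u : EReal) +
    ((kinetic u + a / 2 * (∫ x, ‖u x‖ ^ 4) - b / 6 * (∫ x, ‖u x‖ ^ 6) : ℝ) : EReal)

/-- The infimum of a functional over the `L²`-normalized functions of `H¹(ℝ)`. -/
def groundEnergy (F : H1 → EReal) : EReal := ⨅ (u : H1) (_ : mass u = 1), F u

/-- The Hartree ground state energy. -/
def hartreeEnergy (U : ℝ → ℝ) (W : ℝ × ℝ → ℝ) (s α β a b : ℝ) (N : ℕ) : EReal :=
  groundEnergy (hartree U W s α β a b N)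

/-- The NLS ground state energy. -/
def nlsEnergy (s a b : ℝ) : EReal := groundEnergy (nls s a b)

/-- `u` is a ground state (normalized minimizer) of the functional `F`. -/
def IsGroundState (F : H1 → EReal) (u : H1) : Prop := mass u = 1 ∧ F u = groundEnergy F

/-- `u N` is a sequence of approximate ground states of the functionals `F N`, up to an error
`o(r N)` (genuine ground states are the case of zero error). The lower bound
`groundEnergy (F N) ≤ F N (u N)` holds automatically. -/
def IsApproxGroundStates (F : ℕ → H1 → EReal) (r : ℕ → ℝ) (u : ℕ → H1) : Prop :=
  ∃ δ : ℕ → ℝ, δ =o[atTop] r ∧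
    ∀ N, 3 ≤ N → mass (u N) = 1 ∧ F N (u N) ≤ groundEnergy (F N) + (δ N : EReal)

/-- The assumptions on the two-body potential. -/
structure TwoBodyPotential (U : ℝ → ℝ) : Prop where
  nonneg : ∀ᵐ x, 0 ≤ U x
  even : ∀ᵐ x, U (-x) = U x
  memLp_one : MemLp U 1
  memLp_two : MemLp U 2
  integral_eq_one : ∫ x, U x = 1

/-- The assumptions on the three-body potential. -/
structure ThreeBodyPotential (W : ℝ × ℝ → ℝ) : Prop where
  nonneg : ∀ᵐ p, 0 ≤ W p
  memLp_one : MemLp W 1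
  memLp_top : MemLp W (⊤ : ℝ≥0∞)
  integral_eq_one : ∫ p, W p = 1
  swap : ∀ᵐ p : ℝ × ℝ, W (p.1, p.2) = W (p.2, p.1)
  exchange : ∀ᵐ p : ℝ × ℝ × ℝ,
    W (p.1 - p.2.1, p.1 - p.2.2) = W (p.2.1 - p.1, p.2.1 - p.2.2) ∧
    W (p.2.1 - p.1, p.2.1 - p.2.2) = W (p.2.2 - p.2.1, p.2.2 - p.1)

/-- The critical coupling `3π²/2`. -/
def bCrit : ℝ := 3 * Real.pi ^ 2 / 2

/-- The profile `Q₀(x) = 1 / √(cosh (π x))`. -/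
def Q₀ (x : ℝ) : ℝ := 1 / √(Real.cosh (Real.pi * x))

/-- `𝒬_s = s ∫ |x|^s |Q₀(x)|² dx`. -/
def Qs (s : ℝ) : ℝ := s * ∫ x, |x| ^ s * |Q₀ x| ^ 2

/-- The collapse regime. The limit is taken in the extended reals, where
`0 ^ (-(s+1)/(s+2)) = +∞`; it is `+∞` when `ζ = 0`. -/
structure CollapseRegime (s ζ : ℝ) (a b ℓ : ℕ → ℝ) : Prop where
  b_pos : ∀ N, 3 ≤ N → 0 < b N
  b_le : ∀ N, 3 ≤ N → b N ≤ bCrit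
  stable : ∀ N, 3 ≤ N → 0 < max 0 (a N) + (bCrit - b N)
  tendsto_a : Tendsto a atTop (𝓝 0)
  tendsto_b : Tendsto b atTop (𝓝 bCrit)
  tendsto_ratio : Tendsto
    (fun N => (a N : EReal) * ((ENNReal.ofReal (bCrit - b N) ^ (-(s + 1) / (s + 2)) : ℝ≥0∞) : EReal))
    atTop
    (𝓝 (((Real.pi * ((6 - ζ) / 6) * Qs s ^ (1 / (s + 2)) : ℝ) : EReal) *
      ((ENNReal.ofReal ζ ^ (-(s + 1) / (s + 2)) : ℝ≥0∞) : EReal)))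
  length :
    (ζ ≠ 6 ∧ ∀ N, 3 ≤ N → ℓ N = (6 * a N / ((6 - ζ) * Real.pi * Qs s)) ^ (1 / (s + 1))) ∨
    (ζ ≠ 0 ∧ ∀ N, 3 ≤ N → ℓ N = ((bCrit - b N) / (ζ * Qs s)) ^ (1 / (s + 2)))

/-- The rescaled function `√ℓ u(ℓ x)`. -/
def rescale (ℓ : ℝ) (u : ℝ → ℂ) (x : ℝ) : ℂ := (√ℓ : ℂ) * u (ℓ * x)

end HartreeNLS

end

open HartreeNLS

/-! The proof rests on one identity. For ∫|u|² = 1 put ρ = |u|² and M(x) = ∫_{-∞}^x ρ. Formally,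
∫|u' − (π/2) cot(πM) ρ u|² = ∫|u'|² − (π²/4) ∫ρ³, because expanding the square leaves, besides these
terms, only the total derivative of cot(πM) ρ². This is the sharp Gagliardo–Nirenberg inequality
with constant `bCrit` / 6 = π²/4. Equality forces a first-order ODE whose normalized solutions are
the dilates, translates and phase multiples of Q₀ (`integral_defect`, `exists_eq_of_optimizer`).

The nonlocal interactions are averages of correlations of ρ at distances N^(-α) and N^(-β). They lie
between 0 and ∫ρ², respectively ∫ρ³, so the Hartree attraction is also controlled by
Gagliardo–Nirenberg. Their distance to the local values is governed by ‖ρ(· − h) − ρ‖₁ ≤ 2 min(1,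
|h| κ), where κ² = ∫|u'|² (`twoBody_bounds`, `threeBody_bounds`).

For fixed couplings, bounded energy must bound κ. Below the critical coupling, Gagliardo–Nirenberg
suffices. At the critical coupling, the repulsion bounds the two-body energy, hence ∫ρ² up to the
two-body error, and ∫ρ³ ≤ 2κ ∫ρ² closes the estimate. The error is small because boundedness of W
gives κ = O(N^β) in advance, and β < α. Kinetic and trapping bounds give compactness. Lower
semicontinuity and comparison of energies then give strong convergence (`hartree_subseq`).

In the collapse regime, dilate by ℓ and divide the energy by ℓ^s. With T, K, D₂, D₃ the rescaled
trapping, kinetic, two-body and three-body terms, it becomes T + ℓ^(-(s+2)) (K − (π²/4) D₃) + (B/6)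
D₃ + (A/2) D₂, where A and B converge. The diverging prefactor forces every limit to be a
Gagliardo–Nirenberg optimizer. What remains is an explicit function of the dilation and the centre,
minimal exactly at Q₀ (`reduced_energy`), and Q₀ as trial state gives the matching upper bound. The
three-body error must be o(ℓ^(s+2)) to survive the prefactor, whence η < β/(s+3). Hartree and NLS
are two instances of one scheme (`LocalApprox`), so they share the asymptotics. -/

namespace HartreeNLS

/-! ### Absolutely continuous functions and weak derivatives. -/

/-- `f` is a locally absolutely continuous function on the line with derivative `f'`. -/
structure ACDeriv (f f' : ℝ → ℝ) : Prop where
  loc : LocallyIntegrable f'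
  ftc : ∀ a b, f b - f a = ∫ t in a..b, f' t

theorem intervalIntegrable_of_loc {E : Type*} [NormedAddCommGroup E] {f : ℝ → E}
    (hf : LocallyIntegrable f) (a b : ℝ) : IntervalIntegrable f volume a b :=
  intervalIntegrable_iff.mpr <|
    (hf.integrableOn_isCompact isCompact_uIcc).mono_set Set.uIoc_subset_uIcc

namespace ACDeriv

variable {f f' g g' : ℝ → ℝ}

theorem eq_add (hf : ACDeriv f f') (a x : ℝ) : f x = f a + ∫ t in a..x, f' t := by
  rw [← hf.ftc a x]; ring

theorem continuous (hf : ACDeriv f f') : Continuous f := by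
  have h : f = fun x => f 0 + ∫ t in (0 : ℝ)..x, f' t := funext fun x => hf.eq_add 0 x
  rw [h]
  exact continuous_const.add
    (intervalIntegral.continuous_primitive (intervalIntegrable_of_loc hf.loc) 0)

theorem ac (hf : ACDeriv f f') (a b : ℝ) : AbsolutelyContinuousOnInterval f a b := by
  have h : f = fun x => f a + ∫ t in a..x, f' t := funext fun x => hf.eq_add a x
  rw [h]
  have h1 : AbsolutelyContinuousOnInterval (fun _ : ℝ => f a) a b :=
    (contDiff_const (n := 1) (c := f a)).contDiffOn.absolutelyContinuousOnInterval
  exact h1.add ((intervalIntegrable_of_loc hf.loc a b).absolutelyContinuousOnInterval_intervalIntegral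
    (by simp))

theorem ae_hasDerivAt (hf : ACDeriv f f') : ∀ᵐ x, HasDerivAt f (f' x) x := by
  filter_upwards [LocallyIntegrable.ae_hasDerivAt_integral hf.loc] with x hx
  have h : f = fun x => f 0 + ∫ t in (0 : ℝ)..x, f' t := funext fun x => hf.eq_add 0 x
  rw [h]
  exact (hx 0).const_add _

theorem of_hasDerivAt (h : ∀ x, HasDerivAt f (f' x) x) (hc : Continuous f') : ACDeriv f f' :=
  ⟨hc.locallyIntegrable, fun a b =>
    (intervalIntegral.integral_eq_sub_of_hasDerivAt (fun x _ => h x)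
      (hc.intervalIntegrable a b)).symm⟩

theorem add (hf : ACDeriv f f') (hg : ACDeriv g g') :
    ACDeriv (fun x => f x + g x) (fun x => f' x + g' x) :=
  ⟨hf.loc.add hg.loc, fun a b => by
    rw [intervalIntegral.integral_add (intervalIntegrable_of_loc hf.loc a b)
      (intervalIntegrable_of_loc hg.loc a b), ← hf.ftc, ← hg.ftc]; ring⟩

theorem mul (hf : ACDeriv f f') (hg : ACDeriv g g') :
    ACDeriv (fun x => f x * g x) (fun x => f' x * g x + f x * g' x) := by
  refine ⟨?_, fun a b => ?_⟩
  · have h1 := LocallyIntegrable.smul_continuous hg.continuous hf.loc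
    have h2 := LocallyIntegrable.smul_continuous hf.continuous hg.loc
    have := h1.add h2
    refine this.congr (Eventually.of_forall fun x => ?_)
    simp [mul_comm]
  · rw [← (hf.ac a b).integral_deriv_mul_eq_sub (hg.ac a b)]
    apply intervalIntegral.integral_congr_ae
    filter_upwards [hf.ae_hasDerivAt, hg.ae_hasDerivAt] with x h1 h2 _
    rw [h1.deriv, h2.deriv]

theorem sub_le (hf : ACDeriv f f') (hi : Integrable f') (x y : ℝ) :
    f x - f y ≤ ∫ t, |f' t| := by
  rw [hf.ftc]
  calc ∫ t in y..x, f' t ≤ |∫ t in y..x, f' t| := le_abs_self _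
    _ ≤ ∫ t in Set.uIoc y x, |f' t| := by
        have := intervalIntegral.norm_integral_le_integral_norm_uIoc (f := f') (a := y) (b := x)
          (μ := volume)
        simpa using this
    _ ≤ ∫ t, |f' t| := setIntegral_le_integral hi.abs (Eventually.of_forall fun t => abs_nonneg _)

/-- If f(x) exceeded the total variation, f would stay above a positive constant on the whole line,
which integrability forbids. -/
theorem le_of_integrable (hf : ACDeriv f f') (hi : Integrable f') (hi0 : Integrable f) (x : ℝ) :
    f x ≤ ∫ t, |f' t| := by
  by_contra! hlt
  set c := f x - ∫ t, |f' t|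
  have hc : 0 < c := sub_pos.mpr hlt
  have h : ∀ y, c ≤ f y := fun y => by have := hf.sub_le hi x y; simp only [c]; linarith
  have h2 : Integrable (fun _ : ℝ => c) := hi0.mono' aestronglyMeasurable_const
    (Eventually.of_forall fun y => by rw [Real.norm_of_nonneg hc.le]; exact h y)
  rw [integrable_const_iff] at h2
  rcases h2 with h2 | h2
  · exact hc.ne' h2
  · have := h2.measure_univ_lt_top; simp at this

/-- Write f(x − h) − f(x) as an integral of f'(x − r) over r between 0 and h, then use Tonelli and
translation invariance. -/
theorem integrable_translate_sub (hf : ACDeriv f f') (hi : Integrable f') (h : ℝ) :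
    ∫⁻ x, ‖f (x - h) - f x‖ₑ ≤ ENNReal.ofReal (|h| * ∫ t, |f' t|) := by
  have h1 : ∀ x, ‖f (x - h) - f x‖ₑ ≤ ∫⁻ r in Set.uIoc 0 h, ‖f' (x - r)‖ₑ := fun x => by
    have : f (x - h) - f x = -∫ r in (0 : ℝ)..h, f' (x - r) := by
      rw [hf.ftc x (x - h), intervalIntegral.integral_symm]
      rw [intervalIntegral.integral_comp_sub_left (fun t => f' t)]
      simp
    rw [this, enorm_neg]
    rw [intervalIntegral.intervalIntegral_eq_integral_uIoc]
    split_ifs <;> simpa [enorm_smul] using enorm_integral_le_lintegral_enorm (μ := volume.restrict (Set.uIoc 0 h)) (fun r => f' (x - r))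
  calc ∫⁻ x, ‖f (x - h) - f x‖ₑ ≤ ∫⁻ x, ∫⁻ r in Set.uIoc 0 h, ‖f' (x - r)‖ₑ := lintegral_mono h1
    _ = ∫⁻ r in Set.uIoc 0 h, ∫⁻ x, ‖f' (x - r)‖ₑ := by
        rw [lintegral_lintegral_swap]
        refine (hi.aestronglyMeasurable.comp_quasiMeasurePreserving ?_).enorm
        exact (quasiMeasurePreserving_sub volume volume).mono_left
          (Measure.AbsolutelyContinuous.prod (Measure.AbsolutelyContinuous.refl _)
            Measure.restrict_le_self.absolutelyContinuous)
    _ = ∫⁻ r in Set.uIoc 0 h, ∫⁻ x, ‖f' x‖ₑ := by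
        refine lintegral_congr fun r => ?_
        exact lintegral_sub_right_eq_self (fun x => ‖f' x‖ₑ) r
    _ = ENNReal.ofReal (|h| * ∫ t, |f' t|) := by
        rw [lintegral_const, Measure.restrict_apply_univ, Real.volume_uIoc, sub_zero,
          ENNReal.ofReal_mul (abs_nonneg _), mul_comm]
        congr 1
        exact (ofReal_integral_norm_eq_lintegral_enorm hi).symm

end ACDeriv

theorem ACDeriv.integral_eq_zero {f f' : ℝ → ℝ} (hf : ACDeriv f f') {R : ℝ}
    (h0 : ∀ x, R < |x| → f x = 0) (h0' : ∀ x, R < |x| → f' x = 0) : ∫ x, f' x = 0 := by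
  have hlt : R < |R| + 1 := by linarith [le_abs_self R]
  have h1 : ∫ x, f' x = ∫ x in (-(|R| + 1))..(|R| + 1), f' x := by
    rw [intervalIntegral.integral_of_le (by linarith [abs_nonneg R])]
    symm
    apply setIntegral_eq_integral_of_forall_compl_eq_zero
    intro x hx
    apply h0' x
    by_contra! hle
    apply hx
    have := abs_le.mp hle
    have := le_abs_self R
    constructor <;> linarith
  rw [h1, ← hf.ftc]
  rw [h0, h0, sub_zero]
  · rw [abs_neg, abs_of_nonneg (by positivity)]; exact hlt
  · rw [abs_of_nonneg (by positivity)]; exact hlt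

theorem exists_radius_of_hasCompactSupport {E : Type*} [Zero E] {φ : ℝ → E}
    (hs : HasCompactSupport φ) : ∃ R, ∀ x, R < |x| → φ x = 0 := by
  obtain ⟨R, hR⟩ := hs.isCompact.isBounded.subset_closedBall 0
  refine ⟨R, fun x hx => image_eq_zero_of_notMem_tsupport fun h => ?_⟩
  have := hR h
  simp at this
  linarith

theorem contDiff_one_of_infty {φ : ℝ → ℝ} (hφ : ContDiff ℝ ∞ φ) : ContDiff ℝ 1 φ :=
  hφ.of_le (by exact_mod_cast le_top)

theorem ACDeriv.of_contDiff {φ : ℝ → ℝ} (hφ : ContDiff ℝ 1 φ) : ACDeriv φ (deriv φ) :=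
  ACDeriv.of_hasDerivAt
    (fun x => (hφ.differentiable (by norm_num) x).hasDerivAt) (hφ.continuous_deriv le_rfl)

theorem ACDeriv.integral_by_parts {f f' : ℝ → ℝ} (hf : ACDeriv f f') {φ : ℝ → ℝ}
    (hφ : ContDiff ℝ ∞ φ) (hs : HasCompactSupport φ) :
    ∫ x, deriv φ x * f x = -∫ x, φ x * f' x := by
  have hφ1 := contDiff_one_of_infty hφ
  have h2 := (ACDeriv.of_contDiff hφ1).mul hf
  obtain ⟨R, hR⟩ := exists_radius_of_hasCompactSupport hs
  obtain ⟨R', hR'⟩ := exists_radius_of_hasCompactSupport hs.deriv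
  have h3 := h2.integral_eq_zero (R := max R R')
    (fun x hx => by simp [hR x ((le_max_left _ _).trans_lt hx)])
    (fun x hx => by
      simp [hR x ((le_max_left _ _).trans_lt hx), hR' x ((le_max_right _ _).trans_lt hx)])
  rw [integral_add] at h3
  · linarith
  · exact (hf.continuous.locallyIntegrable).integrable_smul_left_of_hasCompactSupport
      (hφ1.continuous_deriv le_rfl) hs.deriv
  · exact hf.loc.integrable_smul_left_of_hasCompactSupport hφ1.continuous hs

theorem ACDeriv.re_im {f g : ℝ → ℂ} (hg : LocallyIntegrable g)
    (h : ∀ a b, f b - f a = ∫ t in a..b, g t) :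
    ACDeriv (fun x => (f x).re) (fun x => (g x).re) ∧
      ACDeriv (fun x => (f x).im) (fun x => (g x).im) := by
  have hi := intervalIntegrable_of_loc hg
  have key : ∀ L : ℂ →L[ℝ] ℝ, ACDeriv (fun x => L (f x)) (fun x => L (g x)) := fun L => by
    refine ⟨fun x => ?_, fun a b => ?_⟩
    · obtain ⟨s, hs, hs'⟩ := hg x
      exact ⟨s, hs, L.integrable_comp hs'⟩
    · rw [← map_sub, h, ContinuousLinearMap.intervalIntegral_comp_comm _ (hi a b)]
  exact ⟨key Complex.reCLM, key Complex.imCLM⟩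

theorem hasWeakDeriv_of_ftc {f g : ℝ → ℂ} (hg : LocallyIntegrable g)
    (h : ∀ a b, f b - f a = ∫ t in a..b, g t) : HasWeakDeriv f g := by
  intro φ hφ hs
  obtain ⟨hre, him⟩ := ACDeriv.re_im hg h
  have hφ1 := contDiff_one_of_infty hφ
  have hfc : Continuous f := by
    have : f = fun x => ((f x).re : ℂ) + (f x).im * Complex.I :=
      funext fun x => (Complex.re_add_im _).symm
    rw [this]
    exact (Complex.continuous_ofReal.comp hre.continuous).add
      ((Complex.continuous_ofReal.comp him.continuous).mul continuous_const)
  have i1 : Integrable (fun x => deriv φ x • f x) :=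
    hfc.locallyIntegrable.integrable_smul_left_of_hasCompactSupport
      (hφ1.continuous_deriv le_rfl) hs.deriv
  have i2 : Integrable (fun x => φ x • g x) :=
    hg.integrable_smul_left_of_hasCompactSupport hφ1.continuous hs
  have e1 := hre.integral_by_parts hφ hs
  have e2 := him.integral_by_parts hφ hs
  apply Complex.ext
  · rw [Complex.neg_re, ← RCLike.re_eq_complex_re, ← integral_re i1, ← integral_re i2]
    simpa using e1
  · rw [Complex.neg_im, ← RCLike.im_eq_complex_im, ← integral_im i1, ← integral_im i2]
    simpa using e2

/-- A test function with zero integral is the derivative of a test function. -/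
theorem exists_antideriv_test {ψ : ℝ → ℝ} (hψ : ContDiff ℝ ∞ ψ) (hs : HasCompactSupport ψ)
    (h0 : ∫ x, ψ x = 0) :
    ∃ φ : ℝ → ℝ, ContDiff ℝ ∞ φ ∧ HasCompactSupport φ ∧ deriv φ = ψ := by
  obtain ⟨R, hR⟩ := exists_radius_of_hasCompactSupport hs
  set r := |R| + 1
  have hr : R < r := by simp only [r]; linarith [le_abs_self R]
  have hr0 : 0 < r := by positivity
  have hd : ∀ x, HasDerivAt (fun x => ∫ t in (-r)..x, ψ t) (ψ x) x := fun x =>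
    intervalIntegral.integral_hasDerivAt_right (hψ.continuous.intervalIntegrable _ _)
      (hψ.continuous.stronglyMeasurableAtFilter _ _) hψ.continuous.continuousAt
  have hderiv : deriv (fun x => ∫ t in (-r)..x, ψ t) = ψ := funext fun x => (hd x).deriv
  refine ⟨fun x => ∫ t in (-r)..x, ψ t, ?_, ?_, hderiv⟩
  -- Smoothness of the primitive is obtained at order ∞ + 1, which `contDiff_succ_iff_deriv` reduces
  -- to smoothness of ψ.
  · have : ContDiff ℝ ((∞ : WithTop ℕ∞) + 1) (fun x => ∫ t in (-r)..x, ψ t) := by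
      rw [contDiff_succ_iff_deriv]
      refine ⟨fun x => (hd x).differentiableAt, by simp, by rw [hderiv]; exact hψ⟩
    exact this.of_le le_rfl
  · apply HasCompactSupport.of_support_subset_isCompact (isCompact_Icc (a := -r) (b := r))
    intro x hx
    by_contra hxo
    apply hx
    have hx' : r < |x| := by
      by_contra! hle
      exact hxo (abs_le.mp hle)
    rcases le_total x 0 with hneg | hpos
    · rw [abs_of_nonpos hneg] at hx'
      apply intervalIntegral.integral_zero_ae
      refine Eventually.of_forall fun t ht => hR t ?_
      rw [Set.uIoc_of_ge (by linarith)] at ht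
      rw [abs_of_nonpos (by linarith [ht.2])]
      linarith [ht.2]
    · rw [abs_of_nonneg hpos] at hx'
      change ∫ t in (-r)..x, ψ t = 0
      rw [intervalIntegral.integral_of_le (by linarith), ← h0]
      apply setIntegral_eq_integral_of_forall_compl_eq_zero
      intro t ht
      apply hR
      by_contra! hle
      have := abs_le.mp hle
      exact ht ⟨by linarith, by linarith⟩

/-- The lemma of du Bois-Reymond: a function with zero weak derivative is constant. -/
theorem ae_const_of_weakDeriv_zero {f : ℝ → ℂ} (hf : LocallyIntegrable f)
    (h : ∀ φ : ℝ → ℝ, ContDiff ℝ ∞ φ → HasCompactSupport φ → ∫ x, deriv φ x • f x = 0) :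
    ∃ c : ℂ, ∀ᵐ x, f x = c := by
  let χ : ContDiffBump (0 : ℝ) := ⟨1, 2, by norm_num, by norm_num⟩
  have hχ : ContDiff ℝ ∞ (χ.normed volume) := χ.contDiff_normed
  have hχs : HasCompactSupport (χ.normed volume) := χ.hasCompactSupport_normed
  have hχi : ∫ x, χ.normed volume x = 1 := χ.integral_normed
  refine ⟨∫ x, χ.normed volume x • f x, ?_⟩
  set c := ∫ x, χ.normed volume x • f x
  apply ae_eq_of_integral_contDiff_smul_eq hf (continuous_const.locallyIntegrable)
  intro g hg hgs
  set I := ∫ x, g x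
  have hgi : Integrable g := hg.continuous.integrable_of_hasCompactSupport hgs
  have hχint : Integrable (χ.normed volume) := hχ.continuous.integrable_of_hasCompactSupport hχs
  -- Subtracting the multiple of a fixed unit-mass bump makes the test function mean-free, hence a
  -- derivative of a test function. The constant is therefore the average of f against that bump.
  obtain ⟨φ, hφ, hφs, hφd⟩ := exists_antideriv_test (ψ := fun x => g x - I * χ.normed volume x)
    (hg.sub (contDiff_const.mul hχ)) (hgs.sub hχs.mul_left)
    (by rw [integral_sub hgi (hχint.const_mul I), integral_const_mul, hχi]; simp [I])
  have h1 := h φ hφ hφs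
  rw [hφd] at h1
  have e1 : Integrable (fun x => g x • f x) :=
    hf.integrable_smul_left_of_hasCompactSupport hg.continuous hgs
  have e2 : Integrable (fun x => χ.normed volume x • f x) :=
    hf.integrable_smul_left_of_hasCompactSupport hχ.continuous hχs
  have h2 : (fun x => (g x - I * χ.normed volume x) • f x) =
      fun x => g x • f x - I • (χ.normed volume x • f x) := by
    funext x; rw [sub_smul, smul_smul]
  rw [h2, integral_sub e1 (e2.smul I : Integrable (fun x => I • (χ.normed volume x • f x))), integral_smul] at h1
  rw [integral_smul_const]
  exact sub_eq_zero.mp h1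

/-- The primitive of g has weak derivative g, so it differs from f by a constant almost everywhere.
This supplies the continuous representative on which all later pointwise arguments act. -/
theorem exists_ftc_of_hasWeakDeriv {f g : ℝ → ℂ} (hf : LocallyIntegrable f)
    (hg : LocallyIntegrable g) (h : HasWeakDeriv f g) :
    ∃ F : ℝ → ℂ, f =ᵐ[volume] F ∧ ∀ a b, F b - F a = ∫ t in a..b, g t := by
  have hi := intervalIntegrable_of_loc hg
  set G : ℝ → ℂ := fun x => ∫ t in (0 : ℝ)..x, g t
  have hG : ∀ a b, G b - G a = ∫ t in a..b, g t := fun a b =>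
    intervalIntegral.integral_interval_sub_left (hi 0 b) (hi 0 a)
  have hGc : Continuous G := intervalIntegral.continuous_primitive hi 0
  have hGw := hasWeakDeriv_of_ftc hg hG
  obtain ⟨c, hc⟩ := ae_const_of_weakDeriv_zero (hf.sub hGc.locallyIntegrable) (fun φ hφ hs => by
    have hφ1 := contDiff_one_of_infty hφ
    have e1 : Integrable (fun x => deriv φ x • f x) :=
      hf.integrable_smul_left_of_hasCompactSupport (hφ1.continuous_deriv le_rfl) hs.deriv
    have e2 : Integrable (fun x => deriv φ x • G x) :=
      hGc.locallyIntegrable.integrable_smul_left_of_hasCompactSupport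
        (hφ1.continuous_deriv le_rfl) hs.deriv
    simp only [Pi.sub_apply, smul_sub]
    rw [integral_sub e1 e2, h φ hφ hs, hGw φ hφ hs, sub_self])
  refine ⟨fun x => c + G x, ?_, fun a b => by rw [← hG]; ring⟩
  filter_upwards [hc] with x hx
  rw [← hx]; simp

end HartreeNLS

/-! ### Continuous representatives, densities and basic bounds in H¹. -/

namespace HartreeNLS

theorem integrable_sq_of_memLp {f : ℝ → ℂ} (hf : MemLp f 2) : Integrable (fun x => ‖f x‖ ^ 2) :=
  (memLp_two_iff_integrable_sq_norm hf.1).mp hf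

theorem integral_mul_le_sqrt {f g : ℝ → ℂ} (hf : MemLp f 2) (hg : MemLp g 2) :
    ∫ x, ‖f x‖ * ‖g x‖ ≤ √(∫ x, ‖f x‖ ^ 2) * √(∫ x, ‖g x‖ ^ 2) := by
  have h := integral_mul_le_Lp_mul_Lq_of_nonneg (μ := volume) Real.HolderConjugate.two_two
    (f := fun x => ‖f x‖) (g := fun x => ‖g x‖)
    (Eventually.of_forall fun x => norm_nonneg _) (Eventually.of_forall fun x => norm_nonneg _)
    (by simpa using hf.norm) (by simpa using hg.norm)
  simpa [Real.sqrt_eq_rpow] using h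

theorem integrable_norm_mul {f g : ℝ → ℂ} (hf : MemLp f 2) (hg : MemLp g 2) :
    Integrable (fun x => ‖f x‖ * ‖g x‖) :=
  hf.norm.integrable_mul hg.norm

namespace H1

variable (u : H1)

theorem loc_weakDeriv : LocallyIntegrable u.weakDeriv :=
  u.memLp_weakDeriv.locallyIntegrable (by norm_num)

theorem exists_rep : ∃ F : ℝ → ℂ, u.toFun =ᵐ[volume] F ∧
    ∀ a b, F b - F a = ∫ t in a..b, u.weakDeriv t :=
  exists_ftc_of_hasWeakDeriv (u.memLp_toFun.locallyIntegrable (by norm_num)) u.loc_weakDeriv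
    u.hasWeakDeriv

/-- The continuous representative of an `H¹` function. -/
noncomputable def rep : ℝ → ℂ := u.exists_rep.choose

theorem ae_rep : u.toFun =ᵐ[volume] u.rep := u.exists_rep.choose_spec.1

theorem rep_sub (a b : ℝ) : u.rep b - u.rep a = ∫ t in a..b, u.weakDeriv t :=
  u.exists_rep.choose_spec.2 a b

theorem memLp_rep : MemLp u.rep 2 := u.memLp_toFun.ae_eq u.ae_rep

/-- The density `|u|²` of the continuous representative. -/
noncomputable def dens (x : ℝ) : ℝ := ‖u.rep x‖ ^ 2

/-- The derivative of the density. -/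
noncomputable def dens' (x : ℝ) : ℝ :=
  2 * ((u.rep x).re * (u.weakDeriv x).re + (u.rep x).im * (u.weakDeriv x).im)

theorem acDeriv_re : ACDeriv (fun x => (u.rep x).re) (fun x => (u.weakDeriv x).re) :=
  (ACDeriv.re_im u.loc_weakDeriv u.rep_sub).1

theorem acDeriv_im : ACDeriv (fun x => (u.rep x).im) (fun x => (u.weakDeriv x).im) :=
  (ACDeriv.re_im u.loc_weakDeriv u.rep_sub).2

theorem continuous_rep : Continuous u.rep := by
  have : u.rep = fun x => ((u.rep x).re : ℂ) + (u.rep x).im * Complex.I :=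
    funext fun x => (Complex.re_add_im _).symm
  rw [this]
  exact (Complex.continuous_ofReal.comp u.acDeriv_re.continuous).add
    ((Complex.continuous_ofReal.comp u.acDeriv_im.continuous).mul continuous_const)

theorem dens_eq (x : ℝ) : u.dens x = (u.rep x).re ^ 2 + (u.rep x).im ^ 2 := by
  rw [dens, Complex.sq_norm, Complex.normSq_apply]; ring

theorem dens_nonneg (x : ℝ) : 0 ≤ u.dens x := sq_nonneg _

theorem continuous_dens : Continuous u.dens := (u.continuous_rep.norm).pow 2

theorem acDeriv_dens : ACDeriv u.dens u.dens' := by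
  have h := (u.acDeriv_re.mul u.acDeriv_re).add (u.acDeriv_im.mul u.acDeriv_im)
  convert h using 1
  · funext x; rw [dens_eq]; ring
  · funext x; simp only [dens']; ring

theorem abs_dens'_le (x : ℝ) : |u.dens' x| ≤ 2 * (‖u.rep x‖ * ‖u.weakDeriv x‖) := by
  have h : u.dens' x = 2 * ((starRingEnd ℂ) (u.rep x) * u.weakDeriv x).re := by
    simp [dens', Complex.mul_re]
  rw [h, abs_mul, abs_two]
  gcongr
  refine (Complex.abs_re_le_norm _).trans ?_
  rw [norm_mul, Complex.norm_conj]

theorem integrable_dens : Integrable u.dens := integrable_sq_of_memLp u.memLp_rep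

theorem integrable_sq_weakDeriv : Integrable (fun x => ‖u.weakDeriv x‖ ^ 2) :=
  integrable_sq_of_memLp u.memLp_weakDeriv

theorem integral_dens : ∫ x, u.dens x = mass u :=
  integral_congr_ae (by filter_upwards [u.ae_rep] with x hx; rw [dens, hx])

theorem integrable_dens' : Integrable u.dens' := by
  refine ((integrable_norm_mul u.memLp_rep u.memLp_weakDeriv).const_mul 2).mono' ?_
    (Eventually.of_forall u.abs_dens'_le)
  exact u.acDeriv_dens.loc.aestronglyMeasurable

theorem kinetic_nonneg : 0 ≤ kinetic u := integral_nonneg fun _ => sq_nonneg _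

/-- The square root of the kinetic energy. -/
noncomputable def kap : ℝ := √(kinetic u)

theorem kap_nonneg : 0 ≤ u.kap := Real.sqrt_nonneg _

theorem kap_sq : u.kap ^ 2 = kinetic u := Real.sq_sqrt u.kinetic_nonneg

variable {u}

theorem integral_abs_dens'_le (hm : mass u = 1) : ∫ x, |u.dens' x| ≤ 2 * u.kap := by
  calc ∫ x, |u.dens' x| ≤ ∫ x, 2 * (‖u.rep x‖ * ‖u.weakDeriv x‖) :=
        integral_mono u.integrable_dens'.abs
          ((integrable_norm_mul u.memLp_rep u.memLp_weakDeriv).const_mul 2) u.abs_dens'_le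
    _ = 2 * ∫ x, ‖u.rep x‖ * ‖u.weakDeriv x‖ := integral_const_mul _ _
    _ ≤ 2 * (√(∫ x, u.dens x) * √(kinetic u)) := by
        gcongr
        exact integral_mul_le_sqrt u.memLp_rep u.memLp_weakDeriv
    _ = 2 * u.kap := by rw [u.integral_dens, hm, Real.sqrt_one, one_mul]; rfl

/-- The density is integrable with total variation at most 2κ by Cauchy–Schwarz, so it cannot exceed
that variation. -/
theorem dens_le (hm : mass u = 1) (x : ℝ) : u.dens x ≤ 2 * u.kap :=
  (u.acDeriv_dens.le_of_integrable u.integrable_dens' u.integrable_dens x).trans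
    (integral_abs_dens'_le hm)

theorem integrable_dens_pow (hm : mass u = 1) (k : ℕ) (hk : 1 ≤ k) :
    Integrable (fun x => u.dens x ^ k) := by
  obtain ⟨j, rfl⟩ := Nat.exists_eq_add_of_le hk
  refine (u.integrable_dens.const_mul ((2 * u.kap) ^ j)).mono'
    (u.continuous_dens.pow _).aestronglyMeasurable (Eventually.of_forall fun x => ?_)
  rw [Real.norm_of_nonneg (pow_nonneg (u.dens_nonneg x) _), pow_add, pow_one, mul_comm]
  gcongr
  · exact u.dens_nonneg x
  · exact u.dens_nonneg x
  · exact dens_le hm x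

/-- The bound 2 is the triangle inequality for unit mass, and the linear bound is the variation
estimate. Keeping the minimum lets potentials without a first moment be treated by dominated
convergence. -/
theorem lintegral_translate_le (hm : mass u = 1) (h : ℝ) :
    ∫⁻ x, ‖u.dens (x - h) - u.dens x‖ₑ ≤ ENNReal.ofReal (2 * min 1 (|h| * u.kap)) := by
  rw [mul_min_of_nonneg _ _ (by norm_num : (0 : ℝ) ≤ 2), ENNReal.ofReal_min]
  refine le_min ?_ ?_
  · have h1 : ∫⁻ x, ‖u.dens x‖ₑ = 1 := by
      rw [← ofReal_integral_norm_eq_lintegral_enorm u.integrable_dens]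
      simp_rw [Real.norm_of_nonneg (u.dens_nonneg _)]
      rw [u.integral_dens, hm, ENNReal.ofReal_one]
    calc ∫⁻ x, ‖u.dens (x - h) - u.dens x‖ₑ
        ≤ ∫⁻ x, (‖u.dens (x - h)‖ₑ + ‖u.dens x‖ₑ) := lintegral_mono fun x => enorm_sub_le
      _ = (∫⁻ x, ‖u.dens (x - h)‖ₑ) + ∫⁻ x, ‖u.dens x‖ₑ :=
          lintegral_add_right _ u.continuous_dens.measurable.enorm
      _ = ENNReal.ofReal (2 * 1) := by
          rw [lintegral_sub_right_eq_self (fun x => ‖u.dens x‖ₑ) h, h1]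
          norm_num
  · refine (u.acDeriv_dens.integrable_translate_sub u.integrable_dens' h).trans
      (ENNReal.ofReal_le_ofReal ?_)
    have := mul_le_mul_of_nonneg_left (integral_abs_dens'_le hm) (abs_nonneg h)
    linarith

/-- Cauchy–Schwarz on the interval between a and b. The resulting 1/2-Hölder bound is the
equicontinuity behind compactness. -/
theorem norm_rep_sub_le (u : H1) (a b : ℝ) : ‖u.rep b - u.rep a‖ ≤ u.kap * √|b - a| := by
  rw [u.rep_sub]
  have h1 := intervalIntegral.norm_integral_le_integral_norm_uIoc (f := u.weakDeriv) (a := a)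
    (b := b) (μ := volume)
  refine h1.trans ?_
  have h2 := integral_mul_le_sqrt (f := (Set.uIoc a b).indicator (fun _ => (1 : ℂ)))
    (g := u.weakDeriv) (memLp_indicator_const 2 measurableSet_uIoc 1
      (Or.inr (by rw [Real.volume_uIoc]; simp))) u.memLp_weakDeriv
  have e1 : ∀ x, ‖(Set.uIoc a b).indicator (fun _ => (1 : ℂ)) x‖ * ‖u.weakDeriv x‖ =
      (Set.uIoc a b).indicator (fun x => ‖u.weakDeriv x‖) x := fun x => by
    by_cases hx : x ∈ Set.uIoc a b <;> simp [hx]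
  have e2 : ∀ x, ‖(Set.uIoc a b).indicator (fun _ => (1 : ℂ)) x‖ ^ 2 =
      (Set.uIoc a b).indicator (fun x => (1 : ℝ)) x := fun x => by
    by_cases hx : x ∈ Set.uIoc a b <;> simp [hx]
  simp_rw [e1, e2] at h2
  rw [integral_indicator measurableSet_uIoc, integral_indicator measurableSet_uIoc] at h2
  refine h2.trans (le_of_eq ?_)
  rw [mul_comm]
  congr 2
  simp [Real.volume_uIoc, measureReal_def]

theorem integral_norm_pow_four (u : H1) : ∫ x, ‖u x‖ ^ 4 = ∫ x, u.dens x ^ 2 :=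
  integral_congr_ae (by filter_upwards [u.ae_rep] with x hx; rw [dens, hx, ← pow_mul])

theorem integral_norm_pow_six (u : H1) : ∫ x, ‖u x‖ ^ 6 = ∫ x, u.dens x ^ 3 :=
  integral_congr_ae (by filter_upwards [u.ae_rep] with x hx; rw [dens, hx, ← pow_mul])

theorem trapping_eq (s : ℝ) (u : H1) :
    trapping s u = ∫⁻ x, ENNReal.ofReal (|x| ^ s * u.dens x) :=
  lintegral_congr_ae (by filter_upwards [u.ae_rep] with x hx; rw [dens, hx])

end H1

end HartreeNLS

/-! ### The sharp Gagliardo–Nirenberg inequality through the cumulative mass. -/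

namespace HartreeNLS

theorem eq_zero_of_tendsto_of_integrable {h : ℝ → ℝ} {c : ℝ} (hh : Integrable h)
    (hc : Tendsto h atTop (𝓝 c)) : c = 0 := by
  by_contra hne
  have hpos : 0 < |c| := abs_pos.mpr hne
  have h1 : ∀ᶠ x in atTop, |c| / 2 < |h x| :=
    hc.abs.eventually (lt_mem_nhds (by linarith))
  obtain ⟨R, hR⟩ := eventually_atTop.mp h1
  have h2 : IntegrableOn (fun _ : ℝ => |c| / 2) (Set.Ici R) :=
    Integrable.mono' hh.abs.integrableOn aestronglyMeasurable_const
      ((ae_restrict_iff' measurableSet_Ici).mpr (Eventually.of_forall fun x hx => by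
        rw [Real.norm_of_nonneg (by positivity)]; exact (hR x hx).le))
  rw [integrableOn_const_iff] at h2
  rcases h2 with h2 | h2
  · rw [enorm_eq_zero] at h2
    linarith
  · simp at h2

/-- The boundary terms f(R) − f(−R) converge since f' is integrable, and their limit is 0 since they
form an integrable function of R. -/
theorem ACDeriv.integral_eq_zero_of_integrable {f f' : ℝ → ℝ} (hf : ACDeriv f f')
    (hi : Integrable f) (hi' : Integrable f') : ∫ x, f' x = 0 := by
  have h1 : Tendsto (fun R : ℝ => ∫ x in (-R)..R, f' x) atTop (𝓝 (∫ x, f' x)) :=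
    intervalIntegral_tendsto_integral hi' tendsto_neg_atTop_atBot tendsto_id
  simp_rw [← hf.ftc] at h1
  exact eq_zero_of_tendsto_of_integrable (hi.sub hi.comp_neg) h1

namespace H1

variable (u : H1)

/-- The cumulative mass `∫_{-∞}^x |u|²`. -/
noncomputable def cum (x : ℝ) : ℝ := ∫ t in Set.Iic x, u.dens t

theorem cum_sub (a b : ℝ) : u.cum b - u.cum a = ∫ t in a..b, u.dens t :=
  intervalIntegral.integral_Iic_sub_Iic u.integrable_dens.integrableOn
    u.integrable_dens.integrableOn

theorem hasDerivAt_cum (x : ℝ) : HasDerivAt u.cum (u.dens x) x := by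
  have h : u.cum = fun x => u.cum 0 + ∫ t in (0 : ℝ)..x, u.dens t := funext fun x => by
    rw [← u.cum_sub]; ring
  rw [h]
  exact (intervalIntegral.integral_hasDerivAt_right (u.continuous_dens.intervalIntegrable _ _)
      (u.continuous_dens.stronglyMeasurableAtFilter _ _) u.continuous_dens.continuousAt).const_add _

theorem continuous_cum : Continuous u.cum :=
  continuous_iff_continuousAt.mpr fun x => (u.hasDerivAt_cum x).continuousAt

theorem cum_nonneg (x : ℝ) : 0 ≤ u.cum x := integral_nonneg fun t => u.dens_nonneg t

theorem cum_le_mass (x : ℝ) : u.cum x ≤ mass u := by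
  rw [← u.integral_dens]
  exact setIntegral_le_integral u.integrable_dens (Eventually.of_forall u.dens_nonneg)

theorem tendsto_cum_atTop : Tendsto u.cum atTop (𝓝 (mass u)) := by
  rw [← u.integral_dens]
  have := intervalIntegral_tendsto_integral_Ioi 0 u.integrable_dens.integrableOn tendsto_id
  have h2 : (∫ t, u.dens t) = u.cum 0 + ∫ t in Set.Ioi 0, u.dens t :=
    (intervalIntegral.integral_Iic_add_Ioi u.integrable_dens.integrableOn
      u.integrable_dens.integrableOn).symm
  rw [h2]
  refine (this.const_add (u.cum 0)).congr fun x => ?_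
  rw [← u.cum_sub]; simp

theorem tendsto_cum_atBot : Tendsto u.cum atBot (𝓝 0) := by
  have := intervalIntegral_tendsto_integral_Iic 0 u.integrable_dens.integrableOn tendsto_id
  have h3 : u.cum 0 - u.cum 0 = 0 := sub_self _
  rw [← h3]
  refine (Tendsto.const_sub (u.cum 0) this).congr fun x => ?_
  rw [← u.cum_sub]; simp

/-- The regularized angle `π (M + ε) / (1 + 2 ε)` where `M` is the cumulative mass. -/
noncomputable def angle (ε : ℝ) (x : ℝ) : ℝ := Real.pi / (1 + 2 * ε) * (u.cum x + ε)

/-- The function `u' - (c/2) cot(θ) |u|² u` which vanishes for optimizers when `ε = 0`. -/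
noncomputable def defect (ε : ℝ) (x : ℝ) : ℂ :=
  u.weakDeriv x - ((Real.pi / (1 + 2 * ε) / 2 * (Real.cos (u.angle ε x) / Real.sin (u.angle ε x))
    * u.dens x : ℝ) : ℂ) * u.rep x

theorem continuous_angle (ε : ℝ) : Continuous (u.angle ε) :=
  continuous_const.mul (u.continuous_cum.add continuous_const)

theorem hasDerivAt_angle (ε x : ℝ) :
    HasDerivAt (u.angle ε) (Real.pi / (1 + 2 * ε) * u.dens x) x :=
  ((u.hasDerivAt_cum x).add_const ε).const_mul _

variable {u}

theorem angle_mem (hm : mass u = 1) {ε : ℝ} (hε : 0 < ε) (x : ℝ) :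
    u.angle ε x ∈ Set.Icc (Real.pi / (1 + 2 * ε) * ε) (Real.pi - Real.pi / (1 + 2 * ε) * ε) := by
  have h0 := u.cum_nonneg x
  have h1 := u.cum_le_mass x
  rw [hm] at h1
  have hc : 0 < Real.pi / (1 + 2 * ε) := by positivity
  have e : Real.pi = Real.pi / (1 + 2 * ε) * (1 + 2 * ε) := by field_simp
  constructor
  · exact mul_le_mul_of_nonneg_left (by linarith) hc.le
  · rw [angle]
    nlinarith

/-- The cotangent of πM blows up where M reaches 0 or 1. The shift by ε confines the angle to a
compact subinterval of (0, π), which is the only purpose of the regularization. -/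
theorem exists_cot_bound (hm : mass u = 1) {ε : ℝ} (hε : 0 < ε) :
    (∀ x, Real.sin (u.angle ε x) ≠ 0) ∧
    ∃ B, 0 ≤ B ∧ ∀ x, |Real.cos (u.angle ε x) / Real.sin (u.angle ε x)| ≤ B := by
  set δ := Real.pi / (1 + 2 * ε) * ε
  have hδ : 0 < δ := by positivity
  have hs : ∀ θ ∈ Set.Icc δ (Real.pi - δ), Real.sin θ ≠ 0 := fun θ hθ =>
    (Real.sin_pos_of_pos_of_lt_pi (by linarith [hθ.1]) (by linarith [hθ.2])).ne'
  refine ⟨fun x => hs _ (angle_mem hm hε x), ?_⟩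
  obtain ⟨B, hB⟩ := (isCompact_Icc (a := δ) (b := Real.pi - δ)).exists_bound_of_continuousOn
    (f := fun θ => Real.cos θ / Real.sin θ)
    (Real.continuous_cos.continuousOn.div Real.continuous_sin.continuousOn hs)
  refine ⟨max B 0, le_max_right _ _, fun x => (hB _ (angle_mem hm hε x)).trans (le_max_left _ _)⟩

theorem norm_sq_defect (w z : ℂ) (k : ℝ) :
    ‖w - (k : ℂ) * z‖ ^ 2 = ‖w‖ ^ 2 - 2 * k * (z.re * w.re + z.im * w.im) + k ^ 2 * ‖z‖ ^ 2 := by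
  rw [Complex.sq_norm, Complex.sq_norm, Complex.sq_norm, Complex.normSq_apply,
    Complex.normSq_apply, Complex.normSq_apply]
  simp
  ring

/-- With F = cot(angle) and c = π/(1 + 2ε) one has F' = −cρ(1 + F²). Hence the squared defect equals
|u'|² − (c/4)(Fρ²)' − (c²/4)ρ³, and the total derivative integrates to zero. -/
theorem integral_defect (hm : mass u = 1) {ε : ℝ} (hε : 0 < ε) :
    Integrable (fun x => ‖u.defect ε x‖ ^ 2) ∧
    ∫ x, ‖u.defect ε x‖ ^ 2 =
      kinetic u - (Real.pi / (1 + 2 * ε)) ^ 2 / 4 * ∫ x, u.dens x ^ 3 := by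
  set c := Real.pi / (1 + 2 * ε) with hc
  obtain ⟨hs, B, hB0, hB⟩ := exists_cot_bound hm hε
  set F : ℝ → ℝ := fun x => Real.cos (u.angle ε x) / Real.sin (u.angle ε x) with hF
  have hFc : Continuous F :=
    (Real.continuous_cos.comp (u.continuous_angle ε)).div
      (Real.continuous_sin.comp (u.continuous_angle ε)) hs
  -- The Riccati equation of the cotangent, cot' = −(1 + cot²).
  have hFd : ∀ x, HasDerivAt F (-(c * u.dens x * (1 + F x ^ 2))) x := fun x => by
    have h1 := (u.hasDerivAt_angle ε x).cos.div (u.hasDerivAt_angle ε x).sin (hs x)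
    refine h1.congr_deriv ?_
    have := hs x
    simp only [hF, ← hc]
    field_simp
    ring
  have hFac : ACDeriv F (fun x => -(c * u.dens x * (1 + F x ^ 2))) :=
    ACDeriv.of_hasDerivAt hFd (by have := u.continuous_dens; fun_prop)
  have hG := hFac.mul (u.acDeriv_dens.mul u.acDeriv_dens)
  have i3 := integrable_dens_pow hm 3 (by norm_num)
  have i2 := integrable_dens_pow hm 2 (by norm_num)
  have iFd : Integrable (fun x => F x * (2 * u.dens x * u.dens' x)) := by
    refine (u.integrable_dens'.abs.const_mul (B * (2 * (2 * u.kap)))).mono' ?_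
      (Eventually.of_forall fun x => ?_)
    · exact hFc.aestronglyMeasurable.mul ((u.continuous_dens.const_mul 2).aestronglyMeasurable.mul
        u.integrable_dens'.1)
    · rw [norm_mul, norm_mul, norm_mul, Real.norm_eq_abs, Real.norm_eq_abs, Real.norm_eq_abs,
        Real.norm_eq_abs, abs_two, abs_of_nonneg (u.dens_nonneg x), ← mul_assoc]
      refine mul_le_mul_of_nonneg_right (mul_le_mul (hB x) ?_ ?_ hB0) (abs_nonneg _)
      · linarith [dens_le hm x]
      · linarith [u.dens_nonneg x]
  have iF3 : Integrable (fun x => F x ^ 2 * u.dens x ^ 3) := by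
    refine (i3.const_mul (B ^ 2)).mono' ?_ (Eventually.of_forall fun x => ?_)
    · exact ((hFc.pow 2).mul (u.continuous_dens.pow 3)).aestronglyMeasurable
    · rw [norm_mul, norm_pow, norm_pow, Real.norm_eq_abs, Real.norm_eq_abs,
        abs_of_nonneg (u.dens_nonneg x)]
      have := u.dens_nonneg x
      gcongr
      exact hB x
  have iG : Integrable (fun x => F x * (u.dens x * u.dens x)) := by
    refine (i2.const_mul B).mono' ?_ (Eventually.of_forall fun x => ?_)
    · exact (hFc.mul (u.continuous_dens.mul u.continuous_dens)).aestronglyMeasurable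
    · rw [norm_mul, Real.norm_eq_abs, Real.norm_of_nonneg (mul_self_nonneg _), sq]
      exact mul_le_mul_of_nonneg_right (hB x) (mul_self_nonneg _)
  have iG' : Integrable (fun x => -(c * u.dens x * (1 + F x ^ 2)) * (u.dens x * u.dens x) +
      F x * (u.dens' x * u.dens x + u.dens x * u.dens' x)) := by
    have := (((i3.add iF3).const_mul (-c))).add iFd
    refine this.congr (Eventually.of_forall fun x => ?_)
    simp only [Pi.add_apply]
    ring
  have hzero := hG.integral_eq_zero_of_integrable iG iG'
  have key : ∀ x, ‖u.defect ε x‖ ^ 2 = (‖u.weakDeriv x‖ ^ 2 -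
      c / 4 * (-(c * u.dens x * (1 + F x ^ 2)) * (u.dens x * u.dens x) +
      F x * (u.dens' x * u.dens x + u.dens x * u.dens' x))) - c ^ 2 / 4 * u.dens x ^ 3 := fun x => by
    rw [defect, norm_sq_defect]
    have h1 : (u.rep x).re * (u.weakDeriv x).re + (u.rep x).im * (u.weakDeriv x).im
        = u.dens' x / 2 := by rw [dens']; ring
    have h2 : ‖u.rep x‖ ^ 2 = u.dens x := rfl
    rw [h1, h2, ← hc]
    simp only [hF]
    ring
  simp_rw [key]
  have j1 : Integrable (fun x => ‖u.weakDeriv x‖ ^ 2 -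
      c / 4 * (-(c * u.dens x * (1 + F x ^ 2)) * (u.dens x * u.dens x) +
      F x * (u.dens' x * u.dens x + u.dens x * u.dens' x))) :=
    u.integrable_sq_weakDeriv.sub (iG'.const_mul (c / 4))
  refine ⟨j1.sub (i3.const_mul _), ?_⟩
  rw [integral_sub j1 (i3.const_mul _), integral_sub u.integrable_sq_weakDeriv (iG'.const_mul _),
    integral_const_mul, hzero, integral_const_mul]
  simp [kinetic]

theorem tendsto_coeff : Tendsto (fun n : ℕ => Real.pi / (1 + 2 * (1 / ((n : ℝ) + 1)))) atTop
    (𝓝 Real.pi) := by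
  have h1 : Tendsto (fun n : ℕ => 1 + 2 * (1 / ((n : ℝ) + 1))) atTop (𝓝 (1 + 2 * 0)) :=
    (tendsto_one_div_add_atTop_nhds_zero_nat.const_mul 2).const_add 1
  have := (tendsto_const_nhds (x := Real.pi)).div h1 (by norm_num)
  rw [mul_zero, add_zero, div_one] at this
  exact this

/-- The sharp Gagliardo–Nirenberg inequality on the line. -/
theorem gagliardo_nirenberg (hm : mass u = 1) :
    Real.pi ^ 2 / 4 * ∫ x, u.dens x ^ 3 ≤ kinetic u := by
  refine le_of_tendsto (((tendsto_coeff.pow 2).div_const 4).mul_const _)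
    (Eventually.of_forall fun n => ?_)
  have h := integral_defect hm (ε := 1 / ((n : ℝ) + 1)) (by positivity)
  have h0 : 0 ≤ ∫ x, ‖u.defect (1 / ((n : ℝ) + 1)) x‖ ^ 2 := integral_nonneg fun x => sq_nonneg _
  rw [h.2] at h0
  linarith

/-- Where the cumulative mass attains its extreme values 0 or 1, its derivative, the density,
vanishes. -/
theorem dens_eq_zero_of_cum (hm : mass u = 1) {x : ℝ} (h : u.cum x = 0 ∨ u.cum x = 1) :
    u.dens x = 0 := by
  have hd := u.hasDerivAt_cum x
  rcases h with h | h
  · exact IsLocalMin.hasDerivAt_eq_zero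
      (Eventually.of_forall fun y => by rw [h]; exact u.cum_nonneg y) hd
  · exact IsLocalMax.hasDerivAt_eq_zero
      (Eventually.of_forall fun y => by rw [h, ← hm]; exact u.cum_le_mass y) hd

theorem sin_angle_zero_pos {x : ℝ} (h0 : 0 < u.cum x) (h1 : u.cum x < 1) :
    0 < Real.sin (u.angle 0 x) := by
  have : u.angle 0 x = Real.pi * u.cum x := by simp [angle]
  rw [this]
  exact Real.sin_pos_of_pos_of_lt_pi (by positivity) (by nlinarith [Real.pi_pos])

/-- The only points where the cotangent could be singular at ε = 0 are those with cumulative mass 0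
or 1, and there it is multiplied by a vanishing density. -/
theorem tendsto_defect (hm : mass u = 1) (x : ℝ) :
    Tendsto (fun n : ℕ => u.defect (1 / ((n : ℝ) + 1)) x) atTop (𝓝 (u.defect 0 x)) := by
  by_cases hx : u.dens x = 0
  · simp only [defect, hx]; simp
  have h0 : 0 < u.cum x := (u.cum_nonneg x).lt_of_ne'
    fun h => hx (dens_eq_zero_of_cum hm (Or.inl h))
  have h1 : u.cum x < 1 := by
    refine lt_of_le_of_ne ?_ fun h => hx (dens_eq_zero_of_cum hm (Or.inr h))
    rw [← hm]; exact u.cum_le_mass x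
  have hs := (sin_angle_zero_pos h0 h1).ne'
  have ha : Tendsto (fun n : ℕ => u.angle (1 / ((n : ℝ) + 1)) x) atTop (𝓝 (u.angle 0 x)) := by
    have := tendsto_coeff.mul (tendsto_one_div_add_atTop_nhds_zero_nat.const_add (u.cum x))
    simpa [angle] using this
  have hc := tendsto_coeff
  have h2 : Tendsto (fun n : ℕ => Real.pi / (1 + 2 * (1 / ((n : ℝ) + 1))) / 2 *
      (Real.cos (u.angle (1 / ((n : ℝ) + 1)) x) / Real.sin (u.angle (1 / ((n : ℝ) + 1)) x)) *
      u.dens x) atTop (𝓝 (Real.pi / (1 + 2 * 0) / 2 *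
      (Real.cos (u.angle 0 x) / Real.sin (u.angle 0 x)) * u.dens x)) := by
    refine (Tendsto.mul ?_ ?_).mul_const _
    · simpa using hc.div_const 2
    · exact ((Real.continuous_cos.tendsto _).comp ha).div ((Real.continuous_sin.tendsto _).comp ha) hs
  exact tendsto_const_nhds.sub (((Complex.continuous_ofReal.tendsto _).comp h2).mul_const _)

/-- By Fatou as ε → 0, the squared norm of the unregularized defect is at most the
Gagliardo–Nirenberg deficit, which is zero for an optimizer. -/
theorem defect_ae_zero (hm : mass u = 1) (heq : kinetic u ≤ Real.pi ^ 2 / 4 * ∫ x, u.dens x ^ 3) :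
    ∀ᵐ x, u.defect 0 x = 0 := by
  have heq' := le_antisymm heq (gagliardo_nirenberg hm)
  have hmeas : ∀ ε, AEMeasurable (u.defect ε) := fun ε => by
    have h1 : Measurable (fun x => u.angle ε x) := (u.continuous_angle ε).measurable
    have h2 := u.continuous_dens.measurable
    have h3 := u.continuous_rep.measurable
    have h4 := u.memLp_weakDeriv.1.aemeasurable
    refine h4.sub (Measurable.aemeasurable (Measurable.mul ?_ h3))
    exact Complex.measurable_ofReal.comp
      ((measurable_const.mul ((Real.measurable_cos.comp h1).div (Real.measurable_sin.comp h1))).mul h2)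
  have hle := lintegral_liminf_le' (μ := volume) (u := (atTop : Filter ℕ))
    (f := fun (n : ℕ) x => ENNReal.ofReal (‖u.defect (1 / ((n : ℝ) + 1)) x‖ ^ 2))
    (fun n => ((hmeas _).norm.pow_const 2).ennreal_ofReal)
  have hlim : ∀ x, liminf (fun n : ℕ => ENNReal.ofReal (‖u.defect (1 / ((n : ℝ) + 1)) x‖ ^ 2))
      atTop = ENNReal.ofReal (‖u.defect 0 x‖ ^ 2) := fun x =>
    ((ENNReal.continuous_ofReal.tendsto _).comp ((tendsto_defect hm x).norm.pow 2)).liminf_eq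
  simp_rw [hlim] at hle
  have hval : ∀ n : ℕ, ∫⁻ x, ENNReal.ofReal (‖u.defect (1 / ((n : ℝ) + 1)) x‖ ^ 2) =
      ENNReal.ofReal (kinetic u - (Real.pi / (1 + 2 * (1 / ((n : ℝ) + 1)))) ^ 2 / 4 *
        ∫ x, u.dens x ^ 3) := fun n => by
    have h := integral_defect hm (ε := 1 / ((n : ℝ) + 1)) (by positivity)
    rw [← h.2, ofReal_integral_eq_lintegral_ofReal h.1 (Eventually.of_forall fun x => sq_nonneg _)]
  simp_rw [hval] at hle
  have h0 : Tendsto (fun n : ℕ => ENNReal.ofReal (kinetic u -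
      (Real.pi / (1 + 2 * (1 / ((n : ℝ) + 1)))) ^ 2 / 4 * ∫ x, u.dens x ^ 3)) atTop (𝓝 0) := by
    have := (((tendsto_coeff.pow 2).div_const 4).mul_const (∫ x, u.dens x ^ 3)).const_sub (kinetic u)
    have h := (ENNReal.continuous_ofReal.tendsto _).comp this
    rw [heq', sub_self, ENNReal.ofReal_zero] at h
    rw [heq']
    exact h
  rw [h0.liminf_eq, nonpos_iff_eq_zero, lintegral_eq_zero_iff'
    (((hmeas _).norm.pow_const 2).ennreal_ofReal)] at hle
  filter_upwards [hle] with x hx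
  simp only [Pi.zero_apply, ENNReal.ofReal_eq_zero] at hx
  have := le_antisymm hx (sq_nonneg _)
  simpa using this

end H1

end HartreeNLS

/-! ### Classification of the Gagliardo–Nirenberg optimizers. -/

namespace HartreeNLS

namespace H1

variable (u : H1)

/-- The region where the cumulative mass is neither `0` nor `1`. -/
def region : Set ℝ := {x | 0 < u.cum x ∧ u.cum x < 1}

theorem isOpen_region : IsOpen u.region :=
  (isOpen_lt continuous_const u.continuous_cum).inter (isOpen_lt u.continuous_cum continuous_const)

theorem cum_mono : Monotone u.cum := fun x y hxy => by
  have h := u.cum_sub x y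
  have h0 : 0 ≤ ∫ t in x..y, u.dens t :=
    intervalIntegral.integral_nonneg hxy fun t _ => u.dens_nonneg t
  linarith

theorem ordConnected_region : u.region.OrdConnected :=
  ⟨fun _ hx _ hy _ hz => ⟨hx.1.trans_le (u.cum_mono hz.1), (u.cum_mono hz.2).trans_lt hy.2⟩⟩

/-- The logarithmic derivative of an optimizer. -/
noncomputable def logd (x : ℝ) : ℝ :=
  Real.pi / 2 * (Real.cos (Real.pi * u.cum x) / Real.sin (Real.pi * u.cum x)) * u.dens x

variable {u}

theorem sin_pos_of_region {x : ℝ} (hx : x ∈ u.region) : 0 < Real.sin (Real.pi * u.cum x) := by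
  have := sin_angle_zero_pos hx.1 hx.2
  simpa [angle] using this

theorem continuousOn_logd : ContinuousOn u.logd u.region := by
  have h1 : Continuous fun x => Real.pi * u.cum x := continuous_const.mul u.continuous_cum
  exact (continuousOn_const.mul ((Real.continuous_cos.comp h1).continuousOn.div
    (Real.continuous_sin.comp h1).continuousOn fun x hx => (sin_pos_of_region hx).ne')).mul
    u.continuous_dens.continuousOn

theorem nonempty_region (hm : mass u = 1) : u.region.Nonempty := by
  obtain ⟨x, hx⟩ := mem_range_of_exists_le_of_exists_ge (c := (1 / 2 : ℝ)) u.continuous_cum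
    (by
      have := u.tendsto_cum_atBot.eventually (ge_mem_nhds (by norm_num : (0 : ℝ) < 1 / 2))
      exact this.exists)
    (by
      have := u.tendsto_cum_atTop.eventually (le_mem_nhds (by rw [hm]; norm_num : (1 / 2 : ℝ) < _))
      exact this.exists)
  exact ⟨x, by rw [region, Set.mem_ofPred_eq, hx]; norm_num⟩

/-- An almost everywhere equation for the derivative becomes a classical one when its right-hand
side is continuous. This turns the vanishing defect into a genuine ODE on the open region. -/
theorem hasDerivAt_of_ae {E : Type*} [NormedAddCommGroup E] [NormedSpace ℝ E] [CompleteSpace E]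
    {f g h : ℝ → E} {S : Set ℝ} (hS : IsOpen S) (hf : ∀ a b, f b - f a = ∫ t in a..b, g t)
    (hgh : ∀ᵐ t, t ∈ S → g t = h t) (hh : ContinuousOn h S) {x : ℝ} (hx : x ∈ S) :
    HasDerivAt f (h x) x := by
  obtain ⟨r, hr, hball⟩ := Metric.isOpen_iff.mp hS x hx
  have hsub : ∀ y ∈ Metric.ball x r, Set.uIcc x y ⊆ S := fun y hy =>
    ((convex_ball x r).ordConnected.uIcc_subset (Metric.mem_ball_self hr) hy).trans hball
  have e : ∀ᶠ y in 𝓝 x, f y = f x + ∫ t in x..y, h t := by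
    filter_upwards [Metric.ball_mem_nhds x hr] with y hy
    rw [← sub_eq_iff_eq_add', hf]
    apply intervalIntegral.integral_congr_ae
    filter_upwards [hgh] with t ht htm
    exact ht (hsub y hy (Set.uIoc_subset_uIcc htm))
  refine HasDerivAt.congr_of_eventuallyEq ?_ e
  refine (intervalIntegral.integral_hasDerivAt_right (by simp)
    (hh.stronglyMeasurableAtFilter hS x hx) (hh.continuousAt (hS.mem_nhds hx))).const_add _

theorem weakDeriv_ae_eq (hm : mass u = 1)
    (heq : kinetic u ≤ Real.pi ^ 2 / 4 * ∫ x, u.dens x ^ 3) :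
    ∀ᵐ x, u.weakDeriv x = (u.logd x : ℂ) * u.rep x := by
  filter_upwards [defect_ae_zero hm heq] with x hx
  rw [defect, sub_eq_zero] at hx
  rw [hx, logd]
  simp [angle]

theorem hasDerivAt_rep_of_eq (hm : mass u = 1)
    (heq : kinetic u ≤ Real.pi ^ 2 / 4 * ∫ x, u.dens x ^ 3) {x : ℝ} (hx : x ∈ u.region) :
    HasDerivAt u.rep ((u.logd x : ℂ) * u.rep x) x := by
  refine hasDerivAt_of_ae (h := fun x => (u.logd x : ℂ) * u.rep x) u.isOpen_region u.rep_sub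
    (by filter_upwards [weakDeriv_ae_eq hm heq] with t ht _ using ht) ?_ hx
  exact (Complex.continuous_ofReal.comp_continuousOn continuousOn_logd).mul
    u.continuous_rep.continuousOn

theorem hasDerivAt_dens_of_eq (hm : mass u = 1)
    (heq : kinetic u ≤ Real.pi ^ 2 / 4 * ∫ x, u.dens x ^ 3) {x : ℝ} (hx : x ∈ u.region) :
    HasDerivAt u.dens (2 * u.logd x * u.dens x) x := by
  refine hasDerivAt_of_ae (h := fun x => 2 * u.logd x * u.dens x) u.isOpen_region
    u.acDeriv_dens.ftc ?_ ?_ hx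
  · filter_upwards [weakDeriv_ae_eq hm heq] with t ht _
    rw [dens', ht, dens_eq]
    simp
    ring
  · exact (continuousOn_const.mul continuousOn_logd).mul u.continuous_dens.continuousOn

theorem exists_const_of_hasDerivAt_zero {E : Type*} [NormedAddCommGroup E] [NormedSpace ℝ E]
    {f : ℝ → E} {S : Set ℝ} (hS : IsOpen S) (hc : S.OrdConnected)
    (hf : ∀ x ∈ S, HasDerivAt f 0 x) : ∃ a, ∀ x ∈ S, f x = a := by
  exact hS.exists_is_const_of_deriv_eq_zero hc.isPreconnected
    (fun x hx => (hf x hx).differentiableAt.differentiableWithinAt)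
    (fun x hx => (hf x hx).deriv)

/-- The ODE ρ' = π cot(πM) ρ² makes ρ / sin(πM) constant, say l. Then M' = l sin(πM), so log
tan(πM/2) is affine with slope πl. -/
theorem exists_cum_eq (hm : mass u = 1)
    (heq : kinetic u ≤ Real.pi ^ 2 / 4 * ∫ x, u.dens x ^ 3) :
    ∃ l k : ℝ, ∀ x, u.cum x = 2 / Real.pi * Real.arctan (Real.exp (Real.pi * l * x + k)) ∧
      u.dens x = l * Real.sin (Real.pi * u.cum x) := by
  have hpi := Real.pi_pos
  have hsd : ∀ x, HasDerivAt (fun x => Real.sin (Real.pi * u.cum x))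
      (Real.cos (Real.pi * u.cum x) * (Real.pi * u.dens x)) x := fun x =>
    ((u.hasDerivAt_cum x).const_mul Real.pi).sin
  obtain ⟨l, hl⟩ := exists_const_of_hasDerivAt_zero
    (f := fun x => u.dens x / Real.sin (Real.pi * u.cum x)) u.isOpen_region u.ordConnected_region
    (fun x hx => by
      have hs := (sin_pos_of_region hx).ne'
      refine ((hasDerivAt_dens_of_eq hm heq hx).div (hsd x) hs).congr_deriv ?_
      rw [logd]
      field_simp
      ring)
  have hl' : ∀ x ∈ u.region, u.dens x = l * Real.sin (Real.pi * u.cum x) := fun x hx => by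
    rw [← hl x hx, div_mul_cancel₀ _ (sin_pos_of_region hx).ne']
  have hhalf : ∀ x ∈ u.region, 0 < Real.pi * u.cum x / 2 ∧ Real.pi * u.cum x / 2 < Real.pi / 2 :=
    fun x hx => ⟨by have := hx.1; positivity, by have := hx.2; nlinarith⟩
  have hpos : ∀ x ∈ u.region, 0 < Real.cos (Real.pi * u.cum x / 2) ∧
      0 < Real.sin (Real.pi * u.cum x / 2) := fun x hx => by
    obtain ⟨h1, h2⟩ := hhalf x hx
    exact ⟨Real.cos_pos_of_mem_Ioo ⟨by linarith, h2⟩,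
      Real.sin_pos_of_pos_of_lt_pi h1 (by linarith)⟩
  obtain ⟨k, hk⟩ := exists_const_of_hasDerivAt_zero
    (f := fun x => Real.log (Real.tan (Real.pi * u.cum x / 2)) - Real.pi * l * x)
    u.isOpen_region u.ordConnected_region
    (fun x hx => by
      obtain ⟨hc, hs⟩ := hpos x hx
      have h1 : HasDerivAt (fun x => Real.pi * u.cum x / 2) (Real.pi * u.dens x / 2) x :=
        ((u.hasDerivAt_cum x).const_mul Real.pi).div_const 2
      have ht : Real.tan (Real.pi * u.cum x / 2) ≠ 0 := by
        rw [Real.tan_eq_sin_div_cos]; positivity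
      have h2 := (HasDerivAt.comp (h₂ := Real.tan) x (Real.hasDerivAt_tan hc.ne') h1).log ht
      refine (h2.sub ((hasDerivAt_id x).const_mul (Real.pi * l))).congr_deriv ?_
      have e : Real.sin (Real.pi * u.cum x) =
          2 * Real.sin (Real.pi * u.cum x / 2) * Real.cos (Real.pi * u.cum x / 2) := by
        rw [← Real.sin_two_mul]; ring_nf
      simp only [Function.comp]
      rw [hl' x hx, e, Real.tan_eq_sin_div_cos]
      field_simp
      ring)
  set N : ℝ → ℝ := fun x => 2 / Real.pi * Real.arctan (Real.exp (Real.pi * l * x + k)) with hN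
  have hNc : Continuous N := continuous_const.mul (Real.continuous_arctan.comp
    (Real.continuous_exp.comp ((continuous_const.mul continuous_id).add continuous_const)))
  -- The explicit profile takes values strictly between 0 and 1, so agreement with it characterizes
  -- the region by a closed condition. The region is then open, closed and nonempty, hence the whole
  -- line.
  have hreg : ∀ x, x ∈ u.region ↔ u.cum x = N x := fun x => by
    constructor
    · intro hx
      obtain ⟨hc, hs⟩ := hpos x hx
      obtain ⟨h1, h2⟩ := hhalf x hx
      have ht : 0 < Real.tan (Real.pi * u.cum x / 2) := by
        rw [Real.tan_eq_sin_div_cos]; positivity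
      have e1 : Real.pi * l * x + k = Real.log (Real.tan (Real.pi * u.cum x / 2)) := by
        rw [← hk x hx]; ring
      simp only [hN]
      rw [e1, Real.exp_log ht, Real.arctan_tan (by linarith) h2]
      field_simp
    · intro h
      have h1 : 0 < Real.arctan (Real.exp (Real.pi * l * x + k)) :=
        Real.arctan_pos.mpr (Real.exp_pos _)
      have h2 := Real.arctan_lt_pi_div_two (Real.exp (Real.pi * l * x + k))
      refine ⟨by rw [h]; simp only [hN]; positivity, ?_⟩
      rw [h]
      simp only [hN]
      rw [div_mul_eq_mul_div, div_lt_one hpi]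
      linarith
  have huniv : u.region = Set.univ := by
    refine IsClopen.eq_univ ⟨?_, u.isOpen_region⟩ (nonempty_region hm)
    have : u.region = {x | u.cum x = N x} := Set.ext hreg
    rw [this]
    exact isClosed_eq u.continuous_cum hNc
  exact ⟨l, k, fun x => ⟨(hreg x).mp (by rw [huniv]; trivial), hl' x (by rw [huniv]; trivial)⟩⟩

theorem sin_two_arctan_exp (z : ℝ) : Real.sin (2 * Real.arctan (Real.exp z)) = 1 / Real.cosh z := by
  rw [Real.sin_two_mul, Real.sin_arctan, Real.cos_arctan, Real.cosh_eq, Real.exp_neg]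
  have h1 : (0 : ℝ) < 1 + Real.exp z ^ 2 := by positivity
  have h2 := Real.exp_pos z
  have h3 : √(1 + Real.exp z ^ 2) ^ 2 = 1 + Real.exp z ^ 2 := Real.sq_sqrt h1.le
  have h4 : 0 < √(1 + Real.exp z ^ 2) := Real.sqrt_pos.mpr h1
  field_simp
  rw [h3]
  ring

theorem _root_.HartreeNLS.Q₀_sq (x : ℝ) : Q₀ x ^ 2 = 1 / Real.cosh (Real.pi * x) := by
  rw [Q₀, div_pow, one_pow, Real.sq_sqrt (Real.cosh_pos _).le]

theorem _root_.HartreeNLS.Q₀_pos (x : ℝ) : 0 < Q₀ x :=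
  one_div_pos.mpr (Real.sqrt_pos.mpr (Real.cosh_pos _))

/-- Optimizers of the sharp Gagliardo–Nirenberg inequality. -/
theorem exists_eq_of_optimizer (hm : mass u = 1)
    (heq : kinetic u ≤ Real.pi ^ 2 / 4 * ∫ x, u.dens x ^ 3) :
    ∃ (l x₀ : ℝ) (z : ℂ), 0 < l ∧ ‖z‖ = 1 ∧ ∀ x, u.rep x = z * (√l * Q₀ (l * (x - x₀)) : ℝ) := by
  have hpi := Real.pi_pos
  obtain ⟨l, k, h⟩ := exists_cum_eq hm heq
  have hcum := fun x => (h x).1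
  have hd : ∀ x, u.dens x = l / Real.cosh (Real.pi * l * x + k) := fun x => by
    rw [(h x).2, hcum]
    have : Real.pi * (2 / Real.pi * Real.arctan (Real.exp (Real.pi * l * x + k))) =
      2 * Real.arctan (Real.exp (Real.pi * l * x + k)) := by field_simp
    rw [this, sin_two_arctan_exp]; ring
  have hl0 : 0 ≤ l := by
    have := u.dens_nonneg 0
    rw [hd 0] at this
    by_contra! hneg
    exact absurd this (not_le.mpr (div_neg_of_neg_of_pos hneg (Real.cosh_pos _)))
  -- For l = 0 the cumulative mass would be constant, although it tends to 0 on the left and to 1 on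
  -- the right.
  have hl : 0 < l := by
    refine lt_of_le_of_ne hl0 fun h0 => ?_
    have h1 : ∀ x, u.cum x = u.cum 0 := fun x => by rw [hcum, hcum 0, ← h0]; simp
    have h2 : u.cum = fun _ => u.cum 0 := funext h1
    have h3 := u.tendsto_cum_atBot
    have h4 := u.tendsto_cum_atTop
    rw [h2] at h3 h4
    have e1 := tendsto_nhds_unique h3 tendsto_const_nhds
    have e2 := tendsto_nhds_unique h4 tendsto_const_nhds
    rw [hm] at e2
    linarith
  set x₀ := -k / (Real.pi * l) with hx₀
  have harg : ∀ x, Real.pi * l * x + k = Real.pi * (l * (x - x₀)) := fun x => by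
    rw [hx₀]; field_simp; ring
  set q : ℝ → ℝ := fun x => √l * Q₀ (l * (x - x₀)) with hq
  have hqpos : ∀ x, 0 < q x := fun x => mul_pos (Real.sqrt_pos.mpr hl) (Q₀_pos _)
  have hq2 : ∀ x, q x ^ 2 = u.dens x := fun x => by
    rw [hd, harg]; simp only [hq]; rw [mul_pow, Real.sq_sqrt hl0, Q₀_sq]; ring
  have hqe : ∀ x, q x = √(u.dens x) := fun x => by rw [← hq2, Real.sqrt_sq (hqpos x).le]
  have hdpos : ∀ x, 0 < u.dens x := fun x => by rw [← hq2]; have := hqpos x; positivity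
  have hreg : u.region = Set.univ := by
    ext x
    simp only [Set.mem_univ, iff_true]
    refine ⟨(u.cum_nonneg x).lt_of_ne' fun h0 => ?_, lt_of_le_of_ne ?_ fun h0 => ?_⟩
    · exact (hdpos x).ne' (dens_eq_zero_of_cum hm (Or.inl h0))
    · rw [← hm]; exact u.cum_le_mass x
    · exact (hdpos x).ne' (dens_eq_zero_of_cum hm (Or.inr h0))
  have hqd : ∀ x, HasDerivAt q (u.logd x * q x) x := fun x => by
    have h1 := (hasDerivAt_dens_of_eq hm heq (x := x) (by rw [hreg]; trivial)).sqrt (hdpos x).ne'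
    have h2 : q = fun x => √(u.dens x) := funext hqe
    rw [h2]
    refine h1.congr_deriv ?_
    change _ = u.logd x * √(u.dens x)
    have h3 : √(u.dens x) ^ 2 = u.dens x := Real.sq_sqrt (hdpos x).le
    have h4 : 0 < √(u.dens x) := Real.sqrt_pos.mpr (hdpos x)
    field_simp
    rw [h3]
  -- Both u and its modulus solve the linear equation f' = `logd` · f, so their quotient is
  -- constant. This constant is the phase.
  obtain ⟨z, hz⟩ := exists_const_of_hasDerivAt_zero (f := fun x => u.rep x / (q x : ℂ))
    isOpen_univ Set.ordConnected_univ (fun x _ => by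
      have h1 := hasDerivAt_rep_of_eq hm heq (x := x) (by rw [hreg]; trivial)
      have h0 : (q x : ℂ) ≠ 0 := by exact_mod_cast (hqpos x).ne'
      refine (h1.div (hqd x).ofReal_comp h0).congr_deriv ?_
      push_cast
      field_simp
      ring)
  have hz' : ∀ x, u.rep x = z * (q x : ℂ) := fun x => by
    have h0 : (q x : ℂ) ≠ 0 := by exact_mod_cast (hqpos x).ne'
    rw [← hz x trivial, div_mul_cancel₀ _ h0]
  refine ⟨l, x₀, z, hl, ?_, hz'⟩
  have h1 : ‖u.rep 0‖ = ‖z‖ * q 0 := by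
    rw [hz', norm_mul, Complex.norm_real, Real.norm_of_nonneg (hqpos 0).le]
  have h2 : ‖u.rep 0‖ = q 0 := by rw [hqe, dens, Real.sqrt_sq (norm_nonneg _)]
  rw [h2] at h1
  exact (mul_eq_right₀ (hqpos 0).ne').mp h1.symm

end H1

end HartreeNLS

/-! ### Nonlocal interactions as averages of density correlations. -/

namespace HartreeNLS

section Convolution

variable {G : Type*} [NormedAddCommGroup G] [NormedSpace ℝ G] [FiniteDimensional ℝ G]
  [MeasureSpace G] [BorelSpace G] [(volume : Measure G).IsAddHaarMeasure]

theorem measurePreserving_shear {ι : ℝ → G} (hι : Measurable ι) :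
    MeasurePreserving (fun p : ℝ × G => (p.1, ι p.1 - p.2)) (volume.prod volume)
      (volume.prod volume) := by
  refine (MeasurePreserving.id volume).skew_product (g := fun x q => ι x - q) ?_ ?_
  · exact (hι.comp measurable_fst).sub measurable_snd
  · exact Eventually.of_forall fun x => (Measure.measurePreserving_sub_left volume (ι x)).map_eq

/-- The shear (x, q) ↦ (x, ι x − q) preserves measure and turns the interaction into an average
against V. Taking ι as the identity or the diagonal x ↦ (x, x) covers the two- and three-body cases
at once. -/
theorem integral_conv_form {ι : ℝ → G} (hι : Measurable ι) {V : G → ℝ} (hV : Integrable V)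
    {ρ : ℝ → ℝ} (hρ : Integrable ρ) {R : G → ℝ} (hR : Measurable R) {C : ℝ} (hC : ∀ q, |R q| ≤ C) :
    ∫ p : ℝ × G, V (ι p.1 - p.2) * (ρ p.1 * R p.2) ∂(volume.prod volume) =
      ∫ q, V q * ∫ x, ρ x * R (ι x - q) := by
  have hT := measurePreserving_shear hι
  have hm : AEStronglyMeasurable (fun p : ℝ × G => V p.2 * (ρ p.1 * R (ι p.1 - p.2)))
      (volume.prod volume) := by
    refine hV.1.comp_snd.mul (hρ.1.comp_fst.mul ?_)
    exact (hR.comp ((hι.comp measurable_fst).sub measurable_snd)).aestronglyMeasurable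
  have hH : Integrable (fun p : ℝ × G => V p.2 * (ρ p.1 * R (ι p.1 - p.2)))
      (volume.prod volume) := by
    refine ((hρ.norm.mul_prod hV.norm).const_mul C).mono' hm (Eventually.of_forall fun p => ?_)
    rw [norm_mul, norm_mul, Real.norm_eq_abs (R _)]
    have h1 := mul_le_mul_of_nonneg_left (hC (ι p.1 - p.2))
      (mul_nonneg (norm_nonneg (ρ p.1)) (norm_nonneg (V p.2)))
    calc _ = ‖ρ p.1‖ * ‖V p.2‖ * |R (ι p.1 - p.2)| := by ring
      _ ≤ _ := by rw [mul_comm C]; exact h1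
  have h1 : ∫ p : ℝ × G, V (ι p.1 - p.2) * (ρ p.1 * R p.2) ∂(volume.prod volume) =
      ∫ p : ℝ × G, V p.2 * (ρ p.1 * R (ι p.1 - p.2)) ∂(volume.prod volume) := by
    have h2 := integral_map (μ := (volume : Measure ℝ).prod (volume : Measure G))
      hT.measurable.aemeasurable (f := fun p : ℝ × G => V p.2 * (ρ p.1 * R (ι p.1 - p.2)))
      (by rw [hT.map_eq]; exact hm)
    rw [hT.map_eq] at h2
    rw [h2]
    simp
  rw [h1, integral_prod_symm _ hH]
  simp_rw [integral_const_mul]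

theorem integral_scaled_mul {V Φ : G → ℝ} {r : ℝ} (hr : 0 < r) :
    ∫ q, (r ^ Module.finrank ℝ G * V (r • q)) * Φ q = ∫ q, V q * Φ (r⁻¹ • q) := by
  have h := Measure.integral_comp_smul (volume : Measure G)
    (fun q => r ^ Module.finrank ℝ G * (V q * Φ (r⁻¹ • q))) r
  simp only [smul_smul, inv_mul_cancel₀ hr.ne', one_smul] at h
  simp_rw [mul_assoc]
  rw [h, integral_const_mul, abs_of_pos (by positivity), smul_eq_mul, ← mul_assoc,
    inv_mul_cancel₀ (by positivity), one_mul]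

theorem integrable_scaled {V : G → ℝ} (hV : Integrable V) {r : ℝ} (hr : 0 < r) :
    Integrable (fun q => r ^ Module.finrank ℝ G * V (r • q)) :=
  (hV.comp_smul hr.ne').const_mul _

end Convolution

/-- Averages of a bounded function against a probability density. -/
theorem integral_mul_density_bounds {G : Type*} [MeasureSpace G] {V Φ e : G → ℝ} (hV : Integrable V) (hV0 : ∀ᵐ q, 0 ≤ V q)
    (hV1 : ∫ q, V q = 1) (hΦm : Measurable Φ) {P : ℝ} (h0 : ∀ q, 0 ≤ Φ q) (hP : ∀ q, Φ q ≤ P)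
    (he : ∀ q, P - Φ q ≤ e q) (hie : Integrable (fun q => V q * e q)) :
    0 ≤ ∫ q, V q * Φ q ∧ ∫ q, V q * Φ q ≤ P ∧ P - ∫ q, V q * Φ q ≤ ∫ q, V q * e q := by
  have hi : Integrable (fun q => V q * Φ q) := by
    refine (hV.norm.const_mul P).mono' (hV.1.mul hΦm.aestronglyMeasurable)
      (Eventually.of_forall fun q => ?_)
    rw [norm_mul, Real.norm_of_nonneg (h0 q), mul_comm]
    exact mul_le_mul_of_nonneg_right (hP q) (norm_nonneg _)
  have hPi : ∫ q, V q * P = P := by rw [integral_mul_const, hV1, one_mul]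
  refine ⟨integral_nonneg_of_ae ?_, ?_, ?_⟩
  · filter_upwards [hV0] with q hq using mul_nonneg hq (h0 q)
  · rw [← hPi]
    refine integral_mono_ae hi (hV.mul_const P) ?_
    filter_upwards [hV0] with q hq using mul_le_mul_of_nonneg_left (hP q) hq
  · nth_rw 1 [← hPi]
    rw [← integral_sub (hV.mul_const P) hi]
    refine integral_mono_ae ((hV.mul_const P).sub hi) hie ?_
    filter_upwards [hV0] with q hq
    rw [← mul_sub]
    exact mul_le_mul_of_nonneg_left (he q) hq

namespace H1

variable (u : H1)

/-- Correlation `∫ ρ(x) ρ(x - q) dx` of the density. -/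
noncomputable def corr₂ (q : ℝ) : ℝ := ∫ x, u.dens x * u.dens (x - q)

/-- Correlation `∫ ρ(x) ρ(x - q₁) ρ(x - q₂) dx` of the density. -/
noncomputable def corr₃ (q : ℝ × ℝ) : ℝ :=
  ∫ x, u.dens x * (u.dens (x - q.1) * u.dens (x - q.2))

theorem measurable_corr₂ : Measurable u.corr₂ := by
  have h : StronglyMeasurable (fun p : ℝ × ℝ => u.dens p.2 * u.dens (p.2 - p.1)) := by
    have := u.continuous_dens
    exact (by fun_prop : Continuous (fun p : ℝ × ℝ => u.dens p.2 * u.dens (p.2 - p.1))).stronglyMeasurable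
  exact h.integral_prod_right.measurable

theorem measurable_corr₃ : Measurable u.corr₃ := by
  have h : StronglyMeasurable (fun p : (ℝ × ℝ) × ℝ =>
      u.dens p.2 * (u.dens (p.2 - p.1.1) * u.dens (p.2 - p.1.2))) := by
    have := u.continuous_dens
    exact (by fun_prop : Continuous (fun p : (ℝ × ℝ) × ℝ =>
      u.dens p.2 * (u.dens (p.2 - p.1.1) * u.dens (p.2 - p.1.2)))).stronglyMeasurable
  exact h.integral_prod_right.measurable

theorem corr₂_nonneg (q : ℝ) : 0 ≤ u.corr₂ q :=
  integral_nonneg fun _ => mul_nonneg (u.dens_nonneg _) (u.dens_nonneg _)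

theorem corr₃_nonneg (q : ℝ × ℝ) : 0 ≤ u.corr₃ q :=
  integral_nonneg fun _ =>
    mul_nonneg (u.dens_nonneg _) (mul_nonneg (u.dens_nonneg _) (u.dens_nonneg _))

variable {u}

theorem integrable_dens_mul (u : H1) {g : ℝ → ℝ} (hg : Continuous g) {C : ℝ}
    (hC : ∀ x, |g x| ≤ C) : Integrable (fun x => u.dens x * g x) := by
  refine (u.integrable_dens.mul_const C).mono' (u.continuous_dens.mul hg).aestronglyMeasurable
    (Eventually.of_forall fun x => ?_)
  rw [norm_mul, Real.norm_of_nonneg (u.dens_nonneg x)]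
  exact mul_le_mul_of_nonneg_left (hC x) (u.dens_nonneg x)

theorem abs_dens_le (hm : mass u = 1) (x : ℝ) : |u.dens x| ≤ 2 * u.kap := by
  rw [abs_of_nonneg (u.dens_nonneg x)]; exact dens_le hm x

theorem abs_dens_mul_le (hm : mass u = 1) (x y : ℝ) :
    |u.dens x * u.dens y| ≤ (2 * u.kap) * (2 * u.kap) := by
  rw [abs_mul]
  exact mul_le_mul (abs_dens_le hm x) (abs_dens_le hm y) (abs_nonneg _)
    (by have := u.kap_nonneg; positivity)

theorem continuous_dens_translate (u : H1) (q : ℝ) : Continuous (fun x => u.dens (x - q)) :=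
  u.continuous_dens.comp (continuous_id.sub continuous_const)

theorem integrable_translate_sub (u : H1) (q : ℝ) :
    Integrable (fun x => |u.dens (x - q) - u.dens x|) :=
  ((u.integrable_dens.comp_sub_right q).sub u.integrable_dens).abs

theorem integral_translate_le (hm : mass u = 1) (q : ℝ) :
    ∫ x, |u.dens (x - q) - u.dens x| ≤ 2 * min 1 (|q| * u.kap) := by
  have h0 : 0 ≤ 2 * min 1 (|q| * u.kap) :=
    mul_nonneg (by norm_num) (le_min (by norm_num) (mul_nonneg (abs_nonneg _) u.kap_nonneg))
  have h := lintegral_translate_le hm q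
  have hi : Integrable (fun x => u.dens (x - q) - u.dens x) :=
    (u.integrable_dens.comp_sub_right q).sub u.integrable_dens
  rw [← ofReal_integral_norm_eq_lintegral_enorm hi, ENNReal.ofReal_le_ofReal_iff h0] at h
  exact h

/-- Apply ab ≤ (a² + b²)/2 pointwise and use translation invariance. -/
theorem corr₂_le (hm : mass u = 1) (q : ℝ) : u.corr₂ q ≤ ∫ x, u.dens x ^ 2 := by
  have i2 := integrable_dens_pow hm 2 (by norm_num)
  have i2' := i2.comp_sub_right q
  calc u.corr₂ q ≤ ∫ x, (u.dens x ^ 2 / 2 + u.dens (x - q) ^ 2 / 2) := by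
        refine integral_mono (integrable_dens_mul u (u.continuous_dens_translate q)
          fun x => abs_dens_le hm _) ((i2.div_const 2).add (i2'.div_const 2)) fun x => ?_
        have := sq_nonneg (u.dens x - u.dens (x - q))
        simp only
        linarith
    _ = ∫ x, u.dens x ^ 2 := by
        rw [integral_add (i2.div_const 2) (i2'.div_const 2), integral_div, integral_div,
          integral_sub_right_eq_self (fun x => u.dens x ^ 2) q]
        ring

theorem amgm_three {a b c : ℝ} (ha : 0 ≤ a) (hb : 0 ≤ b) (hc : 0 ≤ c) :
    a * (b * c) ≤ a ^ 3 / 3 + b ^ 3 / 3 + c ^ 3 / 3 := by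
  have h : 0 ≤ (a + b + c) * ((a - b) ^ 2 + (b - c) ^ 2 + (c - a) ^ 2) := by positivity
  nlinarith [h]

theorem corr₃_le (hm : mass u = 1) (q : ℝ × ℝ) : u.corr₃ q ≤ ∫ x, u.dens x ^ 3 := by
  have i3 := integrable_dens_pow hm 3 (by norm_num)
  have i1 := (i3.comp_sub_right q.1).div_const 3
  have i2 := (i3.comp_sub_right q.2).div_const 3
  have i0 := i3.div_const 3
  calc u.corr₃ q ≤ ∫ x, (u.dens x ^ 3 / 3 + u.dens (x - q.1) ^ 3 / 3 + u.dens (x - q.2) ^ 3 / 3) := by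
        refine integral_mono (integrable_dens_mul u ((u.continuous_dens_translate q.1).mul
          (u.continuous_dens_translate q.2)) fun x => abs_dens_mul_le hm _ _)
          ((i0.add i1).add i2) fun x => ?_
        exact amgm_three (u.dens_nonneg _) (u.dens_nonneg _) (u.dens_nonneg _)
    _ = ∫ x, u.dens x ^ 3 := by
        rw [integral_add (by exact i0.add i1) i2, integral_add i0 i1, integral_div, integral_div,
          integral_div, integral_sub_right_eq_self (fun x => u.dens x ^ 3) q.1,
          integral_sub_right_eq_self (fun x => u.dens x ^ 3) q.2]
        ring

/-- The error is ∫ρ (ρ − ρ(· − q)); bound one factor by the supremum 2κ and the other by the L¹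
translation estimate. -/
theorem corr₂_error (hm : mass u = 1) (q : ℝ) :
    (∫ x, u.dens x ^ 2) - u.corr₂ q ≤ 4 * u.kap * min 1 (|q| * u.kap) := by
  have i2 := integrable_dens_pow hm 2 (by norm_num)
  rw [corr₂, ← integral_sub i2 (integrable_dens_mul u (u.continuous_dens_translate q)
    fun x => abs_dens_le hm _)]
  calc _ ≤ ∫ x, 2 * u.kap * |u.dens (x - q) - u.dens x| := by
        refine integral_mono (i2.sub (integrable_dens_mul u (u.continuous_dens_translate q)
          fun x => abs_dens_le hm _)) ((integrable_translate_sub u q).const_mul _) fun x => ?_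
        have e : u.dens x ^ 2 - u.dens x * u.dens (x - q) =
          u.dens x * -(u.dens (x - q) - u.dens x) := by ring
        simp only
        rw [e]
        exact (mul_le_mul_of_nonneg_left (neg_le_abs _) (u.dens_nonneg x)).trans
          (mul_le_mul_of_nonneg_right (dens_le hm x) (abs_nonneg _))
    _ ≤ 2 * u.kap * (2 * min 1 (|q| * u.kap)) := by
        rw [integral_const_mul]
        exact mul_le_mul_of_nonneg_left (integral_translate_le hm q)
          (by have := u.kap_nonneg; positivity)
    _ = _ := by ring

theorem corr₃_error (hm : mass u = 1) (q : ℝ × ℝ) :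
    (∫ x, u.dens x ^ 3) - u.corr₃ q ≤
      8 * u.kap ^ 2 * (min 1 (|q.1| * u.kap) + min 1 (|q.2| * u.kap)) := by
  have i3 := integrable_dens_pow hm 3 (by norm_num)
  have hk := u.kap_nonneg
  have ic : Integrable (fun x => u.dens x * (u.dens (x - q.1) * u.dens (x - q.2))) :=
    integrable_dens_mul u ((u.continuous_dens_translate q.1).mul
      (u.continuous_dens_translate q.2)) fun x => abs_dens_mul_le hm _ _
  have it : Integrable (fun x => (2 * u.kap) ^ 2 *
      (|u.dens (x - q.1) - u.dens x| + |u.dens (x - q.2) - u.dens x|)) := ((integrable_translate_sub u q.1).add (integrable_translate_sub u q.2)).const_mul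
    ((2 * u.kap) ^ 2)
  rw [corr₃, ← integral_sub i3 ic]
  calc _ ≤ ∫ x, (2 * u.kap) ^ 2 * (|u.dens (x - q.1) - u.dens x| + |u.dens (x - q.2) - u.dens x|) := by
        refine integral_mono (i3.sub ic) it fun x => ?_
        set a := u.dens x
        set b := u.dens (x - q.1)
        set c := u.dens (x - q.2)
        have ha : 0 ≤ a := u.dens_nonneg _
        have hb : 0 ≤ b := u.dens_nonneg _
        have ha' : a ≤ 2 * u.kap := dens_le hm _
        have hb' : b ≤ 2 * u.kap := dens_le hm _
        change a ^ 3 - a * (b * c) ≤ _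
        -- Telescoping replaces one translated factor at a time, so each term carries a single
        -- translation difference.
        have e : a ^ 3 - a * (b * c) = (a * a) * -(b - a) + (a * b) * -(c - a) := by ring
        rw [e, mul_add]
        have h1 : a * a ≤ (2 * u.kap) ^ 2 := by rw [sq]; exact mul_le_mul ha' ha' ha (by positivity)
        have h2 : a * b ≤ (2 * u.kap) ^ 2 := by rw [sq]; exact mul_le_mul ha' hb' hb (by positivity)
        refine add_le_add ?_ ?_
        · exact (mul_le_mul_of_nonneg_left (neg_le_abs _) (by positivity)).trans
            (mul_le_mul_of_nonneg_right h1 (abs_nonneg _))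
        · exact (mul_le_mul_of_nonneg_left (neg_le_abs _) (by positivity)).trans
            (mul_le_mul_of_nonneg_right h2 (abs_nonneg _))
    _ ≤ (2 * u.kap) ^ 2 * (2 * min 1 (|q.1| * u.kap) + 2 * min 1 (|q.2| * u.kap)) := by
        rw [integral_const_mul, integral_add (integrable_translate_sub u q.1)
          (integrable_translate_sub u q.2)]
        exact mul_le_mul_of_nonneg_left (add_le_add (integral_translate_le hm q.1)
          (integral_translate_le hm q.2)) (by positivity)
    _ = _ := by ring

end H1

/-- The modulus `∫ U(x) min(1, |x| t) dx`. -/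
noncomputable def modU (U : ℝ → ℝ) (t : ℝ) : ℝ := ∫ q, U q * min 1 (|q| * t)

/-- The modulus `∫ W(x, y) (min(1, |x| t) + min(1, |y| t)) dx dy`. -/
noncomputable def modW (W : ℝ × ℝ → ℝ) (t : ℝ) : ℝ :=
  ∫ q, W q * (min 1 (|q.1| * t) + min 1 (|q.2| * t))

theorem min_one_mem {a : ℝ} (ha : 0 ≤ a) : |min 1 a| ≤ 1 := by
  rw [abs_of_nonneg (le_min zero_le_one ha)]; exact min_le_left _ _

/-- Dominated convergence with majorant |U| needs no moment. This qualitative version serves fixed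
couplings, while `modU_le` gives the rate needed for collapse. -/
theorem tendsto_modU {U : ℝ → ℝ} (hU : TwoBodyPotential U) {ι : Type*} {l : Filter ι}
    [l.IsCountablyGenerated] {t : ι → ℝ} (ht : Tendsto t l (𝓝 0)) (ht0 : ∀ᶠ i in l, 0 ≤ t i) :
    Tendsto (fun i => modU U (t i)) l (𝓝 0) := by
  have hi := memLp_one_iff_integrable.mp hU.memLp_one
  have h0 : (0 : ℝ) = ∫ q : ℝ, (0 : ℝ) := by simp
  rw [h0]
  refine tendsto_integral_filter_of_dominated_convergence (fun q => ‖U q‖) ?_ ?_ hi.norm ?_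
  · refine Eventually.of_forall fun i => hi.1.mul ?_
    exact (by fun_prop : Continuous fun q : ℝ => min 1 (|q| * t i)).aestronglyMeasurable
  · filter_upwards [ht0] with i hi0
    refine Eventually.of_forall fun q => ?_
    rw [norm_mul]
    exact mul_le_of_le_one_right (norm_nonneg _) (min_one_mem (by positivity))
  · refine Eventually.of_forall fun q => ?_
    have h1 : Tendsto (fun i => U q * min 1 (|q| * t i)) l (𝓝 (U q * min 1 (|q| * 0))) :=
      (tendsto_const_nhds.min (ht.const_mul _)).const_mul _
    simpa using h1

theorem tendsto_modW {W : ℝ × ℝ → ℝ} (hW : ThreeBodyPotential W) {ι : Type*} {l : Filter ι}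
    [l.IsCountablyGenerated] {t : ι → ℝ} (ht : Tendsto t l (𝓝 0)) (ht0 : ∀ᶠ i in l, 0 ≤ t i) :
    Tendsto (fun i => modW W (t i)) l (𝓝 0) := by
  have hi := memLp_one_iff_integrable.mp hW.memLp_one
  have h0 : (0 : ℝ) = ∫ q : ℝ × ℝ, (0 : ℝ) := by simp
  rw [h0]
  refine tendsto_integral_filter_of_dominated_convergence (fun q => ‖W q‖ * 2) ?_ ?_
    (hi.norm.mul_const 2) ?_
  · refine Eventually.of_forall fun i => hi.1.mul ?_
    exact (by fun_prop : Continuous fun q : ℝ × ℝ =>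
      min 1 (|q.1| * t i) + min 1 (|q.2| * t i)).aestronglyMeasurable
  · filter_upwards [ht0] with i hi0
    refine Eventually.of_forall fun q => ?_
    rw [norm_mul]
    refine mul_le_mul_of_nonneg_left ((abs_add_le _ _).trans ?_) (norm_nonneg _)
    linarith [min_one_mem (a := |q.1| * t i) (by positivity),
      min_one_mem (a := |q.2| * t i) (by positivity)]
  · refine Eventually.of_forall fun q => ?_
    have h1 : Tendsto (fun i => W q * (min 1 (|q.1| * t i) + min 1 (|q.2| * t i))) l
        (𝓝 (W q * (min 1 (|q.1| * 0) + min 1 (|q.2| * 0)))) :=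
      ((tendsto_const_nhds.min (ht.const_mul _)).add
        (tendsto_const_nhds.min (ht.const_mul _))).const_mul _
    simpa using h1

theorem integrable_mul_bounded {G : Type*} [MeasurableSpace G] {μ : Measure G} {V e : G → ℝ}
    (hV : Integrable V μ) (he : AEStronglyMeasurable e μ) {C : ℝ} (hC : ∀ q, |e q| ≤ C) :
    Integrable (fun q => V q * e q) μ := by
  refine (hV.norm.mul_const C).mono' (hV.1.mul he) (Eventually.of_forall fun q => ?_)
  rw [norm_mul]
  exact mul_le_mul_of_nonneg_left (hC q) (norm_nonneg _)

theorem modU_le {U : ℝ → ℝ} (hU : TwoBodyPotential U) (hx : Integrable fun x => x * U x) {t : ℝ}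
    (ht : 0 ≤ t) : modU U t ≤ (∫ x, |x * U x|) * t := by
  have hi := memLp_one_iff_integrable.mp hU.memLp_one
  rw [modU, ← integral_mul_const]
  refine integral_mono_ae (integrable_mul_bounded hi (by fun_prop :
    Continuous fun q : ℝ => min 1 (|q| * t)).aestronglyMeasurable fun q => min_one_mem (by positivity))
    (hx.abs.mul_const t) ?_
  filter_upwards [hU.nonneg] with q hq
  rw [abs_mul, abs_of_nonneg hq]
  calc U q * min 1 (|q| * t) ≤ U q * (|q| * t) := mul_le_mul_of_nonneg_left (min_le_right _ _) hq
    _ = _ := by ring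

/-- The symmetry of W transfers the moment condition from the first variable to the second. -/
theorem integrable_snd_mul {W : ℝ × ℝ → ℝ} (hW : ThreeBodyPotential W)
    (hx : Integrable fun p : ℝ × ℝ => p.1 * W p) : Integrable fun p : ℝ × ℝ => p.2 * W p := by
  have h : Integrable (fun p : ℝ × ℝ => p.2 * W p.swap) := hx.swap
  refine h.congr ?_
  filter_upwards [hW.swap] with p hp
  rw [show p.swap = (p.2, p.1) from rfl, ← hp]

theorem modW_le {W : ℝ × ℝ → ℝ} (hW : ThreeBodyPotential W)
    (hx : Integrable fun p : ℝ × ℝ => p.1 * W p) {t : ℝ}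
    (ht : 0 ≤ t) : modW W t ≤ (∫ p : ℝ × ℝ, (|p.1 * W p| + |p.2 * W p|)) * t := by
  have hi := memLp_one_iff_integrable.mp hW.memLp_one
  have hy := integrable_snd_mul hW hx
  rw [modW, ← integral_mul_const]
  refine integral_mono_ae (integrable_mul_bounded (C := 2) hi (by fun_prop :
    Continuous fun q : ℝ × ℝ => min 1 (|q.1| * t) + min 1 (|q.2| * t)).aestronglyMeasurable
      fun q => (abs_add_le _ _).trans (by
    linarith [min_one_mem (a := |q.1| * t) (by positivity),
      min_one_mem (a := |q.2| * t) (by positivity)]))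
    ((hx.abs.add hy.abs).mul_const t) ?_
  filter_upwards [hW.nonneg] with q hq
  rw [abs_mul, abs_mul, abs_of_nonneg hq]
  calc _ ≤ W q * (|q.1| * t + |q.2| * t) :=
        mul_le_mul_of_nonneg_left (add_le_add (min_le_right _ _) (min_le_right _ _)) hq
    _ = _ := by ring

theorem twoBody_eq {U : ℝ → ℝ} (hU : TwoBodyPotential U) (α : ℝ) {N : ℕ} (hN : 1 ≤ N) {u : H1}
    (hm : mass u = 1) : twoBody U α N u = ∫ q, U q * u.corr₂ (((N : ℝ) ^ α)⁻¹ • q) := by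
  have hr : 0 < (N : ℝ) ^ α := Real.rpow_pos_of_pos (by exact_mod_cast hN) α
  have hi := memLp_one_iff_integrable.mp hU.memLp_one
  rw [← integral_scaled_mul hr]
  have e1 : twoBody U α N u = ∫ p : ℝ × ℝ, scaledU U α N (p.1 - p.2) * (u.dens p.1 * u.dens p.2)
      ∂(volume.prod volume) := by
    refine integral_congr_ae ?_
    have h1 : ∀ᵐ p : ℝ × ℝ, u p.1 = u.rep p.1 :=
      (Measure.quasiMeasurePreserving_fst).ae_eq_comp u.ae_rep
    have h2 : ∀ᵐ p : ℝ × ℝ, u p.2 = u.rep p.2 :=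
      (Measure.quasiMeasurePreserving_snd).ae_eq_comp u.ae_rep
    filter_upwards [h1, h2] with p h1 h2
    rw [h1, h2, H1.dens, H1.dens, mul_assoc]
  rw [e1]
  have h := integral_conv_form (ι := fun x : ℝ => x) measurable_id (integrable_scaled hi hr)
    u.integrable_dens u.continuous_dens.measurable (H1.abs_dens_le hm)
  simpa [scaledU, H1.corr₂] using h

theorem threeBody_eq {W : ℝ × ℝ → ℝ} (hW : ThreeBodyPotential W) (β : ℝ) {N : ℕ} (hN : 1 ≤ N)
    {u : H1} (hm : mass u = 1) :
    threeBody W β N u = ∫ q, W q * u.corr₃ (((N : ℝ) ^ β)⁻¹ • q) := by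
  have hr : 0 < (N : ℝ) ^ β := Real.rpow_pos_of_pos (by exact_mod_cast hN) β
  have hi := memLp_one_iff_integrable.mp hW.memLp_one
  rw [← integral_scaled_mul hr]
  have e1 : threeBody W β N u = ∫ p : ℝ × ℝ × ℝ, scaledW W β N (p.1 - p.2.1) (p.1 - p.2.2) *
      (u.dens p.1 * (u.dens p.2.1 * u.dens p.2.2)) ∂(volume.prod volume) := by
    refine integral_congr_ae ?_
    have h1 : ∀ᵐ p : ℝ × ℝ × ℝ, u p.1 = u.rep p.1 :=
      (Measure.quasiMeasurePreserving_fst).ae_eq_comp u.ae_rep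
    have h2 : ∀ᵐ p : ℝ × ℝ × ℝ, u p.2.1 = u.rep p.2.1 :=
      ((Measure.quasiMeasurePreserving_fst).comp Measure.quasiMeasurePreserving_snd).ae_eq_comp
        u.ae_rep
    have h3 : ∀ᵐ p : ℝ × ℝ × ℝ, u p.2.2 = u.rep p.2.2 :=
      ((Measure.quasiMeasurePreserving_snd).comp Measure.quasiMeasurePreserving_snd).ae_eq_comp
        u.ae_rep
    filter_upwards [h1, h2, h3] with p h1 h2 h3
    rw [h1, h2, h3, H1.dens, H1.dens, H1.dens]
    ring
  rw [e1]
  have h := integral_conv_form (ι := fun x : ℝ => ((x, x) : ℝ × ℝ)) (by fun_prop)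
    (integrable_scaled hi hr)
    u.integrable_dens (R := fun q : ℝ × ℝ => u.dens q.1 * u.dens q.2)
    (by have := u.continuous_dens; exact (by fun_prop : Continuous _).measurable)
    (fun q => H1.abs_dens_mul_le hm q.1 q.2)
  have e2 : ((N : ℝ) ^ β) ^ 2 = (N : ℝ) ^ (2 * β) := by
    rw [← Real.rpow_natCast, ← Real.rpow_mul (by positivity)]; ring_nf
  have e3 : ∀ a b : ℝ, (N : ℝ) ^ β • ((a, b) : ℝ × ℝ) = ((N : ℝ) ^ β * a, (N : ℝ) ^ β * b) :=
    fun _ _ => rfl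
  have e4 : ∀ (x : ℝ) (q : ℝ × ℝ), ((x, x) : ℝ × ℝ) - q = (x - q.1, x - q.2) := fun _ _ => rfl
  simpa [scaledW, e2, e3, e4, H1.corr₃] using h

/-- U is a probability density, so the energy is an average of rescaled correlations, each at most
the diagonal value ∫ρ². The quantity κ / N^α compares the interaction range with the shortest length
on which ρ varies. -/
theorem twoBody_bounds {U : ℝ → ℝ} (hU : TwoBodyPotential U) (α : ℝ) {N : ℕ} (hN : 1 ≤ N) {u : H1}
    (hm : mass u = 1) : 0 ≤ twoBody U α N u ∧ twoBody U α N u ≤ ∫ x, u.dens x ^ 2 ∧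
      (∫ x, u.dens x ^ 2) - twoBody U α N u ≤ 4 * u.kap * modU U (u.kap / (N : ℝ) ^ α) := by
  have hr : 0 < (N : ℝ) ^ α := Real.rpow_pos_of_pos (by exact_mod_cast hN) α
  have hi := memLp_one_iff_integrable.mp hU.memLp_one
  have hk := u.kap_nonneg
  have h := integral_mul_density_bounds hi hU.nonneg hU.integral_eq_one
    (Φ := fun q => u.corr₂ (((N : ℝ) ^ α)⁻¹ • q))
    (u.measurable_corr₂.comp (measurable_const_smul _)) (fun q => u.corr₂_nonneg _)
    (fun q => H1.corr₂_le hm _)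
    (e := fun q => 4 * u.kap * min 1 (|q| * (u.kap / (N : ℝ) ^ α))) (fun q => by
      refine (H1.corr₂_error hm _).trans (le_of_eq ?_)
      rw [smul_eq_mul, abs_mul, abs_inv, abs_of_pos hr]
      ring_nf) (by
      refine integrable_mul_bounded (C := 4 * u.kap) hi (by fun_prop : Continuous fun q : ℝ =>
        4 * u.kap * min 1 (|q| * (u.kap / (N : ℝ) ^ α))).aestronglyMeasurable fun q => ?_
      rw [abs_mul, abs_of_nonneg (by positivity : 0 ≤ 4 * u.kap)]
      exact mul_le_of_le_one_right (by positivity) (min_one_mem (by positivity)))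
  rw [twoBody_eq hU α hN hm]
  refine ⟨h.1, h.2.1, h.2.2.trans (le_of_eq ?_)⟩
  rw [modU, ← integral_const_mul]
  congr 1; funext q; ring

theorem threeBody_bounds {W : ℝ × ℝ → ℝ} (hW : ThreeBodyPotential W) (β : ℝ) {N : ℕ} (hN : 1 ≤ N)
    {u : H1} (hm : mass u = 1) : 0 ≤ threeBody W β N u ∧ threeBody W β N u ≤ ∫ x, u.dens x ^ 3 ∧
      (∫ x, u.dens x ^ 3) - threeBody W β N u ≤
        8 * u.kap ^ 2 * modW W (u.kap / (N : ℝ) ^ β) := by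
  have hr : 0 < (N : ℝ) ^ β := Real.rpow_pos_of_pos (by exact_mod_cast hN) β
  have hi := memLp_one_iff_integrable.mp hW.memLp_one
  have hk := u.kap_nonneg
  have h := integral_mul_density_bounds hi hW.nonneg hW.integral_eq_one
    (Φ := fun q => u.corr₃ (((N : ℝ) ^ β)⁻¹ • q))
    (u.measurable_corr₃.comp (measurable_const_smul _)) (fun q => u.corr₃_nonneg _)
    (fun q => H1.corr₃_le hm _)
    (e := fun q => 8 * u.kap ^ 2 * (min 1 (|q.1| * (u.kap / (N : ℝ) ^ β)) +
      min 1 (|q.2| * (u.kap / (N : ℝ) ^ β)))) (fun q => by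
      refine (H1.corr₃_error hm _).trans (le_of_eq ?_)
      simp only [Prod.smul_fst, Prod.smul_snd]
      rw [smul_eq_mul, abs_mul, abs_inv, abs_of_pos hr, smul_eq_mul, abs_mul, abs_inv,
        abs_of_pos hr]
      ring_nf) (by
      refine integrable_mul_bounded (C := 8 * u.kap ^ 2 * 2) hi (by fun_prop :
        Continuous fun q : ℝ × ℝ => 8 * u.kap ^ 2 * (min 1 (|q.1| * (u.kap / (N : ℝ) ^ β)) +
        min 1 (|q.2| * (u.kap / (N : ℝ) ^ β)))).aestronglyMeasurable fun q => ?_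
      rw [abs_mul, abs_of_nonneg (by positivity : 0 ≤ 8 * u.kap ^ 2)]
      refine mul_le_mul_of_nonneg_left ((abs_add_le _ _).trans ?_) (by positivity)
      linarith [min_one_mem (a := |q.1| * (u.kap / (N : ℝ) ^ β)) (by positivity),
        min_one_mem (a := |q.2| * (u.kap / (N : ℝ) ^ β)) (by positivity)])
  rw [threeBody_eq hW β hN hm]
  refine ⟨h.1, h.2.1, h.2.2.trans (le_of_eq ?_)⟩
  rw [modW, ← integral_const_mul]
  congr 1; funext q; ring

/-- The same shear turns the integral of the correlation into the triple product of the mass. -/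
theorem H1.integral_corr₃ {u : H1} (hm : mass u = 1) :
    Integrable u.corr₃ ∧ ∫ q, u.corr₃ q = 1 := by
  have hT := measurePreserving_shear (ι := fun x : ℝ => ((x, x) : ℝ × ℝ)) (by fun_prop)
  have hf : Integrable (fun p : ℝ × ℝ × ℝ => u.dens p.1 * (u.dens p.2.1 * u.dens p.2.2))
      (volume.prod volume) :=
    u.integrable_dens.mul_prod (u.integrable_dens.mul_prod u.integrable_dens)
  have hg := (hT.integrable_comp hf.1).mpr hf
  have e1 : ∫ p : ℝ × ℝ × ℝ, u.dens p.1 * (u.dens p.2.1 * u.dens p.2.2)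
      ∂(volume.prod volume) = 1 := by
    rw [integral_prod_mul (μ := (volume : Measure ℝ)) (ν := (volume : Measure (ℝ × ℝ))) u.dens
      (fun q : ℝ × ℝ => u.dens q.1 * u.dens q.2), u.integral_dens, hm]
    have := integral_prod_mul (μ := (volume : Measure ℝ)) (ν := (volume : Measure ℝ)) u.dens u.dens
    rw [u.integral_dens, hm] at this
    rw [one_mul, Measure.volume_eq_prod, this, one_mul]
  refine ⟨hg.integral_prod_right, ?_⟩
  have h2 := integral_map (μ := (volume : Measure ℝ).prod (volume : Measure (ℝ × ℝ)))
    hT.measurable.aemeasurable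
    (f := fun p : ℝ × ℝ × ℝ => u.dens p.1 * (u.dens p.2.1 * u.dens p.2.2))
    (by rw [hT.map_eq]; exact hf.1)
  rw [hT.map_eq, e1] at h2
  rw [h2]
  exact (integral_prod_symm _ hg).symm

/-- Bound W by its essential supremum and integrate the correlation. The N^(2β) growth is poor, but
independent of u: at critical coupling it gives a first bound κ = O(N^β). -/
theorem exists_threeBody_le {W : ℝ × ℝ → ℝ} (hW : ThreeBodyPotential W) (β : ℝ) :
    ∃ C, 0 ≤ C ∧ ∀ N : ℕ, 1 ≤ N → ∀ u : H1, mass u = 1 →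
      threeBody W β N u ≤ C * ((N : ℝ) ^ β) ^ 2 := by
  set C := (eLpNormEssSup W volume).toReal
  have hC : ∀ᵐ q, W q ≤ C := by
    have hfin : eLpNormEssSup W volume ≠ ⊤ := by
      have := hW.memLp_top.2
      rw [eLpNorm_exponent_top] at this
      exact this.ne
    filter_upwards [ae_le_eLpNormEssSup (f := W) (μ := volume)] with q hq
    refine (le_abs_self _).trans ?_
    have := ENNReal.toReal_mono hfin hq
    simpa using this
  refine ⟨C, ENNReal.toReal_nonneg, fun N hN u hm => ?_⟩
  have hr : 0 < (N : ℝ) ^ β := Real.rpow_pos_of_pos (by exact_mod_cast hN) β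
  have hi := memLp_one_iff_integrable.mp hW.memLp_one
  obtain ⟨hci, hc1⟩ := H1.integral_corr₃ hm
  have hr' : ((N : ℝ) ^ β)⁻¹ ≠ 0 := (inv_pos.mpr hr).ne'
  rw [threeBody_eq hW β hN hm]
  calc ∫ q, W q * u.corr₃ (((N : ℝ) ^ β)⁻¹ • q) ≤ ∫ q, C * u.corr₃ (((N : ℝ) ^ β)⁻¹ • q) := by
        refine integral_mono_ae (integrable_mul_bounded (C := ∫ x, u.dens x ^ 3) hi
          (u.measurable_corr₃.comp (measurable_const_smul _)).aestronglyMeasurable fun q => ?_)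
          ((hci.comp_smul hr').const_mul C) ?_
        · rw [abs_of_nonneg (u.corr₃_nonneg _)]
          exact H1.corr₃_le hm _
        · filter_upwards [hC] with q hq
          exact mul_le_mul_of_nonneg_right hq (u.corr₃_nonneg _)
    _ = C * ((N : ℝ) ^ β) ^ 2 := by
        rw [integral_const_mul, Measure.integral_comp_smul, hc1]
        simp [abs_of_pos hr]

end HartreeNLS

/-! ### Compactness in H¹ under the trap. -/

namespace HartreeNLS

/-- Dominated convergence handles [−R, R]; outside, the weight |x|^s bounds the integral by R^(-s) D
uniformly in n. -/
theorem lintegral_tendsto_zero_of_tight {s : ℝ} (hs : 0 < s) {f : ℕ → ℝ → ℝ}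
    (hf : ∀ n, Measurable (f n)) {B : ℝ} (hB : ∀ n x, f n x ≤ B)
    (h0 : ∀ x, Tendsto (fun n => f n x) atTop (𝓝 0)) {D : ℝ≥0∞} (hD : D ≠ ⊤)
    (hT : ∀ n, ∫⁻ x, ENNReal.ofReal (|x| ^ s * f n x) ≤ D) :
    Tendsto (fun n => ∫⁻ x, ENNReal.ofReal (f n x)) atTop (𝓝 0) := by
  rw [ENNReal.tendsto_nhds_zero]
  intro ε hε
  have hε2 : (0 : ℝ≥0∞) < ε / 2 := ENNReal.div_pos hε.ne' (by simp)
  obtain ⟨R, hR0, hR⟩ : ∃ R : ℝ, 0 < R ∧ ENNReal.ofReal (R ^ (-s)) * D ≤ ε / 2 := by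
    have h1 : Tendsto (fun R : ℝ => ENNReal.ofReal (R ^ (-s)) * D) atTop (𝓝 0) := by
      have := ENNReal.Tendsto.mul_const (b := D)
        ((ENNReal.continuous_ofReal.tendsto _).comp (tendsto_rpow_neg_atTop hs)) (Or.inr hD)
      simpa using this
    have h2 := (ENNReal.tendsto_nhds_zero.mp h1) (ε / 2) hε2
    obtain ⟨R, hR, hR'⟩ := (h2.and (eventually_gt_atTop 0)).exists
    exact ⟨R, hR', hR⟩
  have hin : Tendsto (fun n => ∫⁻ x in Set.Icc (-R) R, ENNReal.ofReal (f n x)) atTop (𝓝 0) := by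
    have := tendsto_lintegral_of_dominated_convergence (μ := volume.restrict (Set.Icc (-R) R))
      (F := fun n x => ENNReal.ofReal (f n x)) (f := fun _ => 0) (fun _ => ENNReal.ofReal B)
      (fun n => (hf n).ennreal_ofReal)
      (fun n => Eventually.of_forall fun x => ENNReal.ofReal_le_ofReal (hB n x))
      (by
        rw [lintegral_const]
        exact ENNReal.mul_ne_top ENNReal.ofReal_ne_top (by simp))
      (Eventually.of_forall fun x => by
        have := (ENNReal.continuous_ofReal.tendsto _).comp (h0 x)
        simpa [Function.comp_def] using this)
    simpa using this
  filter_upwards [(ENNReal.tendsto_nhds_zero.mp hin) (ε / 2) hε2] with n hn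
  rw [← lintegral_add_compl _ (measurableSet_Icc (a := -R) (b := R)), ← ENNReal.add_halves ε]
  refine add_le_add hn (le_trans ?_ hR)
  calc ∫⁻ x in (Set.Icc (-R) R)ᶜ, ENNReal.ofReal (f n x)
      ≤ ∫⁻ x in (Set.Icc (-R) R)ᶜ, ENNReal.ofReal (R ^ (-s)) * ENNReal.ofReal (|x| ^ s * f n x) := by
        refine setLIntegral_mono' measurableSet_Icc.compl fun x hx => ?_
        rw [← ENNReal.ofReal_mul (by positivity)]
        rcases le_or_gt (f n x) 0 with hneg | hpos
        · rw [ENNReal.ofReal_of_nonpos hneg]; exact zero_le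
        · refine ENNReal.ofReal_le_ofReal ?_
          have hxR : R ≤ |x| := by
            by_contra! hlt
            exact hx (abs_le.mp hlt.le)
          have h1 : R ^ s ≤ |x| ^ s := Real.rpow_le_rpow hR0.le hxR hs.le
          have h2 : 1 ≤ R ^ (-s) * |x| ^ s := by
            rw [Real.rpow_neg hR0.le, ← div_eq_inv_mul, le_div_iff₀ (by positivity)]
            linarith
          rw [← mul_assoc]
          nlinarith
    _ ≤ ∫⁻ x, ENNReal.ofReal (R ^ (-s)) * ENNReal.ofReal (|x| ^ s * f n x) :=
        setLIntegral_le_lintegral _ _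
    _ = ENNReal.ofReal (R ^ (-s)) * ∫⁻ x, ENNReal.ofReal (|x| ^ s * f n x) :=
        lintegral_const_mul' _ _ ENNReal.ofReal_ne_top
    _ ≤ _ := by gcongr; exact hT n

theorem integral_tendsto_zero_of_tight {s : ℝ} (hs : 0 < s) {f : ℕ → ℝ → ℝ}
    (hf : ∀ n, Measurable (f n)) (hpos : ∀ n x, 0 ≤ f n x) {B : ℝ} (hB : ∀ n x, f n x ≤ B)
    (h0 : ∀ x, Tendsto (fun n => f n x) atTop (𝓝 0)) {D : ℝ≥0∞} (hD : D ≠ ⊤)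
    (hT : ∀ n, ∫⁻ x, ENNReal.ofReal (|x| ^ s * f n x) ≤ D) :
    Tendsto (fun n => ∫ x, f n x) atTop (𝓝 0) := by
  have h := lintegral_tendsto_zero_of_tight hs hf hB h0 hD hT
  have h2 := (ENNReal.tendsto_toReal ENNReal.zero_ne_top).comp h
  refine h2.congr fun n => ?_
  exact (integral_eq_lintegral_of_nonneg_ae (Eventually.of_forall (hpos n))
    (hf n).aestronglyMeasurable).symm

theorem tendsto_eLpNorm_two {f : ℕ → ℝ → ℂ} (hf : ∀ᶠ n in atTop, MemLp (f n) 2)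
    (h : Tendsto (fun n => ∫ x, ‖f n x‖ ^ 2) atTop (𝓝 0)) :
    Tendsto (fun n => eLpNorm (f n) 2) atTop (𝓝 0) := by
  have h1 : Tendsto (fun n => ENNReal.ofReal ((∫ x, ‖f n x‖ ^ 2) ^ (1 / 2 : ℝ))) atTop (𝓝 0) := by
    have h2 := (h.rpow_const (p := 1 / 2) (Or.inr (by norm_num)))
    have := (ENNReal.continuous_ofReal.tendsto _).comp h2
    simpa [Function.comp_def] using this
  refine h1.congr' ?_
  filter_upwards [hf] with n hn
  rw [hn.eLpNorm_eq_integral_rpow_norm (by norm_num) (by norm_num)]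
  simp

/-- Weak sequential compactness of balls of `L²`. -/
theorem exists_weak_subseq (g : ℕ → Lp ℂ 2 (volume : Measure ℝ)) {C : ℝ} (hC : ∀ n, ‖g n‖ ≤ C) :
    ∃ (G : Lp ℂ 2 (volume : Measure ℝ)) (k : ℕ → ℕ), StrictMono k ∧
      ∀ h : Lp ℂ 2 (volume : Measure ℝ),
        Tendsto (fun n => inner ℂ h (g (k n))) atTop (𝓝 (inner ℂ h G)) := by
  have : Fact ((2 : ℝ≥0∞) ≠ ⊤) := ⟨by simp⟩
  let T := InnerProductSpace.toDual ℂ (Lp ℂ 2 (volume : Measure ℝ))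
  have hseq := WeakDual.isSeqCompact_closedBall ℂ (Lp ℂ 2 (volume : Measure ℝ)) 0 C
  obtain ⟨Λ, -, k, hk, hlim⟩ := hseq (x := fun n => StrongDual.toWeakDual (T (g n)))
    (fun n => by simpa using hC n)
  refine ⟨T.symm (WeakDual.toStrongDual Λ), k, hk, fun h => ?_⟩
  have h1 := ((WeakDual.eval_continuous h).tendsto Λ).comp hlim
  have h2 : Tendsto (fun n => inner ℂ (g (k n)) h) atTop
      (𝓝 (inner ℂ (T.symm (WeakDual.toStrongDual Λ)) h)) := by
    have e : inner ℂ (T.symm (WeakDual.toStrongDual Λ)) h = Λ h := by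
      rw [← InnerProductSpace.toDual_apply_apply]
      change T (T.symm _) h = _
      rw [LinearIsometryEquiv.apply_symm_apply]
      rfl
    rw [e]
    exact h1
  have h3 := (Complex.continuous_conj.tendsto _).comp h2
  simpa [Function.comp_def, inner_conj_symm] using h3

theorem norm_toLp_sq {f : ℝ → ℂ} (hf : MemLp f 2) : ‖hf.toLp f‖ ^ 2 = ∫ x, ‖f x‖ ^ 2 := by
  have h0 : 0 ≤ ∫ x, ‖f x‖ ^ 2 := integral_nonneg fun x => sq_nonneg _
  rw [Lp.norm_toLp, hf.eLpNorm_eq_integral_rpow_norm (by norm_num) (by norm_num),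
    ENNReal.toReal_ofReal (by positivity)]
  simp only [ENNReal.toReal_ofNat, Real.rpow_ofNat]
  rw [← one_div, ← Real.sqrt_eq_rpow, Real.sq_sqrt h0]

namespace H1

theorem trapping_le_liminf {s : ℝ} {u : ℕ → H1} {φ : H1}
    (h : ∀ x, Tendsto (fun n => (u n).rep x) atTop (𝓝 (φ.rep x))) :
    trapping s φ ≤ liminf (fun n => trapping s (u n)) atTop := by
  simp_rw [trapping_eq]
  have hle := lintegral_liminf_le' (μ := volume) (u := (atTop : Filter ℕ))
    (f := fun (n : ℕ) x => ENNReal.ofReal (|x| ^ s * (u n).dens x))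
    (fun n => ((measurable_abs.pow_const s).mul
      (u n).continuous_dens.measurable).ennreal_ofReal.aemeasurable)
  refine le_trans (le_of_eq (lintegral_congr fun x => ?_)) hle
  exact ((ENNReal.continuous_ofReal.tendsto _).comp
    (((h x).norm.pow 2).const_mul _)).liminf_eq.symm

theorem norm_rep_le {u : H1} (hm : mass u = 1) {C : ℝ} (hC : u.kap ≤ C) (x : ℝ) :
    ‖u.rep x‖ ≤ 1 + 2 * C := by
  have h1 : ‖u.rep x‖ ^ 2 ≤ 2 * u.kap := dens_le hm x
  have h2 := u.kap_nonneg
  nlinarith [norm_nonneg (u.rep x)]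

/-- Compactness of a countable product of discs gives convergence at all rational points, and the
uniform Hölder bound extends it to every real point. -/
theorem exists_pointwise_subseq {u : ℕ → H1} (hm : ∀ n, mass (u n) = 1) {C : ℝ}
    (hC : ∀ n, (u n).kap ≤ C) : ∃ (F : ℝ → ℂ) (k : ℕ → ℕ), StrictMono k ∧
      ∀ x, Tendsto (fun n => (u (k n)).rep x) atTop (𝓝 (F x)) := by
  have hcomp : IsCompact (Set.univ.pi fun _ : ℚ => Metric.closedBall (0 : ℂ) (1 + 2 * C)) :=
    isCompact_univ_pi fun _ => isCompact_closedBall 0 _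
  obtain ⟨a, -, k, hk, hlim⟩ := hcomp.tendsto_subseq (x := fun n (q : ℚ) => (u n).rep q)
    (fun n q _ => by simpa using norm_rep_le (hm n) (hC n) _)
  have hC0 : 0 ≤ C := (u 0).kap_nonneg.trans (hC 0)
  have hcauchy : ∀ x : ℝ, CauchySeq fun n => (u (k n)).rep x := fun x => by
    rw [Metric.cauchySeq_iff']
    intro ε hε
    have hc : Tendsto (fun y : ℝ => C * √|x - y|) (𝓝 x) (𝓝 0) := by
      have : Continuous fun y : ℝ => C * √|x - y| := by fun_prop
      simpa using this.tendsto x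
    obtain ⟨q, hq⟩ := Rat.denseRange_cast.exists_mem_open (isOpen_lt (by fun_prop :
      Continuous fun y : ℝ => C * √|x - y|) (continuous_const (y := ε / 3)))
      (by exact ⟨x, by simpa using (by positivity : 0 < ε)⟩)
    have hq' : C * √|x - q| < ε / 3 := hq
    have hcq : CauchySeq fun n => (u (k n)).rep q :=
      (((continuous_apply q).tendsto a).comp hlim).cauchySeq
    obtain ⟨N, hN⟩ := Metric.cauchySeq_iff'.mp hcq (ε / 3) (by positivity)
    refine ⟨N, fun n hn => ?_⟩
    have h1 : ∀ m, ‖(u m).rep x - (u m).rep q‖ < ε / 3 := fun m =>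
      ((norm_rep_sub_le (u m) q x).trans
        (mul_le_mul_of_nonneg_right (hC m) (Real.sqrt_nonneg _))).trans_lt hq'
    have h2 := hN n hn
    rw [dist_eq_norm] at h2 ⊢
    have e : (u (k n)).rep x - (u (k N)).rep x = ((u (k n)).rep x - (u (k n)).rep q) +
      ((u (k n)).rep q - (u (k N)).rep q) - ((u (k N)).rep x - (u (k N)).rep q) := by ring
    rw [e]
    refine (norm_sub_le _ _).trans_lt ?_
    have := norm_add_le ((u (k n)).rep x - (u (k n)).rep q) ((u (k n)).rep q - (u (k N)).rep q)
    linarith [h1 (k n), h1 (k N)]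
  choose F hF using fun x => cauchySeq_tendsto_of_complete (hcauchy x)
  exact ⟨F, k, hk, hF⟩

/-- Pairing with a test function is an L² inner product, so weak convergence of the derivatives
passes to the definition of the weak derivative. -/
theorem integral_smul_eq_inner {f : ℝ → ℂ} (hf : MemLp f 2) {φ : ℝ → ℝ}
    (hφ : MemLp (fun x => (φ x : ℂ)) 2) :
    ∫ x, φ x • f x = inner ℂ (hφ.toLp _) (hf.toLp f) := by
  rw [L2.inner_def]
  refine integral_congr_ae ?_
  filter_upwards [hf.coeFn_toLp, hφ.coeFn_toLp] with x h1 h2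
  rw [h1, h2]
  simp [mul_comm]

theorem eq_of_pointwise {φ : H1} {F : ℝ → ℂ} (hF : Continuous F) (h : φ.toFun = F) :
    φ.rep = F :=
  (Continuous.ae_eq_iff_eq volume φ.continuous_rep hF).mp (by rw [← h]; exact φ.ae_rep.symm)

/-- Weak limits in `H¹`: pointwise convergence of the functions and weak convergence of the
derivatives. -/
theorem exists_weak_limit {u : ℕ → H1} (hm : ∀ n, mass (u n) = 1) {C : ℝ}
    (hC : ∀ n, (u n).kap ≤ C) : ∃ (φ : H1) (k : ℕ → ℕ), StrictMono k ∧
      (∀ x, Tendsto (fun n => (u (k n)).rep x) atTop (𝓝 (φ.rep x))) ∧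
      Tendsto (fun n => kinetic (u (k n)) - ∫ x, ‖(u (k n)).weakDeriv x - φ.weakDeriv x‖ ^ 2)
        atTop (𝓝 (kinetic φ)) := by
  obtain ⟨F, k₁, hk₁, hF⟩ := exists_pointwise_subseq hm hC
  have hC0 : 0 ≤ C := (u 0).kap_nonneg.trans (hC 0)
  have hnorm : ∀ n, ‖(u (k₁ n)).memLp_weakDeriv.toLp _‖ ≤ C := fun n => by
    refine le_trans (le_of_eq ?_) (hC (k₁ n))
    rw [kap, kinetic, ← norm_toLp_sq (u (k₁ n)).memLp_weakDeriv, Real.sqrt_sq (norm_nonneg _)]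
  obtain ⟨G, k₂, hk₂, hG⟩ := exists_weak_subseq _ hnorm
  set k := k₁ ∘ k₂
  have hFk : ∀ x, Tendsto (fun n => (u (k n)).rep x) atTop (𝓝 (F x)) := fun x =>
    (hF x).comp hk₂.tendsto_atTop
  have hFh : ∀ a b, ‖F b - F a‖ ≤ C * √|b - a| := fun a b =>
    le_of_tendsto ((hFk b).sub (hFk a)).norm (Eventually.of_forall fun n =>
      (norm_rep_sub_le _ a b).trans (mul_le_mul_of_nonneg_right (hC _) (Real.sqrt_nonneg _)))
  have hFb : ∀ x, ‖F x‖ ≤ 1 + 2 * C := fun x =>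
    le_of_tendsto (hFk x).norm (Eventually.of_forall fun n => norm_rep_le (hm _) (hC _) x)
  have hFc : Continuous F := by
    rw [continuous_iff_continuousAt]
    intro x
    rw [ContinuousAt, tendsto_iff_norm_sub_tendsto_zero]
    refine squeeze_zero (fun _ => norm_nonneg _) (fun y => hFh x y) ?_
    have : Continuous fun y : ℝ => C * √|y - x| := by fun_prop
    simpa using this.tendsto x
  have hFL : MemLp F 2 := by
    refine ⟨hFc.aestronglyMeasurable, ?_⟩
    have := Lp.eLpNorm_lim_le_liminf_eLpNorm (p := 2) (μ := volume)
      (f := fun n => (u (k n)).rep) (fun n => (u (k n)).continuous_rep.aestronglyMeasurable) F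
      (Eventually.of_forall hFk)
    refine this.trans_lt ?_
    have h1 : ∀ n, eLpNorm (u (k n)).rep 2 volume = 1 := fun n => by
      rw [(u (k n)).memLp_rep.eLpNorm_eq_integral_rpow_norm (by norm_num) (by norm_num)]
      have := (u (k n)).integral_dens
      simp only [dens, hm] at this
      simp [this]
    simp [h1]
  have hw : HasWeakDeriv F G := by
    intro φ hφ hs
    have hφ1 := contDiff_one_of_infty hφ
    have hd := hφ1.continuous_deriv le_rfl
    have hφL : MemLp (fun x => (φ x : ℂ)) 2 :=
      (Complex.continuous_ofReal.comp hφ1.continuous).memLp_of_hasCompactSupport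
        (hs.comp_left (g := fun r : ℝ => (r : ℂ)) (by simp))
    have l1 : Tendsto (fun n => ∫ x, deriv φ x • (u (k n)).rep x) atTop
        (𝓝 (∫ x, deriv φ x • F x)) := by
      refine tendsto_integral_of_dominated_convergence (fun x => ‖deriv φ x‖ * (1 + 2 * C))
        (fun n => (hd.smul (u (k n)).continuous_rep).aestronglyMeasurable)
        ((hd.norm.integrable_of_hasCompactSupport hs.deriv.norm).mul_const _)
        (fun n => Eventually.of_forall fun x => ?_)
        (Eventually.of_forall fun x => (hFk x).const_smul _)
      rw [norm_smul]
      exact mul_le_mul_of_nonneg_left (norm_rep_le (hm _) (hC _) x) (norm_nonneg _)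
    have l2 : Tendsto (fun n => ∫ x, φ x • (u (k n)).weakDeriv x) atTop (𝓝 (∫ x, φ x • G x)) := by
      have e : ∫ x, φ x • G x = inner ℂ (hφL.toLp _) G := by
        rw [integral_smul_eq_inner (Lp.memLp G) hφL, Lp.toLp_coeFn]
      rw [e]
      refine (hG (hφL.toLp _)).congr fun n => ?_
      exact (integral_smul_eq_inner (u (k n)).memLp_weakDeriv hφL).symm
    refine tendsto_nhds_unique l1 (l2.neg.congr fun n => ?_)
    rw [← (u (k n)).hasWeakDeriv φ hφ hs]
    refine integral_congr_ae ?_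
    filter_upwards [(u (k n)).ae_rep] with x hx
    rw [hx]
  let φ : H1 := ⟨F, G, hFL, Lp.memLp G, hw⟩
  have hrep : φ.rep = F := eq_of_pointwise hFc rfl
  refine ⟨φ, k, hk₁.comp hk₂, fun x => by rw [hrep]; exact hFk x, ?_⟩
  have hlim := (Complex.continuous_re.tendsto _).comp (hG G)
  have eG : ‖G‖ ^ 2 = kinetic φ := by
    have := norm_toLp_sq (Lp.memLp G)
    rw [Lp.toLp_coeFn] at this
    exact this
  -- Polarization gives ‖gₙ‖² − ‖gₙ − G‖² = 2 Re⟨G, gₙ⟩ − ‖G‖², which converges to ‖G‖² under weak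
  -- convergence. Once the kinetic energies converge, strong convergence follows.
  have hlim2 := (hlim.const_mul 2).sub_const (‖G‖ ^ 2)
  have eGG : 2 * (inner ℂ G G).re - ‖G‖ ^ 2 = kinetic φ := by
    rw [← eG, ← RCLike.re_eq_complex_re, inner_self_eq_norm_sq]; ring
  rw [eGG] at hlim2
  refine hlim2.congr fun n => ?_
  have hsub : ∫ x, ‖(u (k n)).weakDeriv x - φ.weakDeriv x‖ ^ 2 =
      ‖(u (k n)).memLp_weakDeriv.toLp _ - G‖ ^ 2 := by
    have := norm_toLp_sq ((u (k n)).memLp_weakDeriv.sub (Lp.memLp G))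
    rw [MemLp.toLp_sub _ (Lp.memLp G), Lp.toLp_coeFn] at this
    exact this.symm
  have hK : kinetic (u (k n)) = ‖(u (k n)).memLp_weakDeriv.toLp _‖ ^ 2 :=
    (norm_toLp_sq (u (k n)).memLp_weakDeriv).symm
  rw [hsub, hK, norm_sub_rev, norm_sub_sq (𝕜 := ℂ)]
  simp only [Function.comp]
  rw [← RCLike.re_eq_complex_re]
  change _ = _ - (_ - 2 * RCLike.re (inner ℂ G ((u (k₁ (k₂ n))).memLp_weakDeriv.toLp _)) + _)
  ring

/-- The trap prevents loss of mass at infinity, and the uniform bound on the density controls its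
powers. Pointwise convergence therefore suffices, and the limit stays normalized. -/
theorem dens_pow_tendsto {s : ℝ} (hs : 0 < s) {u : ℕ → H1} {φ : H1} {C : ℝ}
    (hm : ∀ n, mass (u n) = 1) (hC : ∀ n, (u n).kap ≤ C)
    (hT : ∀ n, trapping s (u n) ≤ ENNReal.ofReal C)
    (h : ∀ x, Tendsto (fun n => (u n).rep x) atTop (𝓝 (φ.rep x))) :
    mass φ = 1 ∧ Tendsto (fun n => ∫ x, (u n).dens x ^ 2) atTop (𝓝 (∫ x, φ.dens x ^ 2)) ∧
    Tendsto (fun n => ∫ x, (u n).dens x ^ 3) atTop (𝓝 (∫ x, φ.dens x ^ 3)) ∧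
    Tendsto (fun n => ∫ x, ‖(u n).rep x - φ.rep x‖ ^ 2) atTop (𝓝 0) := by
  have hC0 : 0 ≤ C := (u 0).kap_nonneg.trans (hC 0)
  have hd : ∀ n x, (u n).dens x ≤ 2 * C := fun n x =>
    (dens_le (hm n) x).trans (by linarith [hC n])
  have hlim : ∀ x, Tendsto (fun n => (u n).dens x) atTop (𝓝 (φ.dens x)) := fun x =>
    (h x).norm.pow 2
  have hφd : ∀ x, φ.dens x ≤ 2 * C := fun x =>
    le_of_tendsto (hlim x) (Eventually.of_forall fun n => hd n x)
  have hTφ : trapping s φ ≤ ENNReal.ofReal C := by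
    refine (trapping_le_liminf h).trans (liminf_le_of_frequently_le' ?_)
    exact Frequently.of_forall hT
  -- Any nonnegative quantity dominated by a multiple of the two densities inherits their tightness.
  -- It is applied to differences of powers of the densities and to |uₙ − φ|².
  have main : ∀ (f : ℕ → ℝ → ℝ) (c : ℝ), 0 ≤ c → (∀ n, Measurable (f n)) → (∀ n x, 0 ≤ f n x) →
      (∀ n x, f n x ≤ c * ((u n).dens x + φ.dens x)) →
      (∀ x, Tendsto (fun n => f n x) atTop (𝓝 0)) →
      Tendsto (fun n => ∫ x, f n x) atTop (𝓝 0) := by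
    intro f c hc hfm hf0 hfle hfl
    refine integral_tendsto_zero_of_tight hs hfm hf0 (B := c * (2 * C + 2 * C))
      (fun n x => (hfle n x).trans (mul_le_mul_of_nonneg_left (add_le_add (hd n x) (hφd x)) hc)) hfl
      (D := ENNReal.ofReal c * (ENNReal.ofReal C + ENNReal.ofReal C))
      (ENNReal.mul_ne_top ENNReal.ofReal_ne_top (by simp)) fun n => ?_
    have hmu : Measurable fun x => ENNReal.ofReal (|x| ^ s * (u n).dens x) :=
      ((measurable_abs.pow_const s).mul (u n).continuous_dens.measurable).ennreal_ofReal
    calc ∫⁻ x, ENNReal.ofReal (|x| ^ s * f n x)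
        ≤ ∫⁻ x, ENNReal.ofReal c * (ENNReal.ofReal (|x| ^ s * (u n).dens x) +
          ENNReal.ofReal (|x| ^ s * φ.dens x)) := by
          refine lintegral_mono fun x => ?_
          have hx : 0 ≤ |x| ^ s := by positivity
          rw [← ENNReal.ofReal_add (mul_nonneg hx ((u n).dens_nonneg x))
            (mul_nonneg hx (φ.dens_nonneg x)), ← ENNReal.ofReal_mul hc]
          refine ENNReal.ofReal_le_ofReal ((mul_le_mul_of_nonneg_left (hfle n x) hx).trans
            (le_of_eq ?_))
          ring
      _ = ENNReal.ofReal c * (trapping s (u n) + trapping s φ) := by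
          rw [lintegral_const_mul' _ _ ENNReal.ofReal_ne_top, lintegral_add_left hmu,
            trapping_eq, trapping_eq]
      _ ≤ _ := by gcongr; exact hT n
  have powlim : ∀ j : ℕ, Tendsto (fun n => ∫ x, |(u n).dens x ^ (j + 1) - φ.dens x ^ (j + 1)|)
      atTop (𝓝 0) := fun j => by
    refine main _ ((2 * C) ^ j) (by positivity) (fun n => ?_) (fun n x => abs_nonneg _)
      (fun n x => ?_) (fun x => ?_)
    · exact (((u n).continuous_dens.pow _).sub (φ.continuous_dens.pow _)).abs.measurable
    · have h1 := (u n).dens_nonneg x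
      have h2 := φ.dens_nonneg x
      refine (abs_sub _ _).trans ?_
      rw [abs_of_nonneg (by positivity), abs_of_nonneg (by positivity), mul_add, pow_succ, pow_succ]
      exact add_le_add
        (mul_le_mul_of_nonneg_right (pow_le_pow_left₀ h1 (hd n x) j) h1)
        (mul_le_mul_of_nonneg_right (pow_le_pow_left₀ h2 (hφd x) j) h2)
    · have := (((hlim x).pow (j + 1)).sub_const (φ.dens x ^ (j + 1))).abs
      simpa using this
  have hφi : ∀ j : ℕ, Integrable (fun x => φ.dens x ^ (j + 1)) := fun j => by
    refine (φ.integrable_dens.const_mul ((2 * C) ^ j)).mono'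
      (φ.continuous_dens.pow _).aestronglyMeasurable (Eventually.of_forall fun x => ?_)
    have h2 := φ.dens_nonneg x
    rw [Real.norm_of_nonneg (by positivity), pow_succ]
    exact mul_le_mul_of_nonneg_right (pow_le_pow_left₀ h2 (hφd x) j) h2
  have conv : ∀ j : ℕ, Tendsto (fun n => ∫ x, (u n).dens x ^ (j + 1)) atTop
      (𝓝 (∫ x, φ.dens x ^ (j + 1))) := fun j => by
    rw [tendsto_iff_norm_sub_tendsto_zero]
    refine squeeze_zero (fun _ => norm_nonneg _) (fun n => ?_) (powlim j)
    rw [← integral_sub (integrable_dens_pow (hm n) _ (by omega)) (hφi j)]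
    exact norm_integral_le_integral_norm _
  refine ⟨?_, conv 1, conv 2, ?_⟩
  · have := conv 0
    simp only [zero_add, pow_one, integral_dens, hm] at this
    exact (tendsto_nhds_unique tendsto_const_nhds this).symm
  · refine main _ 2 (by norm_num) (fun n => ?_) (fun n x => sq_nonneg _) (fun n x => ?_)
      (fun x => ?_)
    · exact (((u n).continuous_rep.sub φ.continuous_rep).norm.pow 2).measurable
    · have h1 := norm_sub_le ((u n).rep x) (φ.rep x)
      have h2 := norm_nonneg ((u n).rep x - φ.rep x)
      simp only [dens]
      nlinarith [sq_nonneg (‖(u n).rep x‖ - ‖φ.rep x‖)]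
    · have := ((h x).sub_const (φ.rep x)).norm.pow 2
      simpa using this

theorem tendstoInH1_of_kinetic {u : ℕ → H1} {φ : H1}
    (h0 : Tendsto (fun n => ∫ x, ‖(u n).rep x - φ.rep x‖ ^ 2) atTop (𝓝 0))
    (h1 : Tendsto (fun n => kinetic (u n) - ∫ x, ‖(u n).weakDeriv x - φ.weakDeriv x‖ ^ 2)
        atTop (𝓝 (kinetic φ)))
    (hK : Tendsto (fun n => kinetic (u n)) atTop (𝓝 (kinetic φ))) :
    Tendsto (fun n => ∫ x, ‖u n x - φ x‖ ^ 2) atTop (𝓝 0) ∧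
    Tendsto (fun n => ∫ x, ‖(u n).weakDeriv x - φ.weakDeriv x‖ ^ 2) atTop (𝓝 0) := by
  constructor
  · refine h0.congr fun n => integral_congr_ae ?_
    filter_upwards [(u n).ae_rep, φ.ae_rep] with x h1 h2
    rw [h1, h2]
  · have := hK.sub h1
    simpa using this

theorem tendstoInH1 {u : ℕ → H1} {φ : H1}
    (h0 : Tendsto (fun n => ∫ x, ‖u n x - φ x‖ ^ 2) atTop (𝓝 0))
    (h1 : Tendsto (fun n => ∫ x, ‖(u n).weakDeriv x - φ.weakDeriv x‖ ^ 2) atTop (𝓝 0)) :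
    TendstoInH1 (fun n => u n) φ :=
  ⟨fun n => (u n).weakDeriv, φ.weakDeriv,
    Eventually.of_forall fun n => ⟨(u n).memLp_toFun, (u n).memLp_weakDeriv, (u n).hasWeakDeriv⟩,
    ⟨φ.memLp_toFun, φ.memLp_weakDeriv, φ.hasWeakDeriv⟩,
    tendsto_eLpNorm_two (Eventually.of_forall fun n => (u n).memLp_toFun.sub φ.memLp_toFun) h0,
    tendsto_eLpNorm_two
      (Eventually.of_forall fun n => (u n).memLp_weakDeriv.sub φ.memLp_weakDeriv) h1⟩

end H1

end HartreeNLS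

/-! ### The profile Q₀: explicit integrals, moments and the reduced energy. -/

namespace HartreeNLS

theorem integrable_comp_abs {f : ℝ → ℝ} (hf : IntegrableOn f (Set.Ioi 0)) :
    Integrable fun x => f |x| := by
  have h1 : IntegrableOn (fun x => f |x|) (Set.Ioi 0) :=
    hf.congr_fun (fun x hx => by
      rw [abs_of_pos hx]) measurableSet_Ioi
  have h2 : IntegrableOn (fun x ↦ f |x|) (Set.Iic 0) := by
    rw [← Measure.map_neg_eq_self (volume : Measure ℝ)]
    let m : MeasurableEmbedding fun x : ℝ => -x := (Homeomorph.neg ℝ).measurableEmbedding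
    rw [m.integrableOn_map_iff]
    simp_rw [Function.comp_def, abs_neg, Set.neg_preimage, Set.neg_Iic, neg_zero]
    exact Iff.mpr integrableOn_Ici_iff_integrableOn_Ioi h1
  rw [← integrableOn_univ, ← Set.Iic_union_Ioi (a := (0 : ℝ))]
  exact h2.union h1

theorem continuous_Q₀ : Continuous Q₀ := by
  have h : ∀ x : ℝ, √(Real.cosh (Real.pi * x)) ≠ 0 := fun x =>
    (Real.sqrt_pos.mpr (Real.cosh_pos _)).ne'
  exact continuous_const.div (Real.continuous_sqrt.comp
    (Real.continuous_cosh.comp (continuous_const.mul continuous_id))) h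

theorem Q₀_neg (x : ℝ) : Q₀ (-x) = Q₀ x := by
  rw [Q₀, Q₀, mul_neg, Real.cosh_neg]

theorem Q₀_sq_le_one (x : ℝ) : Q₀ x ^ 2 ≤ 1 := by
  rw [Q₀_sq, div_le_one (Real.cosh_pos _)]; exact Real.one_le_cosh _

/-- The exponent is written |x| ^ (1 : ℝ) to match `integrableOn_rpow_mul_exp_neg_mul_rpow` at p =
1. -/
theorem Q₀_sq_le_exp (x : ℝ) : Q₀ x ^ 2 ≤ 2 * Real.exp (-Real.pi * |x| ^ (1 : ℝ)) := by
  rw [Q₀_sq, Real.rpow_one, neg_mul, Real.exp_neg, div_le_iff₀ (Real.cosh_pos _)]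
  have h : Real.exp (Real.pi * |x|) ≤ 2 * Real.cosh (Real.pi * x) := by
    rw [← Real.cosh_abs, abs_mul, abs_of_pos Real.pi_pos, Real.cosh_eq]
    have := Real.exp_pos (-(Real.pi * |x|))
    linarith
  have hp := Real.exp_pos (Real.pi * |x|)
  rw [mul_comm (2 : ℝ), mul_assoc, ← div_eq_inv_mul, le_div_iff₀ hp]
  linarith

theorem integrable_rpow_mul_Q₀_sq {s : ℝ} (hs : -1 < s) :
    Integrable fun x => |x| ^ s * Q₀ x ^ 2 := by
  have h := integrable_comp_abs
    (integrableOn_rpow_mul_exp_neg_mul_rpow (p := 1) hs one_pos Real.pi_pos)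
  refine (h.const_mul 2).mono' ?_ (Eventually.of_forall fun x => ?_)
  · exact ((measurable_abs.pow_const s).mul (continuous_Q₀.measurable.pow_const 2)).aestronglyMeasurable
  · rw [Real.norm_of_nonneg (by positivity)]
    calc |x| ^ s * Q₀ x ^ 2 ≤ |x| ^ s * (2 * Real.exp (-Real.pi * |x| ^ (1 : ℝ))) :=
          mul_le_mul_of_nonneg_left (Q₀_sq_le_exp x) (by positivity)
      _ = _ := by ring

theorem integrable_Q₀_sq : Integrable fun x => Q₀ x ^ 2 := by
  simpa using integrable_rpow_mul_Q₀_sq (s := 0) (by norm_num)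

theorem integrable_Q₀_sq_pow (k : ℕ) : Integrable fun x => (Q₀ x ^ 2) ^ (k + 1) := by
  refine integrable_Q₀_sq.mono' ((continuous_Q₀.pow 2).pow _).aestronglyMeasurable
    (Eventually.of_forall fun x => ?_)
  rw [Real.norm_of_nonneg (by positivity), pow_succ]
  exact mul_le_of_le_one_left (sq_nonneg _) (pow_le_one₀ (sq_nonneg _) (Q₀_sq_le_one x))

theorem tendsto_exp_pi_atTop : Tendsto (fun x : ℝ => Real.exp (Real.pi * x)) atTop atTop :=
  Real.tendsto_exp_atTop.comp (tendsto_id.const_mul_atTop Real.pi_pos)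

theorem tendsto_exp_pi_atBot : Tendsto (fun x : ℝ => Real.exp (Real.pi * x)) atBot (𝓝 0) :=
  Real.tendsto_exp_atBot.comp (tendsto_id.const_mul_atBot Real.pi_pos)

theorem hasDerivAt_exp_pi (x : ℝ) :
    HasDerivAt (fun x : ℝ => Real.exp (Real.pi * x)) (Real.pi * Real.exp (Real.pi * x)) x := by
  have := ((hasDerivAt_id x).const_mul Real.pi).exp
  refine this.congr_deriv ?_
  simp [mul_comm]

theorem Q₀_sq_eq_exp (x : ℝ) :
    Q₀ x ^ 2 = 2 * Real.exp (Real.pi * x) / (1 + Real.exp (Real.pi * x) ^ 2) := by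
  rw [Q₀_sq, Real.cosh_eq, Real.exp_neg]
  have := Real.exp_pos (Real.pi * x)
  field_simp
  ring

theorem integral_Q₀_sq : ∫ x, Q₀ x ^ 2 = 1 := by
  have hpi := Real.pi_pos
  have hd : ∀ x, HasDerivAt (fun x => 2 / Real.pi * Real.arctan (Real.exp (Real.pi * x)))
      (Q₀ x ^ 2) x := fun x => by
    refine ((hasDerivAt_exp_pi x).arctan.const_mul (2 / Real.pi)).congr_deriv ?_
    rw [Q₀_sq_eq_exp]
    field_simp
  have h1 : Tendsto (fun x => 2 / Real.pi * Real.arctan (Real.exp (Real.pi * x))) atTop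
      (𝓝 (2 / Real.pi * (Real.pi / 2))) :=
    ((tendsto_nhds_of_tendsto_nhdsWithin Real.tendsto_arctan_atTop).comp
      tendsto_exp_pi_atTop).const_mul _
  have h2 : Tendsto (fun x => 2 / Real.pi * Real.arctan (Real.exp (Real.pi * x))) atBot
      (𝓝 (2 / Real.pi * Real.arctan 0)) :=
    ((Real.continuous_arctan.tendsto 0).comp tendsto_exp_pi_atBot).const_mul _
  rw [integral_of_hasDerivAt_of_tendsto hd integrable_Q₀_sq h2 h1]
  simp

theorem integral_Q₀_four : ∫ x, (Q₀ x ^ 2) ^ 2 = 2 / Real.pi := by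
  have hpi := Real.pi_pos
  -- With t = e^(πx) the integrand is 4t²/(1 + t²)² and dt = πt dx, so the primitive is a multiple
  -- of 1/(1 + t²).
  have hd : ∀ x, HasDerivAt (fun x => -(2 / Real.pi) * (1 + Real.exp (Real.pi * x) ^ 2)⁻¹)
      ((Q₀ x ^ 2) ^ 2) x := fun x => by
    have h0 : 1 + Real.exp (Real.pi * x) ^ 2 ≠ 0 := by positivity
    refine ((((hasDerivAt_exp_pi x).fun_pow 2).const_add 1).fun_inv h0 |>.const_mul
      (-(2 / Real.pi))).congr_deriv ?_
    rw [Q₀_sq_eq_exp]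
    field_simp
    push_cast
    ring
  have h1 : Tendsto (fun x => -(2 / Real.pi) * (1 + Real.exp (Real.pi * x) ^ 2)⁻¹) atTop
      (𝓝 (-(2 / Real.pi) * 0)) := by
    refine Tendsto.const_mul _ (tendsto_inv_atTop_zero.comp ?_)
    exact tendsto_atTop_add_const_left _ _
      ((tendsto_pow_atTop two_ne_zero).comp tendsto_exp_pi_atTop)
  have h2 : Tendsto (fun x => -(2 / Real.pi) * (1 + Real.exp (Real.pi * x) ^ 2)⁻¹) atBot
      (𝓝 (-(2 / Real.pi) * (1 + 0 ^ 2)⁻¹)) := by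
    refine Tendsto.const_mul _ (Tendsto.inv₀ ?_ (by norm_num))
    exact (tendsto_exp_pi_atBot.pow 2).const_add 1
  rw [integral_of_hasDerivAt_of_tendsto hd (integrable_Q₀_sq_pow 1) h2 h1]
  norm_num

theorem hasDerivAt_Q₀_sq (x : ℝ) : HasDerivAt (fun x => Q₀ x ^ 2)
    (-Real.pi * Real.tanh (Real.pi * x) * Q₀ x ^ 2) x := by
  have h0 := (Real.cosh_pos (Real.pi * x)).ne'
  have h1 : HasDerivAt (fun x => Real.cosh (Real.pi * x)) (Real.sinh (Real.pi * x) * Real.pi) x := by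
    have := ((hasDerivAt_id x).const_mul Real.pi).cosh
    simpa using this
  have h2 := h1.inv h0
  have e : (fun x => Q₀ x ^ 2) = (fun x => Real.cosh (Real.pi * x))⁻¹ := by
    funext x; rw [Q₀_sq]; simp
  rw [e]
  refine h2.congr_deriv ?_
  rw [Q₀_sq, Real.tanh_eq_sinh_div_cosh]
  field_simp

theorem tanh_sq_pi (x : ℝ) : Real.tanh (Real.pi * x) ^ 2 = 1 - (Q₀ x ^ 2) ^ 2 := by
  rw [Q₀_sq, Real.tanh_eq_sinh_div_cosh, div_pow, Real.sinh_sq]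
  have h0 := (Real.cosh_pos (Real.pi * x)).ne'
  field_simp

theorem hasDerivAt_tanh_pi (x : ℝ) : HasDerivAt (fun x => Real.tanh (Real.pi * x))
    (Real.pi * (Q₀ x ^ 2) ^ 2) x := by
  have h0 := (Real.cosh_pos (Real.pi * x)).ne'
  have h1 : HasDerivAt (fun x => Real.cosh (Real.pi * x)) (Real.sinh (Real.pi * x) * Real.pi) x := by
    have := ((hasDerivAt_id x).const_mul Real.pi).cosh
    simpa using this
  have h2 : HasDerivAt (fun x => Real.sinh (Real.pi * x)) (Real.cosh (Real.pi * x) * Real.pi) x := by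
    have := ((hasDerivAt_id x).const_mul Real.pi).sinh
    simpa using this
  have e : (fun x => Real.tanh (Real.pi * x)) =
      (fun x => Real.sinh (Real.pi * x) / Real.cosh (Real.pi * x)) := by
    funext x; rw [Real.tanh_eq_sinh_div_cosh]
  rw [e]
  refine (h2.div h1 h0).congr_deriv ?_
  rw [Q₀_sq]
  have := Real.cosh_sq_sub_sinh_sq (Real.pi * x)
  field_simp
  linarith

theorem continuous_tanh_pi : Continuous fun x => Real.tanh (Real.pi * x) :=
  continuous_iff_continuousAt.mpr fun x => (hasDerivAt_tanh_pi x).continuousAt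

theorem abs_tanh_pi_le (x : ℝ) : |Real.tanh (Real.pi * x)| ≤ 1 := by
  rw [← sq_le_one_iff_abs_le_one, tanh_sq_pi]
  have := sq_nonneg (Q₀ x ^ 2)
  linarith

theorem integral_Q₀_six : ∫ x, (Q₀ x ^ 2) ^ 3 = 1 / 2 := by
  have hpi := Real.pi_pos
  -- Differentiating Q₀² tanh(πx) and using tanh² = 1 − Q₀⁴ relates the sixth power to the mass, so
  -- no further primitive is needed.
  have hd : ∀ x, HasDerivAt (fun x => 1 / Real.pi * (Q₀ x ^ 2 * Real.tanh (Real.pi * x)))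
      (2 * (Q₀ x ^ 2) ^ 3 - Q₀ x ^ 2) x := fun x => by
    refine (((hasDerivAt_Q₀_sq x).mul (hasDerivAt_tanh_pi x)).const_mul
      (1 / Real.pi)).congr_deriv ?_
    have h := tanh_sq_pi x
    field_simp
    linear_combination (-(Q₀ x ^ 2)) * h
  have hac := ACDeriv.of_hasDerivAt hd (by have := continuous_Q₀; fun_prop)
  have i3 := integrable_Q₀_sq_pow 2
  have hi' : Integrable fun x => 2 * (Q₀ x ^ 2) ^ 3 - Q₀ x ^ 2 :=
    (i3.const_mul 2).sub integrable_Q₀_sq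
  have h0 := hac.integral_eq_zero_of_integrable
    ((integrable_mul_bounded integrable_Q₀_sq continuous_tanh_pi.aestronglyMeasurable
      abs_tanh_pi_le).const_mul _) hi'
  rw [integral_sub (i3.const_mul 2) integrable_Q₀_sq, integral_const_mul, integral_Q₀_sq] at h0
  linarith

theorem hasDerivAt_Q₀ (x : ℝ) :
    HasDerivAt Q₀ (-(Real.pi / 2) * Real.tanh (Real.pi * x) * Q₀ x) x := by
  have hp := Q₀_pos x
  have h := (hasDerivAt_Q₀_sq x).sqrt (by positivity)
  have e : Q₀ = fun x => √(Q₀ x ^ 2) := by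
    funext x; rw [Real.sqrt_sq (Q₀_pos x).le]
  rw [e]
  refine h.congr_deriv ?_
  simp only [Real.sqrt_sq (Q₀_pos _).le]
  field_simp

/-- The optimizer `Q₀` as an element of `H¹`. -/
noncomputable def soliton : H1 where
  toFun x := (Q₀ x : ℂ)
  weakDeriv x := ((-(Real.pi / 2) * Real.tanh (Real.pi * x) * Q₀ x : ℝ) : ℂ)
  memLp_toFun := by
    refine (memLp_two_iff_integrable_sq_norm
      (Complex.continuous_ofReal.comp continuous_Q₀).aestronglyMeasurable).mpr ?_
    simpa using integrable_Q₀_sq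
  memLp_weakDeriv := by
    have hc : Continuous fun x => -(Real.pi / 2) * Real.tanh (Real.pi * x) * Q₀ x :=
      (continuous_const.mul continuous_tanh_pi).mul continuous_Q₀
    refine (memLp_two_iff_integrable_sq_norm
      (Complex.continuous_ofReal.comp hc).aestronglyMeasurable).mpr ?_
    have h := (integrable_Q₀_sq.sub (integrable_Q₀_sq_pow 2)).const_mul ((Real.pi / 2) ^ 2)
    refine h.congr (Eventually.of_forall fun x => ?_)
    simp only [Function.comp_apply, Pi.sub_apply, Complex.norm_real, Real.norm_eq_abs, sq_abs]
    rw [mul_pow, mul_pow, tanh_sq_pi]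
    ring
  hasWeakDeriv := by
    have hc : Continuous fun x => -(Real.pi / 2) * Real.tanh (Real.pi * x) * Q₀ x :=
      (continuous_const.mul continuous_tanh_pi).mul continuous_Q₀
    refine hasWeakDeriv_of_ftc (Complex.continuous_ofReal.comp hc).locallyIntegrable fun a b => ?_
    rw [intervalIntegral.integral_ofReal, ← (ACDeriv.of_hasDerivAt hasDerivAt_Q₀ hc).ftc]
    push_cast
    rfl

theorem soliton_rep : soliton.rep = fun x => (Q₀ x : ℂ) :=
  H1.eq_of_pointwise (Complex.continuous_ofReal.comp continuous_Q₀) rfl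

theorem soliton_dens (x : ℝ) : soliton.dens x = Q₀ x ^ 2 := by
  rw [H1.dens, soliton_rep]; simp

theorem mass_soliton : mass soliton = 1 := by
  rw [← H1.integral_dens]
  simp_rw [soliton_dens]
  exact integral_Q₀_sq

theorem kinetic_soliton : kinetic soliton = Real.pi ^ 2 / 8 := by
  have h : kinetic soliton = ∫ x, (Real.pi / 2) ^ 2 * (Q₀ x ^ 2 - (Q₀ x ^ 2) ^ 3) := by
    refine integral_congr_ae (Eventually.of_forall fun x => ?_)
    simp only [soliton, Complex.norm_real, Real.norm_eq_abs, sq_abs]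
    rw [mul_pow, mul_pow, tanh_sq_pi]
    ring
  rw [h, integral_const_mul, integral_sub integrable_Q₀_sq (integrable_Q₀_sq_pow 2),
    integral_Q₀_sq, integral_Q₀_six]
  ring

/-- The moment `∫ |x|^s |Q₀(x - c)|² dx` of the translated optimizer. -/
noncomputable def moment (s c : ℝ) : ℝ := ∫ x, |x| ^ s * Q₀ (x - c) ^ 2

theorem integrable_moment {s : ℝ} (hs : 0 < s) (c : ℝ) :
    Integrable fun x => |x| ^ s * Q₀ (x - c) ^ 2 := by
  have h1 := (integrable_rpow_mul_Q₀_sq (s := s) (by linarith)).comp_sub_right c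
  have h2 := integrable_Q₀_sq.comp_sub_right c
  refine ((h1.const_mul (2 ^ s)).add (h2.const_mul (2 ^ s * |c| ^ s))).mono' ?_
    (Eventually.of_forall fun x => ?_)
  · exact ((measurable_abs.pow_const s).mul ((continuous_Q₀.comp
      (continuous_id.sub continuous_const)).measurable.pow_const 2)).aestronglyMeasurable
  · rw [Real.norm_of_nonneg (by positivity)]
    have h : |x| ^ s ≤ 2 ^ s * (|x - c| ^ s + |c| ^ s) := by
      have hm : |x| ≤ 2 * max |x - c| |c| := by
        have : |x| ≤ |x - c| + |c| := by simpa using abs_add_le (x - c) c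
        linarith [le_max_left |x - c| |c|, le_max_right |x - c| |c|]
      have h3 : (max |x - c| |c|) ^ s ≤ |x - c| ^ s + |c| ^ s := by
        rcases max_choice |x - c| |c| with h | h <;> rw [h]
        · have : 0 ≤ |c| ^ s := by positivity
          linarith
        · have : 0 ≤ |x - c| ^ s := by positivity
          linarith
      calc |x| ^ s ≤ (2 * max |x - c| |c|) ^ s := Real.rpow_le_rpow (abs_nonneg _) hm hs.le
        _ = 2 ^ s * (max |x - c| |c|) ^ s := Real.mul_rpow (by norm_num) (by positivity)
        _ ≤ _ := mul_le_mul_of_nonneg_left h3 (by positivity)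
    have := mul_le_mul_of_nonneg_right h (sq_nonneg (Q₀ (x - c)))
    refine this.trans (le_of_eq ?_)
    simp only [Pi.add_apply]
    ring

theorem Q₀_sq_lt_iff {x y : ℝ} : Q₀ x ^ 2 < Q₀ y ^ 2 ↔ |y| < |x| := by
  rw [Q₀_sq, Q₀_sq, one_div_lt_one_div (Real.cosh_pos _) (Real.cosh_pos _), Real.cosh_lt_cosh,
    abs_mul, abs_mul, mul_lt_mul_iff_right₀ (abs_pos.mpr Real.pi_pos.ne')]

/-- The reflection x ↦ c − x exchanges the two bells Q₀² and Q₀(· − c)². After symmetrization the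
integrand is a product of two factors of equal sign, since |x|^s increases and Q₀² decreases with
|x|. -/
theorem moment_lt {s : ℝ} (hs : 0 < s) {c : ℝ} (hc : c ≠ 0) : moment s 0 < moment s c := by
  have i0 := integrable_moment hs 0
  have ic := integrable_moment hs c
  set f : ℝ → ℝ := fun x => |x| ^ s * (Q₀ (x - c) ^ 2 - Q₀ x ^ 2) with hf
  have hfi : Integrable f := by
    refine (ic.sub i0).congr (Eventually.of_forall fun x => ?_)
    simp only [Pi.sub_apply, sub_zero, hf]
    ring
  have hfe : ∫ x, f x = moment s c - moment s 0 := by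
    rw [moment, moment, ← integral_sub ic i0]
    congr 1; funext x; simp only [sub_zero, hf]; ring
  have hfi' : Integrable (fun x => f (c - x)) := hfi.comp_sub_left c
  set g : ℝ → ℝ := fun x => (|x| ^ s - |c - x| ^ s) * (Q₀ (x - c) ^ 2 - Q₀ x ^ 2) with hg
  have hge : ∀ x, g x = f x + f (c - x) := fun x => by
    have e1 : Q₀ (c - x - c) = Q₀ x := by rw [← Q₀_neg x]; ring_nf
    have e2 : Q₀ (c - x) = Q₀ (x - c) := by rw [← Q₀_neg (x - c)]; ring_nf
    simp only [hf, hg, e1, e2]; ring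
  have hgi : Integrable g := (hfi.add hfi').congr (Eventually.of_forall fun x => (hge x).symm)
  have hg2 : ∫ x, g x = 2 * (moment s c - moment s 0) := by
    simp_rw [hge]
    rw [integral_add hfi hfi', integral_sub_left_eq_self, hfe]; ring
  -- Both factors have the sign of |x| − |x − c|, and equality of these distances with c ≠ 0 occurs
  -- only at the midpoint.
  have key : ∀ x, x ≠ c / 2 → 0 < g x := fun x hx => by
    have e : |c - x| = |x - c| := abs_sub_comm _ _
    rcases lt_trichotomy |x| |x - c| with h | h | h
    · refine mul_pos_of_neg_of_neg ?_ ?_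
      · rw [e]; exact sub_neg.mpr (Real.rpow_lt_rpow (abs_nonneg _) h hs)
      · exact sub_neg.mpr (Q₀_sq_lt_iff.mpr h)
    · exfalso
      rcases abs_eq_abs.mp h with h | h
      · exact hc (by linarith)
      · exact hx (by linarith)
    · refine mul_pos ?_ ?_
      · rw [e]; exact sub_pos.mpr (Real.rpow_lt_rpow (abs_nonneg _) h hs)
      · exact sub_pos.mpr (Q₀_sq_lt_iff.mpr h)
  have hae : ∀ᵐ x, 0 < g x := by
    have : ∀ᵐ x : ℝ, x ≠ c / 2 := by simp [ae_iff, measure_singleton]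
    filter_upwards [this] with x hx using key x hx
  have hpos : 0 < ∫ x, g x := by
    rw [integral_pos_iff_support_of_nonneg_ae (hae.mono fun x hx => hx.le) hgi]
    have : Function.support g =ᵐ[volume] Set.univ := by
      filter_upwards [hae] with x hx
      exact eq_true (by exact hx.ne')
    rw [measure_congr this]
    simp
  rw [hg2] at hpos
  linarith

theorem Qs_eq (s : ℝ) : Qs s = s * moment s 0 := by
  simp only [Qs, moment, sq_abs, sub_zero]

theorem moment_zero_pos {s : ℝ} (hs : 0 < s) : 0 < moment s 0 := by
  have hae : ∀ᵐ x : ℝ, x ≠ 0 := by simp [ae_iff, measure_singleton]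
  have hpos : ∀ᵐ x : ℝ, 0 < |x| ^ s * Q₀ (x - 0) ^ 2 := by
    filter_upwards [hae] with x hx
    have := Q₀_pos (x - 0)
    have := abs_pos.mpr hx
    positivity
  rw [moment, integral_pos_iff_support_of_nonneg_ae (hpos.mono fun x hx => hx.le)
    (integrable_moment hs 0)]
  have : Function.support (fun x : ℝ => |x| ^ s * Q₀ (x - 0) ^ 2) =ᵐ[volume] Set.univ := by
    filter_upwards [hpos] with x hx
    exact eq_true (by exact hx.ne')
  rw [measure_congr this]
  simp

theorem Qs_pos {s : ℝ} (hs : 0 < s) : 0 < Qs s := by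
  rw [Qs_eq]; exact mul_pos hs (moment_zero_pos hs)

/-- The reduced energy of a dilated and translated optimizer is minimal exactly at `Q₀`. -/
theorem reduced_energy {s ζ : ℝ} (hs : 0 < s) (hζ : 0 ≤ ζ) {l y : ℝ} (hl : 0 < l) :
    Qs s * ((s + 1) / s - ζ / 12) ≤
      l ^ (-s) * moment s y + ζ * Qs s / 6 * (l ^ 2 / 2) +
        Real.pi * ((6 - ζ) / 6) * Qs s / 2 * (2 * l / Real.pi) ∧
    (l ^ (-s) * moment s y + ζ * Qs s / 6 * (l ^ 2 / 2) +
        Real.pi * ((6 - ζ) / 6) * Qs s / 2 * (2 * l / Real.pi) ≤ Qs s * ((s + 1) / s - ζ / 12) →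
      l = 1 ∧ y = 0) := by
  have hQ := Qs_pos hs
  have hm0 : moment s 0 = Qs s / s := by rw [Qs_eq]; field_simp
  have hmom : moment s 0 ≤ moment s y := by
    rcases eq_or_ne y 0 with h | h
    · rw [h]
    · exact (moment_lt hs h).le
  have hlp : 0 < l ^ (-s) := Real.rpow_pos_of_pos hl _
  have hls : l ^ (-s) = Real.exp (-s * Real.log l) := by
    rw [Real.rpow_def_of_pos hl]; ring_nf
  have h1 : 1 - s * Real.log l ≤ l ^ (-s) := by
    rw [hls]; linarith [Real.add_one_le_exp (-s * Real.log l)]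
  have h2 : 1 + Real.log l ≤ l := by linarith [Real.log_le_sub_one_of_pos hl]
  have hrw : Real.pi * ((6 - ζ) / 6) * Qs s / 2 * (2 * l / Real.pi) = (6 - ζ) / 6 * Qs s * l := by
    have := Real.pi_pos
    field_simp
  rw [hrw]
  -- The excess energy splits into four nonnegative parts: off-centring, the square (l − 1)²
  -- weighted by ζ, convexity of l^(-s) in log l, and l ≥ 1 + log l. The logarithms cancel, and no
  -- sign of 6 − ζ is needed.
  have hdiff : l ^ (-s) * moment s y + ζ * Qs s / 6 * (l ^ 2 / 2) + (6 - ζ) / 6 * Qs s * l -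
      Qs s * ((s + 1) / s - ζ / 12) = l ^ (-s) * (moment s y - moment s 0) +
      Qs s * (ζ / 12 * (l - 1) ^ 2) + Qs s / s * (l ^ (-s) - (1 - s * Real.log l)) +
      Qs s * (l - (1 + Real.log l)) := by
    rw [hm0]; field_simp; ring
  have t1 : 0 ≤ l ^ (-s) * (moment s y - moment s 0) := mul_nonneg hlp.le (by linarith)
  have t2 : 0 ≤ Qs s * (ζ / 12 * (l - 1) ^ 2) := by positivity
  have t3 : 0 ≤ Qs s / s * (l ^ (-s) - (1 - s * Real.log l)) :=
    mul_nonneg (by positivity) (by linarith)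
  have t4 : 0 ≤ Qs s * (l - (1 + Real.log l)) := mul_nonneg hQ.le (by linarith)
  refine ⟨by linarith, fun hle => ?_⟩
  have hl1 : l = 1 := by
    by_contra hne
    have hlog := Real.log_lt_sub_one_of_pos hl hne
    have : 0 < Qs s * (l - (1 + Real.log l)) := mul_pos hQ (by linarith)
    linarith
  refine ⟨hl1, ?_⟩
  by_contra hy
  have : 0 < l ^ (-s) * (moment s y - moment s 0) :=
    mul_pos hlp (by linarith [moment_lt hs hy])
  linarith

section Bubble

variable {φ : H1} {l x₀ : ℝ}

theorem integral_dens_sq_of_bubble (hl : 0 < l) (h : ∀ x, φ.dens x = l * Q₀ (l * (x - x₀)) ^ 2) :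
    ∫ x, φ.dens x ^ 2 = 2 * l / Real.pi := by
  simp_rw [h, mul_pow]
  rw [integral_const_mul, integral_sub_right_eq_self (fun x => (Q₀ (l * x) ^ 2) ^ 2) x₀,
    Measure.integral_comp_mul_left (fun x => (Q₀ x ^ 2) ^ 2) l, integral_Q₀_four,
    abs_of_pos (by positivity), smul_eq_mul]
  field_simp

theorem integral_dens_cube_of_bubble (hl : 0 < l) (h : ∀ x, φ.dens x = l * Q₀ (l * (x - x₀)) ^ 2) :
    ∫ x, φ.dens x ^ 3 = l ^ 2 / 2 := by
  simp_rw [h, mul_pow]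
  rw [integral_const_mul, integral_sub_right_eq_self (fun x => (Q₀ (l * x) ^ 2) ^ 3) x₀,
    Measure.integral_comp_mul_left (fun x => (Q₀ x ^ 2) ^ 3) l, integral_Q₀_six,
    abs_of_pos (by positivity), smul_eq_mul]
  field_simp

theorem trapping_of_bubble {s : ℝ} (hs : 0 < s) (hl : 0 < l)
    (h : ∀ x, φ.dens x = l * Q₀ (l * (x - x₀)) ^ 2) :
    trapping s φ = ENNReal.ofReal (l ^ (-s) * moment s (l * x₀)) := by
  have e : ∀ x, |x| ^ s * φ.dens x =
      l ^ (1 - s) * (|l * x| ^ s * Q₀ (l * x - l * x₀) ^ 2) := fun x => by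
    rw [h, abs_mul, abs_of_pos hl, Real.mul_rpow hl.le (abs_nonneg _), ← mul_sub,
      Real.rpow_sub hl, Real.rpow_one]
    have : l ^ s ≠ 0 := (Real.rpow_pos_of_pos hl s).ne'
    field_simp
  have hi := (integrable_moment hs (l * x₀)).comp_mul_left' hl.ne'
  rw [H1.trapping_eq]
  simp_rw [e]
  rw [← ofReal_integral_eq_lintegral_ofReal (hi.const_mul _)
    (Eventually.of_forall fun x => by positivity), integral_const_mul,
    Measure.integral_comp_mul_left (fun x => |x| ^ s * Q₀ (x - l * x₀) ^ 2) l,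
    abs_of_pos (by positivity), smul_eq_mul, ← mul_assoc, moment]
  congr 2
  rw [sub_eq_neg_add, Real.rpow_add hl, Real.rpow_one]
  field_simp

end Bubble

end HartreeNLS

/-! ### Normalized dilations of H¹ functions. -/

namespace HartreeNLS

theorem ae_comp_mul_left {E : Type*} {f g : ℝ → E} {r : ℝ} (hr : r ≠ 0) (h : f =ᵐ[volume] g) :
    (fun x => f (r * x)) =ᵐ[volume] fun x => g (r * x) :=
  (Measure.quasiMeasurePreserving_smul (volume : Measure ℝ) hr).ae_eq_comp h

theorem memLp_two_const_mul_comp {f : ℝ → ℂ} (hf : MemLp f 2) (c : ℂ) {r : ℝ} (hr : r ≠ 0) :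
    MemLp (fun x => c * f (r * x)) 2 := by
  have hm : AEStronglyMeasurable (fun x => c * f (r * x)) volume :=
    (hf.1.comp_quasiMeasurePreserving
      (Measure.quasiMeasurePreserving_smul (volume : Measure ℝ) hr)).const_mul c
  refine (memLp_two_iff_integrable_sq_norm hm).mpr ?_
  have := ((integrable_sq_of_memLp hf).comp_mul_left' hr).const_mul (‖c‖ ^ 2)
  refine this.congr (Eventually.of_forall fun x => ?_)
  simp [mul_pow]

theorem integral_norm_sq_const_mul_comp (f : ℝ → ℂ) (c : ℂ) {r : ℝ} (hr : 0 < r) :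
    ∫ x, ‖c * f (r * x)‖ ^ 2 = ‖c‖ ^ 2 / r * ∫ x, ‖f x‖ ^ 2 := by
  simp_rw [norm_mul, mul_pow]
  rw [integral_const_mul, Measure.integral_comp_mul_left (fun x => ‖f x‖ ^ 2) r,
    abs_of_pos (by positivity), smul_eq_mul]
  ring

namespace H1

/-- The `L²`-normalized dilation `√ℓ u(ℓ x)` of an `H¹` function. -/
noncomputable def scl (ℓ : ℝ) (u : H1) : H1 :=
  if h : 0 < ℓ then
    { toFun := rescale ℓ u
      weakDeriv := fun x => ((ℓ * √ℓ : ℝ) : ℂ) * u.weakDeriv (ℓ * x)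
      memLp_toFun := memLp_two_const_mul_comp u.memLp_toFun _ h.ne'
      memLp_weakDeriv := memLp_two_const_mul_comp u.memLp_weakDeriv _ h.ne'
      hasWeakDeriv := by
        have hl := (memLp_two_const_mul_comp u.memLp_weakDeriv ((ℓ * √ℓ : ℝ) : ℂ)
          h.ne').locallyIntegrable (by norm_num)
        have hw := hasWeakDeriv_of_ftc (f := fun x => (√ℓ : ℂ) * u.rep (ℓ * x)) hl (fun a b => by
          rw [intervalIntegral.integral_const_mul,
            intervalIntegral.integral_comp_mul_left (fun x => u.weakDeriv x) h.ne', ← u.rep_sub,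
            Complex.real_smul]
          push_cast
          have : (ℓ : ℂ) ≠ 0 := by exact_mod_cast h.ne'
          field_simp)
        intro φ hφ hs
        rw [← hw φ hφ hs]
        refine integral_congr_ae ?_
        filter_upwards [ae_comp_mul_left h.ne' u.ae_rep] with x hx
        rw [rescale, hx] }
  -- The value for ℓ ≤ 0 is arbitrary; it makes dilation total, since the length ℓ N is only known
  -- to be positive for large N.
  else u

theorem scl_toFun {ℓ : ℝ} (hℓ : 0 < ℓ) (u : H1) : (scl ℓ u).toFun = rescale ℓ u := by
  rw [scl, dif_pos hℓ]

theorem scl_weakDeriv {ℓ : ℝ} (hℓ : 0 < ℓ) (u : H1) :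
    (scl ℓ u).weakDeriv = fun x => ((ℓ * √ℓ : ℝ) : ℂ) * u.weakDeriv (ℓ * x) := by
  rw [scl, dif_pos hℓ]

theorem scl_rep {ℓ : ℝ} (hℓ : 0 < ℓ) (u : H1) : (scl ℓ u).rep = fun x => (√ℓ : ℂ) * u.rep (ℓ * x) := by
  refine (Continuous.ae_eq_iff_eq volume (scl ℓ u).continuous_rep ?_).mp ?_
  · exact continuous_const.mul (u.continuous_rep.comp (continuous_const.mul continuous_id))
  · refine (scl ℓ u).ae_rep.symm.trans ?_
    rw [scl_toFun hℓ]
    filter_upwards [ae_comp_mul_left hℓ.ne' u.ae_rep] with x hx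
    rw [rescale, hx]

theorem scl_dens {ℓ : ℝ} (hℓ : 0 < ℓ) (u : H1) (x : ℝ) : (scl ℓ u).dens x = ℓ * u.dens (ℓ * x) := by
  rw [dens, dens, scl_rep hℓ, norm_mul, mul_pow, Complex.norm_real, Real.norm_eq_abs, sq_abs,
    Real.sq_sqrt hℓ.le]

theorem mass_scl {ℓ : ℝ} (hℓ : 0 < ℓ) (u : H1) : mass (scl ℓ u) = mass u := by
  rw [← integral_dens, ← integral_dens]
  simp_rw [scl_dens hℓ]
  rw [integral_const_mul, Measure.integral_comp_mul_left u.dens ℓ, abs_of_pos (by positivity),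
    smul_eq_mul]
  field_simp

theorem kinetic_scl {ℓ : ℝ} (hℓ : 0 < ℓ) (u : H1) : kinetic (scl ℓ u) = ℓ ^ 2 * kinetic u := by
  rw [kinetic, kinetic, scl_weakDeriv hℓ, integral_norm_sq_const_mul_comp _ _ hℓ,
    Complex.norm_real, Real.norm_eq_abs, sq_abs, mul_pow, Real.sq_sqrt hℓ.le]
  field_simp

theorem kap_scl {ℓ : ℝ} (hℓ : 0 < ℓ) (u : H1) : (scl ℓ u).kap = ℓ * u.kap := by
  rw [kap, kap, kinetic_scl hℓ, Real.sqrt_mul (sq_nonneg _), Real.sqrt_sq hℓ.le]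

theorem integral_dens_pow_scl {ℓ : ℝ} (hℓ : 0 < ℓ) (u : H1) (k : ℕ) :
    ∫ x, (scl ℓ u).dens x ^ (k + 1) = ℓ ^ k * ∫ x, u.dens x ^ (k + 1) := by
  simp_rw [scl_dens hℓ, mul_pow]
  rw [integral_const_mul, Measure.integral_comp_mul_left (fun x => u.dens x ^ (k + 1)) ℓ,
    abs_of_pos (by positivity), smul_eq_mul, pow_succ]
  field_simp

theorem trapping_scl {ℓ : ℝ} (hℓ : 0 < ℓ) (u : H1) (s : ℝ) :
    trapping s (scl ℓ u) = ENNReal.ofReal (ℓ ^ (-s)) * trapping s u := by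
  rw [trapping_eq, trapping_eq]
  have e : ∀ x, ENNReal.ofReal (|x| ^ s * (scl ℓ u).dens x) = ENNReal.ofReal (ℓ ^ (-s) * ℓ) *
      (fun y => ENNReal.ofReal (|y| ^ s * u.dens y)) (ℓ * x) := fun x => by
    rw [← ENNReal.ofReal_mul (by positivity), scl_dens hℓ, abs_mul, abs_of_pos hℓ,
      Real.mul_rpow hℓ.le (abs_nonneg _), Real.rpow_neg hℓ.le]
    have : ℓ ^ s ≠ 0 := (Real.rpow_pos_of_pos hℓ s).ne'
    congr 1
    field_simp
  simp_rw [e]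
  have hm : Measurable fun y => ENNReal.ofReal (|y| ^ s * u.dens y) :=
    ((measurable_abs.pow_const s).mul u.continuous_dens.measurable).ennreal_ofReal
  rw [lintegral_const_mul' _ _ ENNReal.ofReal_ne_top]
  have hmap := Real.smul_map_volume_mul_left hℓ.ne'
  have h1 : ∫⁻ y, ENNReal.ofReal (|y| ^ s * u.dens y) = ENNReal.ofReal ℓ *
      ∫⁻ x, (fun y => ENNReal.ofReal (|y| ^ s * u.dens y)) (ℓ * x) := by
    conv_lhs => rw [← hmap]
    rw [lintegral_smul_measure, lintegral_map hm (measurable_const_mul ℓ), abs_of_pos hℓ,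
      smul_eq_mul]
  rw [h1, ENNReal.ofReal_mul (by positivity), mul_assoc]

theorem trapping_scl_toReal {ℓ : ℝ} (hℓ : 0 < ℓ) (u : H1) (s : ℝ) :
    (trapping s (scl ℓ u)).toReal = ℓ ^ (-s) * (trapping s u).toReal := by
  rw [trapping_scl hℓ, ENNReal.toReal_mul, ENNReal.toReal_ofReal (by positivity)]

theorem trapping_scl_ne_top {ℓ : ℝ} (hℓ : 0 < ℓ) (u : H1) {s : ℝ} (h : trapping s u ≠ ⊤) :
    trapping s (scl ℓ u) ≠ ⊤ := by
  rw [trapping_scl hℓ]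
  exact ENNReal.mul_ne_top ENNReal.ofReal_ne_top h

theorem ae_hasDerivAt_rep (u : H1) : ∀ᵐ x, HasDerivAt u.rep (u.weakDeriv x) x := by
  filter_upwards [LocallyIntegrable.ae_hasDerivAt_integral u.loc_weakDeriv] with x hx
  have h : u.rep = fun x => u.rep 0 + ∫ t in (0 : ℝ)..x, u.weakDeriv t := funext fun x => by
    rw [← u.rep_sub]; ring
  rw [h]
  exact (hx 0).const_add _

end H1

/-- The weak derivative is almost everywhere the classical derivative of the representative, so it
is determined by the latter. -/
theorem weakDeriv_ae_of_rep_eq {φ ψ : H1} {z : ℂ} (h : ∀ x, φ.rep x = z * ψ.rep x) :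
    ∀ᵐ x, φ.weakDeriv x = z * ψ.weakDeriv x := by
  filter_upwards [φ.ae_hasDerivAt_rep, ψ.ae_hasDerivAt_rep] with x h1 h2
  have h3 : φ.rep = fun x => z * ψ.rep x := funext h
  rw [h3] at h1
  exact h1.unique (h2.const_mul z)

end HartreeNLS

/-! ### A priori bounds and limits of rescaled states. -/

namespace HartreeNLS

theorem le_of_quadratic {a b c x : ℝ} (ha : 0 < a) (hb : 0 ≤ b) (hc : 0 ≤ c)
    (h : a * x ^ 2 ≤ b * x + c) : x ≤ 1 + (b + c) / a := by
  rcases le_or_gt x 1 with h1 | h1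
  · have : 0 ≤ (b + c) / a := by positivity
    linarith
  · have h2 : a * x ≤ b + c := by
      by_contra! hlt
      nlinarith
    have h3 : x ≤ (b + c) / a := by rw [le_div_iff₀ ha]; linarith
    linarith

namespace H1

variable {u : H1}

theorem integral_dens_sq_nonneg (u : H1) : 0 ≤ ∫ x, u.dens x ^ 2 :=
  integral_nonneg fun _ => sq_nonneg _

theorem integral_dens_cube_nonneg (u : H1) : 0 ≤ ∫ x, u.dens x ^ 3 :=
  integral_nonneg fun x => pow_nonneg (u.dens_nonneg x) 3

theorem integral_dens_sq_le (hm : mass u = 1) : ∫ x, u.dens x ^ 2 ≤ 2 * u.kap := by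
  calc ∫ x, u.dens x ^ 2 ≤ ∫ x, 2 * u.kap * u.dens x := by
        refine integral_mono (integrable_dens_pow hm 2 (by norm_num))
          (u.integrable_dens.const_mul _) fun x => ?_
        simp only [sq]
        exact mul_le_mul_of_nonneg_right (dens_le hm x) (u.dens_nonneg x)
    _ = 2 * u.kap := by rw [integral_const_mul, u.integral_dens, hm, mul_one]

theorem integral_dens_cube_le (hm : mass u = 1) :
    ∫ x, u.dens x ^ 3 ≤ 2 * u.kap * ∫ x, u.dens x ^ 2 := by
  rw [← integral_const_mul]
  refine integral_mono (integrable_dens_pow hm 3 (by norm_num))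
    ((integrable_dens_pow hm 2 (by norm_num)).const_mul _) fun x => ?_
  simp only [pow_succ' _ 2]
  exact mul_le_mul_of_nonneg_right (dens_le hm x) (sq_nonneg _)

theorem gagliardo_nirenberg' (hm : mass u = 1) :
    bCrit / 6 * ∫ x, u.dens x ^ 3 ≤ u.kap ^ 2 := by
  rw [kap_sq]
  refine le_trans (le_of_eq ?_) (gagliardo_nirenberg hm)
  rw [bCrit]; ring

end H1

theorem bCrit_pos : 0 < bCrit := by rw [bCrit]; positivity

/-- Boundedness of rescaled states when the three-body coupling stays strictly subcritical in
rescaled units. -/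
theorem kap_le_of_coercive {t K' A B lam d2 d3 b0 A1 E : ℝ} {v : H1} (hm : mass v = 1)
    (ht : 0 ≤ t) (hK : K' = v.kap ^ 2) (hb0 : 0 < b0) (hB : b0 ≤ B) (hA : |A| ≤ A1) (hE : 0 ≤ E)
    (hlam : B ≤ bCrit * lam)
    (hd2 : 0 ≤ d2) (hd2' : d2 ≤ ∫ x, v.dens x ^ 2) (hd3' : d3 ≤ ∫ x, v.dens x ^ 3)
    (he : t + lam * (K' - bCrit / 6 * d3) + B / 6 * d3 + A / 2 * d2 ≤ E) :
    v.kap ≤ 1 + (A1 + E) / (b0 / bCrit) ∧ t ≤ A1 * v.kap + E := by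
  have hbc := bCrit_pos
  have hk := v.kap_nonneg
  have hGN : 0 ≤ K' - bCrit / 6 * d3 := by
    rw [hK]
    have := H1.gagliardo_nirenberg' hm
    have := mul_le_mul_of_nonneg_left hd3' (by positivity : 0 ≤ bCrit / 6)
    linarith
  have hd2k := hd2'.trans (H1.integral_dens_sq_le hm)
  have hA2 : -(A1 * v.kap) ≤ A / 2 * d2 := by
    have h1 := neg_le_of_abs_le hA
    have hA1 : 0 ≤ A1 := (abs_nonneg _).trans hA
    have h2 : -(A1 / 2 * d2) ≤ A / 2 * d2 := by nlinarith
    nlinarith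
  -- The gap term (B/6) d3 is traded for kinetic energy: a share B / `bCrit` of the nonnegative
  -- Gagliardo–Nirenberg deficit is spent to produce (B / `bCrit`) K'. The rest stays nonnegative by
  -- `hlam`.
  have hsplit : lam * (K' - bCrit / 6 * d3) + B / 6 * d3 =
      (lam - B / bCrit) * (K' - bCrit / 6 * d3) + B / bCrit * K' := by field_simp; ring
  have hlam' : 0 ≤ lam - B / bCrit := by
    rw [sub_nonneg, div_le_iff₀ hbc]; linarith
  have h1 := mul_nonneg hlam' hGN
  have h2 : b0 / bCrit * v.kap ^ 2 ≤ B / bCrit * K' := by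
    rw [hK]; gcongr
  have h3 : 0 ≤ b0 / bCrit * v.kap ^ 2 := by positivity
  refine ⟨le_of_quadratic (by positivity) ((abs_nonneg _).trans hA) hE ?_, ?_⟩ <;> linarith

/-- Boundedness of rescaled states when only the two-body repulsion prevents collapse. -/
theorem kap_le_of_repulsive {t K' A B lam d2 d3 a0 E δ D : ℝ} {v : H1} (hm : mass v = 1)
    (ht : 0 ≤ t) (hK : K' = v.kap ^ 2) (ha0 : 0 < a0) (hB : 0 ≤ B) (hA : a0 ≤ A) (hE : 0 ≤ E)
    (hlam : 0 < lam) (hD : 0 ≤ D) (hED : E ≤ lam * D)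
    (hd2 : 0 ≤ d2) (hd3 : 0 ≤ d3) (hd3' : d3 ≤ ∫ x, v.dens x ^ 3)
    (hδ : bCrit * δ / 3 ≤ 1 / 2)
    (hap : K' ≤ bCrit / 6 * d3 + D → (∫ x, v.dens x ^ 2) - d2 ≤ v.kap * δ)
    (he : t + lam * (K' - bCrit / 6 * d3) + B / 6 * d3 + A / 2 * d2 ≤ E) :
    v.kap ≤ 1 + (bCrit / 3 * (2 * E / a0) + D) / (1 / 2) ∧ t ≤ E := by
  have hbc := bCrit_pos
  have hk := v.kap_nonneg
  have hGN : 0 ≤ K' - bCrit / 6 * d3 := by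
    rw [hK]
    have := H1.gagliardo_nirenberg' hm
    have := mul_le_mul_of_nonneg_left hd3' (by positivity : 0 ≤ bCrit / 6)
    linarith
  have h1 : 0 ≤ lam * (K' - bCrit / 6 * d3) := mul_nonneg hlam.le hGN
  have h2 : 0 ≤ B / 6 * d3 := by positivity
  have h3 : a0 / 2 * d2 ≤ A / 2 * d2 := by gcongr
  have h4 : 0 ≤ a0 / 2 * d2 := by positivity
  -- The energy bounds the deficit itself, which unlocks the conditional comparison `hap` between
  -- the local and nonlocal two-body energies.
  have hX : K' - bCrit / 6 * d3 ≤ D := le_of_mul_le_mul_left (by linarith) hlam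
  have hd2E : d2 ≤ 2 * E / a0 := by rw [le_div_iff₀ ha0]; linarith
  have hp2 := hap (by linarith)
  refine ⟨le_of_quadratic (by norm_num) (by positivity) hD ?_, by linarith⟩
  have hP3 := H1.integral_dens_cube_le hm
  have hP2 : ∫ x, v.dens x ^ 2 ≤ 2 * E / a0 + v.kap * δ := by linarith
  -- Through ∫ρ³ ≤ 2κ ∫ρ² the kinetic energy is bounded by a linear term in κ plus (`bCrit` δ / 3)
  -- κ², and the latter is absorbed because its coefficient is at most 1/2.
  have h5 : v.kap ^ 2 ≤ bCrit / 6 * (2 * v.kap * (2 * E / a0 + v.kap * δ)) + D := by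
    rw [← hK]
    have h6 : d3 ≤ 2 * v.kap * (2 * E / a0 + v.kap * δ) :=
      (hd3'.trans hP3).trans (mul_le_mul_of_nonneg_left hP2 (by positivity))
    have := mul_le_mul_of_nonneg_left h6 (by positivity : 0 ≤ bCrit / 6)
    linarith
  have h7 : bCrit * δ / 3 * v.kap ^ 2 ≤ 1 / 2 * v.kap ^ 2 :=
    mul_le_mul_of_nonneg_right hδ (sq_nonneg _)
  nlinarith

theorem toReal_tendsto_lower {T : ℕ → ℝ≥0∞} {T0 : ℝ≥0∞} (hT : ∀ᶠ n in atTop, T n ≠ ⊤)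
    (h0 : T0 ≠ ⊤) (h : T0 ≤ liminf T atTop) {ε : ℝ} (hε : 0 < ε) :
    ∀ᶠ n in atTop, T0.toReal - ε < (T n).toReal := by
  rcases lt_or_ge (T0.toReal - ε) 0 with hneg | hpos
  · exact Eventually.of_forall fun n => hneg.trans_le ENNReal.toReal_nonneg
  · have h1 : ENNReal.ofReal (T0.toReal - ε) < liminf T atTop := by
      refine lt_of_lt_of_le ?_ h
      rw [ENNReal.ofReal_lt_iff_lt_toReal hpos h0]
      linarith
    filter_upwards [eventually_lt_of_lt_liminf h1, hT] with n hn hn'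
    rwa [ENNReal.ofReal_lt_iff_lt_toReal hpos hn'] at hn

/-- The data of rescaled states in the collapse regime. -/
structure CollapseData (s ζ : ℝ) (v : ℕ → H1) (A B lam d2 d3 c : ℕ → ℝ) (cinf : ℝ) : Prop where
  mass_eq : ∀ᶠ n in atTop, mass (v n) = 1
  trap : ∀ᶠ n in atTop, trapping s (v n) ≠ ⊤
  tendsto_A : Tendsto A atTop (𝓝 (Real.pi * ((6 - ζ) / 6) * Qs s))
  tendsto_B : Tendsto B atTop (𝓝 (ζ * Qs s))
  B_nonneg : ∀ᶠ n in atTop, 0 ≤ B n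
  tendsto_lam : Tendsto lam atTop atTop
  two : ∀ᶠ n in atTop, 0 ≤ d2 n ∧ d2 n ≤ ∫ x, (v n).dens x ^ 2
  three : ∀ᶠ n in atTop, 0 ≤ d3 n ∧ d3 n ≤ ∫ x, (v n).dens x ^ 3
  approx : ∀ C, (∀ᶠ n in atTop, (v n).kap ≤ C) →
    Tendsto (fun n => (∫ x, (v n).dens x ^ 2) - d2 n) atTop (𝓝 0) ∧
    Tendsto (fun n => (∫ x, (v n).dens x ^ 3) - d3 n) atTop (𝓝 0)
  -- For ζ = 0 the three-body gap B vanishes in the limit, so only repulsion can bound κ. Since κ is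
  -- not yet bounded, the two-body error is needed relative to κ.
  apriori : ζ = 0 → ∃ δ : ℕ → ℝ, Tendsto δ atTop (𝓝 0) ∧ ∀ᶠ n in atTop,
    kinetic (v n) ≤ bCrit / 6 * d3 n + 1 → (∫ x, (v n).dens x ^ 2) - d2 n ≤ (v n).kap * δ n
  tendsto_c : Tendsto c atTop (𝓝 cinf)
  energy : ∀ᶠ n in atTop, (trapping s (v n)).toReal + lam n * (kinetic (v n) - bCrit / 6 * d3 n) +
    B n / 6 * d3 n + A n / 2 * d2 n ≤ c n

namespace CollapseData

variable {s ζ : ℝ} {v : ℕ → H1} {A B lam d2 d3 c : ℕ → ℝ} {cinf : ℝ}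

/-- For ζ > 0 the gap B stays away from zero and gives coercivity, whatever the sign of A. For ζ = 0
the limit of A is positive and the repulsive argument takes over. -/
theorem exists_bound (h : CollapseData s ζ v A B lam d2 d3 c cinf) (hs : 0 < s) (hζ : 0 ≤ ζ) :
    ∃ C, ∀ᶠ n in atTop, (v n).kap ≤ C ∧ trapping s (v n) ≤ ENNReal.ofReal C := by
  have hQ := Qs_pos hs
  have hbc := bCrit_pos
  set E := |cinf| + 1
  have hE : 0 ≤ E := by positivity
  have hcE : ∀ᶠ n in atTop, c n ≤ E :=
    h.tendsto_c.eventually (ge_mem_nhds (lt_of_le_of_lt (le_abs_self _) (lt_add_one _)))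
  suffices hsuff : ∃ C D, ∀ᶠ n in atTop, (v n).kap ≤ C ∧ (trapping s (v n)).toReal ≤ D by
    obtain ⟨C, D, hCD⟩ := hsuff
    refine ⟨max C D, ?_⟩
    filter_upwards [hCD, h.trap] with n hn hn'
    refine ⟨hn.1.trans (le_max_left _ _), ?_⟩
    rw [← ENNReal.ofReal_toReal hn']
    exact ENNReal.ofReal_le_ofReal (hn.2.trans (le_max_right _ _))
  rcases hζ.eq_or_lt with h0 | hpos
  · obtain ⟨δ, hδ, hap⟩ := h.apriori h0.symm
    have hA := h.tendsto_A
    rw [← h0] at hA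
    have hA0 : 0 < Real.pi * ((6 - 0) / 6) * Qs s / 2 := by positivity
    have hA1 := hA.eventually (le_mem_nhds (a := Real.pi * ((6 - 0) / 6) * Qs s / 2) (by linarith))
    have hδ1 : ∀ᶠ n in atTop, bCrit * δ n / 3 ≤ 1 / 2 := by
      have : Tendsto (fun n => bCrit * δ n / 3) atTop (𝓝 (bCrit * 0 / 3)) :=
        (hδ.const_mul _).div_const _
      exact this.eventually (ge_mem_nhds (by norm_num))
    refine ⟨1 + (bCrit / 3 * (2 * E / (Real.pi * ((6 - 0) / 6) * Qs s / 2)) + 1) / (1 / 2), E, ?_⟩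
    filter_upwards [h.mass_eq, hcE, h.B_nonneg, h.two, h.three, h.energy, hap, hA1, hδ1,
      h.tendsto_lam.eventually_ge_atTop E, h.tendsto_lam.eventually_ge_atTop 1] with
      n hm hc hB h2 h3 he hap hA1 hδ1 hl1 hl2
    exact kap_le_of_repulsive hm ENNReal.toReal_nonneg (H1.kap_sq _).symm hA0 hB hA1 hE
      (by linarith) zero_le_one (by linarith)
      h2.1 h3.1 h3.2 hδ1 hap (he.trans hc)
  · have hB := h.tendsto_B.eventually (le_mem_nhds (a := ζ * Qs s / 2)
      (by have := mul_pos hpos hQ; linarith))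
    have hB' := h.tendsto_B.eventually (ge_mem_nhds (a := ζ * Qs s + 1) (by linarith))
    have hA := h.tendsto_A.abs.eventually (ge_mem_nhds (lt_add_one _))
    set A1 := |Real.pi * ((6 - ζ) / 6) * Qs s| + 1
    have hA1 : 0 ≤ A1 := by positivity
    refine ⟨1 + (A1 + E) / (ζ * Qs s / 2 / bCrit),
      A1 * (1 + (A1 + E) / (ζ * Qs s / 2 / bCrit)) + E, ?_⟩
    filter_upwards [h.mass_eq, hcE, hB, hB', h.two, h.three, h.energy, hA,
      h.tendsto_lam.eventually_ge_atTop ((ζ * Qs s + 1) / bCrit)] with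
      n hm hc hB hB' h2 h3 he hA hl
    rw [div_le_iff₀ hbc] at hl
    have := kap_le_of_coercive hm ENNReal.toReal_nonneg (H1.kap_sq _).symm (by positivity) hB hA hE
      (by linarith) h2.1 h2.2 h3.2 (he.trans hc)
    exact ⟨this.1, this.2.trans (by gcongr; exact this.1)⟩

/-- A finite energy bound and λ → ∞ leave no Gagliardo–Nirenberg deficit in the limit, so the weak
limit is a dilated and translated Q₀. The reduced energy then gives the lower bound on `cinf` and,
at equality, fixes scale and centre. -/
theorem converges (h : CollapseData s ζ v A B lam d2 d3 c cinf) (hs : 0 < s) (hζ : 0 ≤ ζ)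
    (hc : cinf ≤ Qs s * ((s + 1) / s - ζ / 12)) :
    Qs s * ((s + 1) / s - ζ / 12) ≤ cinf ∧
    ∃ (k : ℕ → ℕ) (φ : H1) (z : ℂ), Tendsto k atTop atTop ∧ ‖z‖ = 1 ∧
      (∀ x, φ.rep x = z * (Q₀ x : ℂ)) ∧
      Tendsto (fun n => ∫ x, ‖v (k n) x - φ x‖ ^ 2) atTop (𝓝 0) ∧
      Tendsto (fun n => ∫ x, ‖(v (k n)).weakDeriv x - φ.weakDeriv x‖ ^ 2) atTop (𝓝 0) := by
  obtain ⟨C, hC⟩ := h.exists_bound hs hζ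
  obtain ⟨n₀, hn₀⟩ := eventually_atTop.mp (hC.and h.mass_eq)
  set w : ℕ → H1 := fun n => v (n + n₀)
  have hw : ∀ n, ((w n).kap ≤ C ∧ trapping s (w n) ≤ ENNReal.ofReal C) ∧ mass (w n) = 1 :=
    fun n => hn₀ _ (by omega)
  obtain ⟨φ, k, hk, hpt, hkin⟩ := H1.exists_weak_limit (fun n => (hw n).2) (fun n => (hw n).1.1)
  obtain ⟨hmφ, l2, l3, lL⟩ := H1.dens_pow_tendsto hs (fun n => (hw (k n)).2)
    (fun n => (hw (k n)).1.1) (fun n => (hw (k n)).1.2) hpt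
  set m : ℕ → ℕ := fun n => k n + n₀
  have hm : Tendsto m atTop atTop := 
    tendsto_atTop_mono (fun n => Nat.le_add_right _ _) hk.tendsto_atTop
  obtain ⟨e2, e3⟩ := h.approx C (hC.mono fun n hn => hn.1)
  have ld2 : Tendsto (fun n => d2 (m n)) atTop (𝓝 (∫ x, φ.dens x ^ 2)) := by
    have := l2.sub (e2.comp hm)
    simpa [w, m] using this
  have ld3 : Tendsto (fun n => d3 (m n)) atTop (𝓝 (∫ x, φ.dens x ^ 3)) := by
    have := l3.sub (e3.comp hm)
    simpa [w, m] using this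
  set y : ℕ → ℝ := fun n => c (m n) - B (m n) / 6 * d3 (m n) - A (m n) / 2 * d2 (m n) with hy
  set yinf := cinf - ζ * Qs s / 6 * (∫ x, φ.dens x ^ 3) -
    Real.pi * ((6 - ζ) / 6) * Qs s / 2 * ∫ x, φ.dens x ^ 2 with hyinf
  have ly : Tendsto y atTop (𝓝 yinf) :=
    ((h.tendsto_c.comp hm).sub (((h.tendsto_B.comp hm).div_const 6).mul ld3)).sub
      (((h.tendsto_A.comp hm).div_const 2).mul ld2)
  have hbc := bCrit_pos
  have hgn : ∀ᶠ n in atTop, bCrit / 6 * (∫ x, (v (m n)).dens x ^ 3) ≤ kinetic (v (m n)) := by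
    refine Eventually.of_forall fun n => ?_
    have := H1.gagliardo_nirenberg' (hw (k n)).2
    rwa [H1.kap_sq] at this
  have hev := hm.eventually (h.energy.and (h.three.and (h.tendsto_lam.eventually_ge_atTop 1)))
  have hTy : ∀ᶠ n in atTop, (trapping s (v (m n))).toReal ≤ y n := by
    filter_upwards [hev, hgn] with n hn hg
    have h1 : 0 ≤ kinetic (v (m n)) - bCrit / 6 * d3 (m n) := by
      have := mul_le_mul_of_nonneg_left hn.2.1.2 (by positivity : 0 ≤ bCrit / 6)
      linarith
    have h2 := mul_nonneg (zero_le_one.trans hn.2.2) h1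
    simp only [hy]
    linarith [hn.1]
  have hKy : ∀ᶠ n in atTop, kinetic (v (m n)) ≤ bCrit / 6 * d3 (m n) + y n / lam (m n) := by
    filter_upwards [hev] with n hn
    have hl : 0 < lam (m n) := zero_lt_one.trans_le hn.2.2
    have h0 : 0 ≤ (trapping s (v (m n))).toReal := ENNReal.toReal_nonneg
    have : kinetic (v (m n)) - bCrit / 6 * d3 (m n) ≤ y n / lam (m n) := by
      rw [le_div_iff₀ hl]
      simp only [hy]
      linarith [hn.1]
    linarith
  -- The kinetic energies are squeezed between Gagliardo–Nirenberg from below and the energy bound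
  -- divided by λ from above. Their convergence later upgrades weak to strong convergence.
  have lK : Tendsto (fun n => kinetic (v (m n))) atTop (𝓝 (bCrit / 6 * ∫ x, φ.dens x ^ 3)) := by
    have hu := (ld3.const_mul (bCrit / 6)).add (ly.div_atTop (h.tendsto_lam.comp hm))
    rw [add_zero] at hu
    exact tendsto_of_tendsto_of_tendsto_of_le_of_le' (l3.const_mul (bCrit / 6)) hu hgn hKy
  have hKφ : kinetic φ ≤ bCrit / 6 * ∫ x, φ.dens x ^ 3 := by
    refine le_of_tendsto_of_tendsto hkin lK (Eventually.of_forall fun n => ?_)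
    have : 0 ≤ ∫ x, ‖(w (k n)).weakDeriv x - φ.weakDeriv x‖ ^ 2 :=
      integral_nonneg fun x => sq_nonneg _
    change kinetic (w (k n)) - _ ≤ kinetic (w (k n))
    linarith
  have hKe : kinetic φ = bCrit / 6 * ∫ x, φ.dens x ^ 3 := by
    refine le_antisymm hKφ ?_
    have := H1.gagliardo_nirenberg' hmφ
    rwa [H1.kap_sq] at this
  obtain ⟨l, x₀, z, hl, hz, hrep⟩ := H1.exists_eq_of_optimizer hmφ (by
    rw [hKe]; refine le_of_eq ?_; rw [bCrit]; ring)
  have hdens : ∀ x, φ.dens x = l * Q₀ (l * (x - x₀)) ^ 2 := fun x => by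
    rw [H1.dens, hrep, norm_mul, hz, one_mul, Complex.norm_real, Real.norm_eq_abs, sq_abs, mul_pow,
      Real.sq_sqrt hl.le]
  have hred := reduced_energy hs hζ (y := l * x₀) hl
  have hTφ := trapping_of_bubble hs hl hdens
  have hmom : 0 < moment s (l * x₀) := by
    rcases eq_or_ne (l * x₀) 0 with h0 | h0
    · rw [h0]; exact moment_zero_pos hs
    · exact (moment_zero_pos hs).trans (moment_lt hs h0)
  have hTle : l ^ (-s) * moment s (l * x₀) ≤ yinf := by
    have h1 : trapping s φ ≤ ENNReal.ofReal yinf := by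
      refine (H1.trapping_le_liminf hpt).trans ?_
      have h2 := ((ENNReal.continuous_ofReal.tendsto _).comp ly).liminf_eq
      rw [← h2]
      refine liminf_le_liminf ?_
      filter_upwards [hTy, hm.eventually h.trap] with n hn hn'
      change trapping s (v (m n)) ≤ ENNReal.ofReal (y n)
      rw [← ENNReal.ofReal_toReal hn']
      exact ENNReal.ofReal_le_ofReal hn
    rw [hTφ] at h1
    rcases ENNReal.ofReal_le_ofReal_iff'.mp h1 with h2 | h2
    · exact h2
    · exact absurd h2 (not_le.mpr (mul_pos (Real.rpow_pos_of_pos hl _) hmom))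
  rw [hyinf, integral_dens_cube_of_bubble hl hdens, integral_dens_sq_of_bubble hl hdens] at hTle
  obtain ⟨hl1, hx0⟩ := hred.2 (by linarith)
  refine ⟨by linarith [hred.1], m, φ, z, hm, hz, fun x => ?_, ?_⟩
  · have hx : x₀ = 0 := by rw [hl1] at hx0; linarith
    rw [hrep, hl1, hx]
    simp
  · rw [← hKe] at lK
    exact H1.tendstoInH1_of_kinetic lL hkin lK

end CollapseData

end HartreeNLS

/-! ### An abstract collapse theorem for Hartree and NLS. -/

namespace HartreeNLS

theorem coe_add_coe_le_iff {T : ℝ≥0∞} {r c : ℝ} :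
    (T : EReal) + (r : EReal) ≤ (c : EReal) ↔ T ≠ ⊤ ∧ T.toReal + r ≤ c := by
  rcases eq_or_ne T ⊤ with rfl | hT
  · simp
  · lift T to NNReal using hT
    have : ((T : ℝ≥0∞) : EReal) = ((T : ℝ) : EReal) := rfl
    rw [this, ← EReal.coe_add, EReal.coe_le_coe_iff]
    simp

/-- The energy functional with general two- and three-body interaction energies `D2`, `D3`. -/
noncomputable def genEnergy (s a b : ℝ) (D2 D3 : H1 → ℝ) (u : H1) : EReal :=
  (trapping s u : EReal) + ((kinetic u + a / 2 * D2 u - b / 6 * D3 u : ℝ) : EReal)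

theorem nls_eq_genEnergy (s a b : ℝ) :
    nls s a b = genEnergy s a b (fun u => ∫ x, u.dens x ^ 2) (fun u => ∫ x, u.dens x ^ 3) := by
  funext u
  rw [nls, genEnergy, u.integral_norm_pow_four, u.integral_norm_pow_six]

theorem genEnergy_le_iff {s a b c : ℝ} {D2 D3 : H1 → ℝ} {u : H1} :
    genEnergy s a b D2 D3 u ≤ (c : EReal) ↔ trapping s u ≠ ⊤ ∧
      (trapping s u).toReal + (kinetic u + a / 2 * D2 u - b / 6 * D3 u) ≤ c :=
  coe_add_coe_le_iff

theorem groundEnergy_le {F : H1 → EReal} {u : H1} (hm : mass u = 1) : groundEnergy F ≤ F u :=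
  iInf₂_le u hm

/-- The collapse regime, in terms of the rescaled couplings. -/
structure RescaledRegime (s ζ : ℝ) (a b ℓ : ℕ → ℝ) : Prop where
  pos : ∀ᶠ N in atTop, 0 < ℓ N
  tendsto_ℓ : Tendsto ℓ atTop (𝓝 0)
  b_le : ∀ᶠ N in atTop, b N ≤ bCrit
  tendsto_A : Tendsto (fun N => a N / ℓ N ^ (s + 1)) atTop (𝓝 (Real.pi * ((6 - ζ) / 6) * Qs s))
  tendsto_B : Tendsto (fun N => (bCrit - b N) / ℓ N ^ (s + 2)) atTop (𝓝 (ζ * Qs s))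

/-- Interaction energies that approximate the local ones on the length scale `ℓ`. -/
structure LocalApprox (s ζ : ℝ) (ℓ : ℕ → ℝ) (D2 D3 : ℕ → H1 → ℝ) : Prop where
  bounds : ∀ᶠ N in atTop, ∀ u, mass u = 1 → (0 ≤ D2 N u ∧ D2 N u ≤ ∫ x, u.dens x ^ 2) ∧
    (0 ≤ D3 N u ∧ D3 N u ≤ ∫ x, u.dens x ^ 3)
  -- The extra factor ℓ^(s+2) in the three-body error compensates the prefactor ℓ^(-(s+2)) of the
  -- Gagliardo–Nirenberg deficit in the rescaled energy.
  error : ∃ r : ℕ → ℝ, Tendsto r atTop (𝓝 0) ∧ ∀ᶠ N in atTop, ∀ u, mass u = 1 →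
    ℓ N * ((∫ x, u.dens x ^ 2) - D2 N u) ≤ (ℓ N * u.kap) ^ 2 * r N ∧
    ℓ N ^ 2 * ((∫ x, u.dens x ^ 3) - D3 N u) ≤ (ℓ N * u.kap) ^ 3 * (ℓ N ^ (s + 2) * r N)
  apriori : ζ = 0 → ∃ δ : ℕ → ℝ, Tendsto δ atTop (𝓝 0) ∧ ∀ᶠ N in atTop, ∀ u, mass u = 1 →
    ℓ N ^ 2 * kinetic u ≤ bCrit / 6 * (ℓ N ^ 2 * D3 N u) + 1 →
      (∫ x, u.dens x ^ 2) - D2 N u ≤ u.kap * δ N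

/-- Adding and subtracting the critical three-body term isolates the deficit, which scales like
ℓ^(-2), whereas the trap scales like ℓ^s. -/
theorem rescaled_energy_identity {s ℓ a b K d2 d3 T : ℝ} (hℓ : 0 < ℓ) :
    ℓ ^ (-s) * T + ℓ ^ (-(s + 2)) * (ℓ ^ 2 * K - bCrit / 6 * (ℓ ^ 2 * d3)) +
      (bCrit - b) / ℓ ^ (s + 2) / 6 * (ℓ ^ 2 * d3) + a / ℓ ^ (s + 1) / 2 * (ℓ * d2) =
    (T + (K + a / 2 * d2 - b / 6 * d3)) / ℓ ^ s := by
  have hp := Real.rpow_pos_of_pos hℓ s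
  rw [Real.rpow_neg hℓ.le, Real.rpow_neg hℓ.le, Real.rpow_add hℓ, Real.rpow_add hℓ, Real.rpow_one,
    Real.rpow_ofNat]
  field_simp
  ring

variable {s ζ : ℝ} {a b ℓ : ℕ → ℝ} {D2 D3 : ℕ → H1 → ℝ}

theorem RescaledRegime.tendsto_rpow (h : RescaledRegime s ζ a b ℓ) {p : ℝ} (hp : 0 < p) :
    Tendsto (fun N => ℓ N ^ p) atTop (𝓝 0) := by
  have := h.tendsto_ℓ.rpow_const (p := p) (Or.inr hp.le)
  rwa [Real.zero_rpow hp.ne'] at this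

theorem collapseData_scl (hs : 0 < s) (h : RescaledRegime s ζ a b ℓ)
    (happ : LocalApprox s ζ ℓ D2 D3) {ns : ℕ → ℕ} (hns : Tendsto ns atTop atTop) {u : ℕ → H1}
    {c : ℕ → ℝ} {cinf : ℝ} (hc : Tendsto c atTop (𝓝 cinf))
    (hu : ∀ᶠ n in atTop, mass (u n) = 1 ∧
      genEnergy s (a (ns n)) (b (ns n)) (D2 (ns n)) (D3 (ns n)) (u n) ≤
        ((c n * ℓ (ns n) ^ s : ℝ) : EReal)) :
    CollapseData s ζ (fun n => (u n).scl (ℓ (ns n))) (fun n => a (ns n) / ℓ (ns n) ^ (s + 1))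
      (fun n => (bCrit - b (ns n)) / ℓ (ns n) ^ (s + 2)) (fun n => ℓ (ns n) ^ (-(s + 2)))
      (fun n => ℓ (ns n) * D2 (ns n) (u n)) (fun n => ℓ (ns n) ^ 2 * D3 (ns n) (u n)) c cinf := by
  have hpos := hns.eventually h.pos
  have hb := hns.eventually happ.bounds
  have e2 : ∀ {l : ℝ}, 0 < l → ∀ v : H1, ∫ x, (v.scl l).dens x ^ 2 = l * ∫ x, v.dens x ^ 2 :=
    fun hl v => by simpa using v.integral_dens_pow_scl hl 1
  have e3 : ∀ {l : ℝ}, 0 < l → ∀ v : H1, ∫ x, (v.scl l).dens x ^ 3 = l ^ 2 * ∫ x, v.dens x ^ 3 :=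
    fun hl v => v.integral_dens_pow_scl hl 2
  have hm : ∀ᶠ n in atTop, mass ((u n).scl (ℓ (ns n))) = 1 := by
    filter_upwards [hpos, hu] with n hn h1
    rw [H1.mass_scl hn, h1.1]
  refine ⟨hm, ?_, h.tendsto_A.comp hns, h.tendsto_B.comp hns, ?_, ?_, ?_, ?_, ?_, ?_, hc, ?_⟩
  · filter_upwards [hpos, hu] with n hn h1
    exact H1.trapping_scl_ne_top hn _ (genEnergy_le_iff.mp h1.2).1
  · filter_upwards [hpos, hns.eventually h.b_le] with n hn h1
    have := sub_nonneg.mpr h1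
    positivity
  · have h1 : Tendsto (fun n => ℓ (ns n) ^ (s + 2)) atTop (𝓝[>] 0) := by
      refine tendsto_nhdsWithin_iff.mpr ⟨(h.tendsto_rpow (by linarith)).comp hns, ?_⟩
      filter_upwards [hpos] with n hn
      exact Real.rpow_pos_of_pos hn _
    refine h1.inv_tendsto_nhdsGT_zero.congr' ?_
    filter_upwards [hpos] with n hn
    rw [Real.rpow_neg hn.le]; rfl
  · filter_upwards [hpos, hb, hu] with n hn h1 h2
    have := (h1 _ h2.1).1
    rw [e2 hn]
    exact ⟨mul_nonneg hn.le this.1, mul_le_mul_of_nonneg_left this.2 hn.le⟩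
  · filter_upwards [hpos, hb, hu] with n hn h1 h2
    have := (h1 _ h2.1).2
    rw [e3 hn]
    exact ⟨mul_nonneg (by positivity) this.1, mul_le_mul_of_nonneg_left this.2 (by positivity)⟩
  · intro C hC
    obtain ⟨r, hr, her⟩ := happ.error
    have hr' := hr.comp hns
    have hkC : ∀ᶠ n in atTop, 0 ≤ ℓ (ns n) * (u n).kap ∧ ℓ (ns n) * (u n).kap ≤ C := by
      filter_upwards [hC, hpos] with n h1 hn
      rw [H1.kap_scl hn] at h1
      exact ⟨mul_nonneg hn.le (u n).kap_nonneg, h1⟩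
    have hl2 := (h.tendsto_rpow (p := s + 2) (by linarith)).comp hns
    constructor
    · have hz : Tendsto (fun n => C ^ 2 * |r (ns n)|) atTop (𝓝 0) := by
        simpa using hr'.abs.const_mul (C ^ 2)
      refine squeeze_zero' ?_ ?_ hz
      · filter_upwards [hpos, hb, hu] with n hn h1 h2
        have := (h1 _ h2.1).1
        rw [e2 hn, ← mul_sub]
        exact mul_nonneg hn.le (by linarith)
      · filter_upwards [hpos, hns.eventually her, hu, hkC] with n hn h1 h2 h3
        rw [e2 hn, ← mul_sub]
        refine (h1 _ h2.1).1.trans ?_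
        exact (mul_le_mul_of_nonneg_left (le_abs_self _) (by positivity)).trans
          (mul_le_mul_of_nonneg_right (pow_le_pow_left₀ h3.1 h3.2 2) (abs_nonneg _))
    · have hz : Tendsto (fun n => C ^ 3 * |ℓ (ns n) ^ (s + 2) * r (ns n)|) atTop (𝓝 0) := by
        simpa using (hl2.mul hr').abs.const_mul (C ^ 3)
      refine squeeze_zero' ?_ ?_ hz
      · filter_upwards [hpos, hb, hu] with n hn h1 h2
        have := (h1 _ h2.1).2
        rw [e3 hn, ← mul_sub]
        exact mul_nonneg (by positivity) (by linarith)
      · filter_upwards [hpos, hns.eventually her, hu, hkC] with n hn h1 h2 h3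
        rw [e3 hn, ← mul_sub]
        refine (h1 _ h2.1).2.trans ?_
        exact (mul_le_mul_of_nonneg_left (le_abs_self _) (pow_nonneg h3.1 3)).trans
          (mul_le_mul_of_nonneg_right (pow_le_pow_left₀ h3.1 h3.2 3) (abs_nonneg _))
  · intro h0
    obtain ⟨δ, hδ, hap⟩ := happ.apriori h0
    refine ⟨fun n => δ (ns n), hδ.comp hns, ?_⟩
    filter_upwards [hpos, hns.eventually hap, hu] with n hn h1 h2 h3
    rw [H1.kinetic_scl hn] at h3
    rw [e2 hn, ← mul_sub, H1.kap_scl hn, mul_assoc]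
    exact mul_le_mul_of_nonneg_left (h1 _ h2.1 h3) hn.le
  · filter_upwards [hpos, hu] with n hn h1
    have h2 := (genEnergy_le_iff.mp h1.2).2
    rw [H1.trapping_scl_toReal hn, H1.kinetic_scl hn, rescaled_energy_identity hn,
      div_le_iff₀ (Real.rpow_pos_of_pos hn s)]
    exact h2

/-- The energy bound c and the index sequence are left free. A constant c yields the lower bound on
ground energies, while c equal to the upper bound plus the error yields convergence of approximate
ground states. -/
theorem collapse_converges (hs : 0 < s) (hζ : 0 ≤ ζ) (h : RescaledRegime s ζ a b ℓ)
    (happ : LocalApprox s ζ ℓ D2 D3) {ns : ℕ → ℕ} (hns : Tendsto ns atTop atTop) {u : ℕ → H1}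
    {c : ℕ → ℝ} {cinf : ℝ} (hc : Tendsto c atTop (𝓝 cinf))
    (hcinf : cinf ≤ Qs s * ((s + 1) / s - ζ / 12))
    (hu : ∀ᶠ n in atTop, mass (u n) = 1 ∧
      genEnergy s (a (ns n)) (b (ns n)) (D2 (ns n)) (D3 (ns n)) (u n) ≤
        ((c n * ℓ (ns n) ^ s : ℝ) : EReal)) :
    Qs s * ((s + 1) / s - ζ / 12) ≤ cinf ∧
    ∃ (k : ℕ → ℕ) (φ : H1) (z : ℂ), Tendsto k atTop atTop ∧ ‖z‖ = 1 ∧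
      (∀ x, φ.rep x = z * (Q₀ x : ℂ)) ∧
      Tendsto (fun n => ∫ x, ‖(u (k n)).scl (ℓ (ns (k n))) x - φ x‖ ^ 2) atTop (𝓝 0) ∧
      Tendsto (fun n => ∫ x, ‖((u (k n)).scl (ℓ (ns (k n)))).weakDeriv x - φ.weakDeriv x‖ ^ 2)
        atTop (𝓝 0) :=
  (collapseData_scl hs h happ hns hc hu).converges hs hζ hcinf

/-- The trial state is Q₀ contracted to length ℓ. It has no local Gagliardo–Nirenberg deficit, so at
the diverging order only the three-body approximation error remains. -/
theorem collapse_upper_bound (hs : 0 < s) (h : RescaledRegime s ζ a b ℓ)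
    (happ : LocalApprox s ζ ℓ D2 D3) :
    ∃ e : ℕ → ℝ, Tendsto e atTop (𝓝 (Qs s * ((s + 1) / s - ζ / 12))) ∧ ∀ᶠ N in atTop,
      groundEnergy (genEnergy s (a N) (b N) (D2 N) (D3 N)) ≤ ((e N * ℓ N ^ s : ℝ) : EReal) := by
  have hbc := bCrit_pos
  set w : ℕ → H1 := fun N => soliton.scl (ℓ N)⁻¹
  have hw : ∀ᶠ N in atTop, 0 < ℓ N ∧ mass (w N) = 1 ∧ ℓ N * (w N).kap = soliton.kap ∧
      ℓ N ^ 2 * kinetic (w N) = Real.pi ^ 2 / 8 ∧ ℓ N * ∫ x, (w N).dens x ^ 2 = 2 / Real.pi ∧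
      ℓ N ^ 2 * ∫ x, (w N).dens x ^ 3 = 1 / 2 := by
    filter_upwards [h.pos] with N hN
    have hi := inv_pos.mpr hN
    have e2 := soliton.integral_dens_pow_scl hi 1
    have e3 := soliton.integral_dens_pow_scl hi 2
    simp_rw [soliton_dens] at e2 e3
    norm_num only [integral_Q₀_four, integral_Q₀_six] at e2 e3
    refine ⟨hN, (H1.mass_scl hi _).trans mass_soliton, ?_, ?_, ?_, ?_⟩
    · rw [H1.kap_scl hi]; field_simp
    · rw [H1.kinetic_scl hi, kinetic_soliton]; field_simp
    · rw [e2]; field_simp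
    · rw [e3]; field_simp
  have htrap : ∀ᶠ N in atTop, trapping s (w N) ≠ ⊤ ∧
      ℓ N ^ (-s) * (trapping s (w N)).toReal = moment s 0 := by
    have hd : ∀ x, soliton.dens x = (1 : ℝ) * Q₀ (1 * (x - 0)) ^ 2 := fun x => by
      rw [soliton_dens]; simp
    have ht := trapping_of_bubble hs one_pos hd
    rw [Real.one_rpow, one_mul, mul_zero] at ht
    filter_upwards [h.pos] with N hN
    refine ⟨H1.trapping_scl_ne_top (inv_pos.mpr hN) _ (by rw [ht]; exact ENNReal.ofReal_ne_top), ?_⟩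
    rw [H1.trapping_scl_toReal (inv_pos.mpr hN), ht, ENNReal.toReal_ofReal (moment_zero_pos hs).le,
      Real.inv_rpow hN.le, Real.rpow_neg hN.le, inv_inv]
    have := (Real.rpow_pos_of_pos hN s).ne'
    field_simp
  obtain ⟨r, hr, her⟩ := happ.error
  set κ := soliton.kap
  have hp : ∀ᶠ N in atTop, 0 < ℓ N ^ (s + 2) := h.pos.mono fun N hN => Real.rpow_pos_of_pos hN _
  have hbd : ∀ᶠ N in atTop, (0 ≤ 2 / Real.pi - ℓ N * D2 N (w N) ∧
      2 / Real.pi - ℓ N * D2 N (w N) ≤ κ ^ 2 * r N) ∧ (0 ≤ 1 / 2 - ℓ N ^ 2 * D3 N (w N) ∧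
      1 / 2 - ℓ N ^ 2 * D3 N (w N) ≤ κ ^ 3 * (ℓ N ^ (s + 2) * r N)) := by
    filter_upwards [hw, her, happ.bounds] with N ⟨h1, h2, h3, h4, h5, h6⟩ h7 h8
    have h7 := h7 _ h2
    have h8 := h8 _ h2
    rw [h3, mul_sub, mul_sub, h5, h6] at h7
    refine ⟨⟨?_, h7.1⟩, ⟨?_, h7.2⟩⟩
    · rw [← h5, ← mul_sub]; exact mul_nonneg h1.le (by linarith [h8.1.2])
    · rw [← h6, ← mul_sub]; exact mul_nonneg (by positivity) (by linarith [h8.2.2])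
  have l2 : Tendsto (fun N => ℓ N * D2 N (w N)) atTop (𝓝 (2 / Real.pi)) := by
    have : Tendsto (fun N => 2 / Real.pi - ℓ N * D2 N (w N)) atTop (𝓝 0) :=
      squeeze_zero' (hbd.mono fun N hN => hN.1.1) (hbd.mono fun N hN => hN.1.2)
        (by simpa using hr.const_mul (κ ^ 2))
    simpa using this.const_sub (2 / Real.pi)
  have l3 : Tendsto (fun N => ℓ N ^ 2 * D3 N (w N)) atTop (𝓝 (1 / 2)) := by
    have : Tendsto (fun N => 1 / 2 - ℓ N ^ 2 * D3 N (w N)) atTop (𝓝 0) :=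
      squeeze_zero' (hbd.mono fun N hN => hN.2.1) (hbd.mono fun N hN => hN.2.2)
        (by simpa using ((h.tendsto_rpow (p := s + 2) (by linarith)).mul hr).const_mul (κ ^ 3))
    have h3 := this.const_sub (1 / 2)
    rw [sub_zero] at h3
    exact h3.congr fun N => by ring
  -- Here the error of size o(ℓ^(s+2)) is used at full strength: it must vanish even after division
  -- by ℓ^(s+2).
  have l4 : Tendsto (fun N => ℓ N ^ (-(s + 2)) * (1 / 2 - ℓ N ^ 2 * D3 N (w N))) atTop (𝓝 0) := by
    refine squeeze_zero' ?_ ?_ (g := fun N => κ ^ 3 * r N) (by simpa using hr.const_mul (κ ^ 3))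
    · filter_upwards [hbd, h.pos] with N h1 h2
      exact mul_nonneg (Real.rpow_nonneg h2.le _) h1.2.1
    · filter_upwards [hbd, h.pos, hp] with N h1 h2 h3
      rw [Real.rpow_neg h2.le, inv_mul_le_iff₀ h3]
      linarith [h1.2.2]
  refine ⟨fun N => moment s 0 + bCrit / 6 * (ℓ N ^ (-(s + 2)) * (1 / 2 - ℓ N ^ 2 * D3 N (w N))) +
    (bCrit - b N) / ℓ N ^ (s + 2) / 6 * (ℓ N ^ 2 * D3 N (w N)) +
    a N / ℓ N ^ (s + 1) / 2 * (ℓ N * D2 N (w N)), ?_, ?_⟩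
  · have := (((l4.const_mul (bCrit / 6)).const_add (moment s 0)).add
      ((h.tendsto_B.div_const 6).mul l3)).add ((h.tendsto_A.div_const 2).mul l2)
    convert this using 2
    rw [Qs_eq]
    field_simp
    ring
  · filter_upwards [hw, htrap] with N ⟨h1, h2, h3, h4, h5, h6⟩ ht
    refine (groundEnergy_le h2).trans (genEnergy_le_iff.mpr ⟨ht.1, ?_⟩)
    rw [← div_le_iff₀ (Real.rpow_pos_of_pos h1 s), ← rescaled_energy_identity h1, ht.2, h4]
    refine le_of_eq ?_
    rw [bCrit]
    ring

/-- If it failed along a subsequence, states below the threshold would satisfy `collapse_converges`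
with a constant strictly smaller than the minimal reduced energy. -/
theorem collapse_lower_bound (hs : 0 < s) (hζ : 0 ≤ ζ) (h : RescaledRegime s ζ a b ℓ)
    (happ : LocalApprox s ζ ℓ D2 D3) {ε : ℝ} (hε : 0 < ε) : ∀ᶠ N in atTop,
      (((Qs s * ((s + 1) / s - ζ / 12) - ε) * ℓ N ^ s : ℝ) : EReal) ≤
        groundEnergy (genEnergy s (a N) (b N) (D2 N) (D3 N)) := by
  by_contra hcon
  rw [not_eventually] at hcon
  obtain ⟨ns, hns, hP⟩ := extraction_of_frequently_atTop hcon
  have hex : ∀ n, ∃ u, mass u = 1 ∧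
      genEnergy s (a (ns n)) (b (ns n)) (D2 (ns n)) (D3 (ns n)) u ≤
        (((Qs s * ((s + 1) / s - ζ / 12) - ε) * ℓ (ns n) ^ s : ℝ) : EReal) := fun n => by
    have := hP n
    rw [groundEnergy, le_iInf₂_iff] at this
    push Not at this
    obtain ⟨u, hm, hu⟩ := this
    exact ⟨u, hm, hu.le⟩
  choose u hu using hex
  have := (collapse_converges hs hζ h happ hns.tendsto_atTop tendsto_const_nhds
    (by linarith) (Eventually.of_forall hu)).1
  linarith

theorem collapse_groundEnergy (hs : 0 < s) (hζ : 0 ≤ ζ) (h : RescaledRegime s ζ a b ℓ)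
    (happ : LocalApprox s ζ ℓ D2 D3) :
    ∃ ε : ℕ → ℝ, Tendsto ε atTop (𝓝 0) ∧ ∀ᶠ N in atTop,
      groundEnergy (genEnergy s (a N) (b N) (D2 N) (D3 N)) =
        ((((s + 1) / s - ζ / 12 + ε N) * Qs s * ℓ N ^ s : ℝ) : EReal) := by
  have hQ := Qs_pos hs
  set G : ℕ → EReal := fun N => groundEnergy (genEnergy s (a N) (b N) (D2 N) (D3 N)) with hG
  set C := (s + 1) / s - ζ / 12 with hC
  obtain ⟨e, he, hue⟩ := collapse_upper_bound hs h happ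
  have hfin : ∀ᶠ N in atTop, ((G N).toReal : EReal) = G N := by
    filter_upwards [hue, collapse_lower_bound hs hζ h happ one_pos] with N h1 h2
    refine EReal.coe_toReal ?_ ?_
    · exact (h1.trans_lt (EReal.coe_lt_top _)).ne
    · exact ((EReal.bot_lt_coe _).trans_le h2).ne'
  have hlim : Tendsto (fun N => (G N).toReal / ℓ N ^ s) atTop (𝓝 (Qs s * C)) := by
    refine tendsto_order.mpr ⟨fun y hy => ?_, fun y hy => ?_⟩
    · filter_upwards [hfin, h.pos, collapse_lower_bound hs hζ h happ
        (ε := (Qs s * C - y) / 2) (by linarith)] with N h1 h2 h3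
      change _ ≤ G N at h3
      rw [← hC, ← h1, EReal.coe_le_coe_iff] at h3
      have hp := Real.rpow_pos_of_pos h2 s
      rw [lt_div_iff₀ hp]
      refine lt_of_lt_of_le ?_ h3
      exact mul_lt_mul_of_pos_right (by linarith) hp
    · filter_upwards [hfin, h.pos, hue, he.eventually (gt_mem_nhds hy)] with N h1 h2 h3 h4
      change G N ≤ _ at h3
      rw [← h1, EReal.coe_le_coe_iff] at h3
      have hp := Real.rpow_pos_of_pos h2 s
      rw [div_lt_iff₀ hp]
      exact h3.trans_lt (mul_lt_mul_of_pos_right h4 hp)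
  refine ⟨fun N => (G N).toReal / ℓ N ^ s / Qs s - C, ?_, ?_⟩
  · have := (hlim.div_const (Qs s)).sub_const C
    rwa [mul_div_cancel_left₀ _ hQ.ne', sub_self] at this
  · filter_upwards [hfin, h.pos] with N h1 h2
    have hp := (Real.rpow_pos_of_pos h2 s).ne'
    change G N = _
    refine h1.symm.trans (congrArg _ ?_)
    field_simp
    ring

end HartreeNLS

/-! ### Choice of phases and convergence of the whole sequence. -/

namespace HartreeNLS

/-- Multiplication of an `H¹` function by a constant. -/
noncomputable def H1.cmul (c : ℂ) (u : H1) : H1 where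
  toFun x := c * u x
  weakDeriv x := c * u.weakDeriv x
  memLp_toFun := u.memLp_toFun.const_mul c
  memLp_weakDeriv := u.memLp_weakDeriv.const_mul c
  hasWeakDeriv := fun φ hφ hs => by
    simp_rw [← mul_smul_comm]
    rw [integral_const_mul, integral_const_mul, u.hasWeakDeriv φ hφ hs, mul_neg]

/-- Multiplication by the conjugate phase is an isometry, so closeness to z q becomes closeness of
the rotated function to q. -/
theorem integral_norm_sub_mul_sq {f g q : ℝ → ℂ} {z : ℂ} (hz : ‖z‖ = 1)
    (hg : ∀ᵐ x, g x = z * q x) :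
    ∫ x, ‖Complex.exp ((-z.arg : ℝ) * Complex.I) * f x - q x‖ ^ 2 = ∫ x, ‖f x - g x‖ ^ 2 := by
  refine integral_congr_ae ?_
  filter_upwards [hg] with x hx
  have h1 : z = Complex.exp (z.arg * Complex.I) := by
    conv_lhs => rw [← Complex.norm_mul_exp_arg_mul_I z, hz]
    simp
  have h2 : Complex.exp ((-z.arg : ℝ) * Complex.I) * z = 1 := by
    calc Complex.exp ((-z.arg : ℝ) * Complex.I) * z
        = Complex.exp ((-z.arg : ℝ) * Complex.I) * Complex.exp (z.arg * Complex.I) := by rw [← h1]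
      _ = 1 := by
        rw [← Complex.exp_add]
        push_cast
        rw [neg_mul, neg_add_cancel, Complex.exp_zero]
  have h3 : Complex.exp ((-z.arg : ℝ) * Complex.I) * f x - q x =
      Complex.exp ((-z.arg : ℝ) * Complex.I) * (f x - g x) := by
    rw [hx, mul_sub, ← mul_assoc, h2, one_mul]
  rw [h3, norm_mul, Complex.norm_exp_ofReal_mul_I, one_mul]

/-- Squared `H¹` distance of `e^{iθ} v` to the soliton. -/
noncomputable def solitonDist (v : H1) (θ : ℝ) : ℝ :=
  (∫ x, ‖Complex.exp (θ * Complex.I) * v x - soliton x‖ ^ 2) +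
    ∫ x, ‖Complex.exp (θ * Complex.I) * v.weakDeriv x - soliton.weakDeriv x‖ ^ 2

theorem solitonDist_nonneg (v : H1) (θ : ℝ) : 0 ≤ solitonDist v θ :=
  add_nonneg (integral_nonneg fun _ => sq_nonneg _) (integral_nonneg fun _ => sq_nonneg _)

theorem solitonDist_eq {v φ : H1} {z : ℂ} (hz : ‖z‖ = 1) (hφ : ∀ x, φ.rep x = z * (Q₀ x : ℂ)) :
    solitonDist v (-z.arg) =
      (∫ x, ‖v x - φ x‖ ^ 2) + ∫ x, ‖v.weakDeriv x - φ.weakDeriv x‖ ^ 2 := by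
  rw [solitonDist, integral_norm_sub_mul_sq hz, integral_norm_sub_mul_sq hz]
  · exact weakDeriv_ae_of_rep_eq (ψ := soliton) fun x => by rw [hφ, soliton_rep]
  · filter_upwards [φ.ae_rep] with x hx
    rw [hx, hφ]; rfl

theorem tendstoInH1_soliton {ℓ : ℕ → ℝ} {u : ℕ → H1} {θ : ℕ → ℝ} (hℓ : ∀ᶠ N in atTop, 0 < ℓ N)
    (h : Tendsto (fun N => solitonDist ((u N).scl (ℓ N)) (θ N)) atTop (𝓝 0)) :
    TendstoInH1 (fun N x => Complex.exp (θ N * Complex.I) * rescale (ℓ N) (u N) x)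
      (fun x => (Q₀ x : ℂ)) := by
  set w : ℕ → H1 := fun N => ((u N).scl (ℓ N)).cmul (Complex.exp (θ N * Complex.I)) with hw
  have h0 : Tendsto (fun N => ∫ x, ‖w N x - soliton x‖ ^ 2) atTop (𝓝 0) :=
    squeeze_zero (fun N => integral_nonneg fun _ => sq_nonneg _)
      (fun N => le_add_of_nonneg_right (integral_nonneg fun _ => sq_nonneg _)) h
  have h1 : Tendsto (fun N => ∫ x, ‖(w N).weakDeriv x - soliton.weakDeriv x‖ ^ 2) atTop (𝓝 0) :=
    squeeze_zero (fun N => integral_nonneg fun _ => sq_nonneg _)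
      (fun N => le_add_of_nonneg_left (integral_nonneg fun _ => sq_nonneg _)) h
  obtain ⟨v', w', e1, e2, e3, e4⟩ := H1.tendstoInH1 h0 h1
  have he : ∀ᶠ N in atTop, (w N).toFun =
      fun x => Complex.exp (θ N * Complex.I) * rescale (ℓ N) (u N) x := by
    filter_upwards [hℓ] with N hN
    rw [← H1.scl_toFun hN]; rfl
  refine ⟨v', w', ?_, e2, ?_, e4⟩
  · filter_upwards [e1, he] with N h1 h2
    rwa [h2] at h1
  · refine e3.congr' ?_
    filter_upwards [he] with N hN
    rw [hN]; rfl

/-- If a nonnegative function is `L²` close to `z Q₀`, then `z` is close to `1`. -/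
theorem norm_sub_one_sq_le {v φ : H1} {z : ℂ} (hz : ‖z‖ = 1) (hφ : ∀ x, φ.rep x = z * (Q₀ x : ℂ))
    (hv : ∀ᵐ x, v x = (‖v x‖ : ℂ)) : ‖z - 1‖ ^ 2 ≤ 4 * ∫ x, ‖v x - φ x‖ ^ 2 := by
  have hL : ∫ x, ‖z - 1‖ ^ 2 * Q₀ x ^ 2 = ‖z - 1‖ ^ 2 := by
    rw [integral_const_mul, integral_Q₀_sq, mul_one]
  rw [← hL, ← integral_const_mul]
  refine integral_mono_ae (integrable_Q₀_sq.const_mul _)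
    ((integrable_sq_of_memLp (v.memLp_toFun.sub φ.memLp_toFun)).const_mul 4) ?_
  filter_upwards [hv, φ.ae_rep] with x h1 h2
  have hQ := (Q₀_pos x).le
  rw [hφ] at h2
  -- Taking moduli is 1-Lipschitz, v equals its modulus, and z Q₀ has modulus Q₀; so v is close to
  -- both Q₀ and z Q₀.
  have h3 : ‖(v x : ℂ) - Q₀ x‖ ≤ ‖v x - φ x‖ := by
    have h4 : ‖φ x‖ = Q₀ x := by
      rw [h2, norm_mul, hz, one_mul, Complex.norm_real, Real.norm_of_nonneg hQ]
    have h5 := abs_norm_sub_norm_le (v x) (φ x)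
    rw [h4] at h5
    refine le_trans (le_of_eq ?_) h5
    conv_lhs => rw [h1]
    rw [← Complex.ofReal_sub, Complex.norm_real, Real.norm_eq_abs]
  have h6 : ‖z - 1‖ * Q₀ x ≤ 2 * ‖v x - φ x‖ := by
    calc ‖z - 1‖ * Q₀ x = ‖(z - 1) * (Q₀ x : ℂ)‖ := by
          rw [norm_mul, Complex.norm_real, Real.norm_of_nonneg hQ]
      _ = ‖(v x - Q₀ x) - (v x - φ x)‖ := by rw [h2]; congr 1; ring
      _ ≤ ‖v x - Q₀ x‖ + ‖v x - φ x‖ := norm_sub_le _ _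
      _ ≤ _ := by linarith
  calc ‖z - 1‖ ^ 2 * Q₀ x ^ 2 = (‖z - 1‖ * Q₀ x) ^ 2 := by ring
    _ ≤ (2 * ‖v x - φ x‖) ^ 2 := pow_le_pow_left₀ (by positivity) h6 2
    _ = _ := by rw [mul_pow]; norm_num

variable {s ζ : ℝ} {a b ℓ : ℕ → ℝ} {D2 D3 : ℕ → H1 → ℝ}

theorem approxGroundStates_subseq (hs : 0 < s) (hζ : 0 ≤ ζ) (h : RescaledRegime s ζ a b ℓ)
    (happ : LocalApprox s ζ ℓ D2 D3) {u : ℕ → H1}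
    (hu : IsApproxGroundStates (fun N => genEnergy s (a N) (b N) (D2 N) (D3 N))
      (fun N => ℓ N ^ s) u) {ns : ℕ → ℕ} (hns : Tendsto ns atTop atTop) :
    ∃ (k : ℕ → ℕ) (φ : H1) (z : ℂ), Tendsto k atTop atTop ∧ ‖z‖ = 1 ∧
      (∀ x, φ.rep x = z * (Q₀ x : ℂ)) ∧
      Tendsto (fun n => ∫ x, ‖(u (ns (k n))).scl (ℓ (ns (k n))) x - φ x‖ ^ 2) atTop (𝓝 0) ∧
      Tendsto (fun n => ∫ x, ‖((u (ns (k n))).scl (ℓ (ns (k n)))).weakDeriv x - φ.weakDeriv x‖ ^ 2)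
        atTop (𝓝 0) := by
  obtain ⟨δ, hδ, hu⟩ := hu
  obtain ⟨e, he, hue⟩ := collapse_upper_bound hs h happ
  have hc : Tendsto (fun N => e N + δ N / ℓ N ^ s) atTop (𝓝 (Qs s * ((s + 1) / s - ζ / 12))) := by
    simpa using he.add hδ.tendsto_div_nhds_zero
  refine (collapse_converges hs hζ h happ hns (u := fun n => u (ns n)) (hc.comp hns) le_rfl ?_).2
  filter_upwards [hns.eventually hue, hns.eventually h.pos, hns.eventually_ge_atTop 3] with
    n h1 h2 h3
  refine ⟨(hu _ h3).1, (hu _ h3).2.trans ?_⟩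
  have hp := (Real.rpow_pos_of_pos h2 s).ne'
  have h4 : (e (ns n) + δ (ns n) / ℓ (ns n) ^ s) * ℓ (ns n) ^ s =
      e (ns n) * ℓ (ns n) ^ s + δ (ns n) := by field_simp
  simp only [Function.comp_apply]
  rw [h4, EReal.coe_add]
  gcongr

theorem exists_phases (hs : 0 < s) (hζ : 0 ≤ ζ) (h : RescaledRegime s ζ a b ℓ)
    (happ : LocalApprox s ζ ℓ D2 D3) {u : ℕ → H1}
    (hu : IsApproxGroundStates (fun N => genEnergy s (a N) (b N) (D2 N) (D3 N))
      (fun N => ℓ N ^ s) u) :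
    ∃ θ : ℕ → ℝ, TendstoInH1
      (fun N x => Complex.exp (θ N * Complex.I) * rescale (ℓ N) (u N) x) (fun x => (Q₀ x : ℂ)) := by
  set G : ℕ → ℝ → ℝ := fun N θ => solitonDist ((u N).scl (ℓ N)) θ with hG
  have hbd : ∀ N, BddBelow (Set.range (G N)) := fun N =>
    ⟨0, by rintro _ ⟨θ, rfl⟩; exact solitonDist_nonneg _ _⟩
  -- The limiting phase may depend on the subsequence, but the distance minimized over all phases
  -- does not. It tends to zero along the full sequence, and near-minimizers then serve as phases.
  have hinf : Tendsto (fun N => ⨅ θ, G N θ) atTop (𝓝 0) := by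
    refine tendsto_of_subseq_tendsto fun ns hns => ?_
    obtain ⟨k, φ, z, hk, hz, hφ, h0, h1⟩ := approxGroundStates_subseq hs hζ h happ hu hns
    refine ⟨k, squeeze_zero (fun n => le_ciInf fun θ => solitonDist_nonneg _ _)
      (fun n => (ciInf_le (hbd _) (-z.arg)).trans (solitonDist_eq hz hφ).le) ?_⟩
    simpa using h0.add h1
  have hex : ∀ N : ℕ, ∃ θ, G N θ < (⨅ θ, G N θ) + 1 / ((N : ℝ) + 1) := fun N =>
    exists_lt_of_ciInf_lt (lt_add_of_pos_right _ (by positivity))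
  choose θ hθ using hex
  refine ⟨θ, tendstoInH1_soliton h.pos ?_⟩
  refine squeeze_zero (fun N => solitonDist_nonneg _ _) (fun N => (hθ N).le) ?_
  simpa using hinf.add tendsto_one_div_add_atTop_nhds_zero_nat

theorem tendsto_of_nonneg (hs : 0 < s) (hζ : 0 ≤ ζ) (h : RescaledRegime s ζ a b ℓ)
    (happ : LocalApprox s ζ ℓ D2 D3) {u : ℕ → H1}
    (hu : IsApproxGroundStates (fun N => genEnergy s (a N) (b N) (D2 N) (D3 N))
      (fun N => ℓ N ^ s) u) (hpos : ∀ N, 3 ≤ N → ∀ᵐ x, u N x = (‖u N x‖ : ℂ)) :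
    TendstoInH1 (fun N => rescale (ℓ N) (u N)) (fun x => (Q₀ x : ℂ)) := by
  suffices hsuff : Tendsto (fun N => solitonDist ((u N).scl (ℓ N)) 0) atTop (𝓝 0) by
    simpa using tendstoInH1_soliton (θ := fun _ => 0) h.pos hsuff
  refine tendsto_of_subseq_tendsto fun ns hns => ?_
  obtain ⟨k, φ, z, hk, hz, hφ, h0, h1⟩ := approxGroundStates_subseq hs hζ h happ hu hns
  have hnk : Tendsto (fun n => ns (k n)) atTop atTop := hns.comp hk
  have hz1 : z = 1 := by
    have hle : ‖z - 1‖ ^ 2 ≤ 4 * 0 := by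
      refine ge_of_tendsto (h0.const_mul 4) ?_
      filter_upwards [hnk.eventually h.pos, hnk.eventually_ge_atTop 3] with n hn h3
      refine norm_sub_one_sq_le hz hφ ?_
      rw [H1.scl_toFun hn]
      filter_upwards [ae_comp_mul_left hn.ne' (hpos _ h3)] with x hx
      rw [rescale, norm_mul, Complex.norm_real, Real.norm_of_nonneg (Real.sqrt_nonneg _)]
      push_cast
      rw [← hx]
    have : ‖z - 1‖ = 0 := by nlinarith [norm_nonneg (z - 1)]
    exact sub_eq_zero.mp (norm_eq_zero.mp this)
  refine ⟨k, ?_⟩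
  have h2 := (h0.add h1).congr fun n => (solitonDist_eq hz hφ).symm
  rwa [hz1, Complex.arg_one, neg_zero, add_zero] at h2

end HartreeNLS

/-! ### Verification of the scheme for Hartree, and analysis of the couplings. -/

namespace HartreeNLS

theorem localApprox_nls (s ζ : ℝ) (ℓ : ℕ → ℝ) :
    LocalApprox s ζ ℓ (fun _ u => ∫ x, u.dens x ^ 2) (fun _ u => ∫ x, u.dens x ^ 3) where
  bounds := Eventually.of_forall fun _ u _ =>
    ⟨⟨u.integral_dens_sq_nonneg, le_rfl⟩, ⟨u.integral_dens_cube_nonneg, le_rfl⟩⟩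
  error := ⟨fun _ => 0, tendsto_const_nhds, Eventually.of_forall fun _ _ _ => by simp⟩
  apriori _ := ⟨fun _ => 0, tendsto_const_nhds, Eventually.of_forall fun _ _ _ _ => by simp⟩

theorem tendsto_rpow_mul_rpow_atTop {ℓ : ℕ → ℝ} {η p γ : ℝ} (hp : 0 < p) (hη : η * p < γ)
    (hpos : ∀ᶠ N in atTop, 0 < ℓ N) (hℓ : ℓ =Θ[atTop] fun N : ℕ => (N : ℝ) ^ (-η)) :
    Tendsto (fun N : ℕ => ℓ N ^ p * (N : ℝ) ^ γ) atTop atTop := by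
  obtain ⟨C, hC, hb⟩ := hℓ.2.exists_pos
  have h1 : Tendsto (fun N : ℕ => C⁻¹ ^ p * (N : ℝ) ^ (γ - η * p)) atTop atTop :=
    ((tendsto_rpow_atTop (sub_pos.mpr hη)).comp tendsto_natCast_atTop_atTop).const_mul_atTop
      (by positivity)
  refine tendsto_atTop_mono' _ ?_ h1
  filter_upwards [hb.bound, hpos, eventually_gt_atTop 0] with N h2 h3 h4
  have hN : (0 : ℝ) < N := by exact_mod_cast h4
  rw [Real.norm_of_nonneg (by positivity), Real.norm_of_nonneg h3.le] at h2
  have h5 : C⁻¹ * (N : ℝ) ^ (-η) ≤ ℓ N := by rwa [inv_mul_le_iff₀ hC]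
  calc C⁻¹ ^ p * (N : ℝ) ^ (γ - η * p) = (C⁻¹ * (N : ℝ) ^ (-η)) ^ p * (N : ℝ) ^ γ := by
        rw [Real.mul_rpow (by positivity) (by positivity), ← Real.rpow_mul hN.le, mul_assoc,
          ← Real.rpow_add hN]
        congr 2
        ring
    _ ≤ _ := by gcongr

/-- First moments make both errors linear in κ / N^α and κ / N^β. In rescaled units they are of
order 1/(ℓ N^α) and 1/(ℓ N^β); the latter must beat ℓ^(s+2), so ℓ^(s+3) N^β → ∞ is required. -/
theorem localApprox_hartree {s ζ α β η : ℝ} (hs : 0 < s) {U : ℝ → ℝ} {W : ℝ × ℝ → ℝ}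
    (hU : TwoBodyPotential U) (hW : ThreeBodyPotential W) (hxU : Integrable fun x => x * U x)
    (hxW : Integrable fun p : ℝ × ℝ => p.1 * W p) {ℓ : ℕ → ℝ} (hpos : ∀ᶠ N in atTop, 0 < ℓ N)
    (hη : η < min (β / (s + 3)) α) (hη0 : 0 < η) (hℓ : ℓ =Θ[atTop] fun N : ℕ => (N : ℝ) ^ (-η))
    (hζ : ζ = 0 → β < α) :
    LocalApprox s ζ ℓ (fun N => twoBody U α N) (fun N => threeBody W β N) := by
  have hη1 := lt_of_lt_of_le hη (min_le_left _ _)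
  have hη2 := lt_of_lt_of_le hη (min_le_right _ _)
  rw [lt_div_iff₀ (by linarith)] at hη1
  set cU := ∫ x, |x * U x|
  set cW := ∫ p : ℝ × ℝ, (|p.1 * W p| + |p.2 * W p|)
  have hcU : 0 ≤ cU := integral_nonneg fun _ => abs_nonneg _
  have hcW : 0 ≤ cW := integral_nonneg fun _ => by positivity
  have hbc := bCrit_pos
  refine ⟨?_, ⟨fun N => 4 * cU * (ℓ N ^ (1 : ℝ) * (N : ℝ) ^ α)⁻¹ +
      8 * cW * (ℓ N ^ (s + 3) * (N : ℝ) ^ β)⁻¹, ?_, ?_⟩, ?_⟩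
  · filter_upwards [eventually_ge_atTop 1] with N hN u hm
    have h2 := twoBody_bounds hU α hN hm
    have h3 := threeBody_bounds hW β hN hm
    exact ⟨⟨h2.1, h2.2.1⟩, ⟨h3.1, h3.2.1⟩⟩
  · have h1 := (tendsto_rpow_mul_rpow_atTop one_pos (by rwa [mul_one]) hpos
      hℓ).inv_tendsto_atTop.const_mul (4 * cU)
    have h2 := (tendsto_rpow_mul_rpow_atTop (p := s + 3) (by linarith) hη1 hpos
      hℓ).inv_tendsto_atTop.const_mul (8 * cW)
    simpa using h1.add h2
  · filter_upwards [hpos, eventually_ge_atTop 1] with N hl hN u hm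
    have hNpos : (0 : ℝ) < N := by exact_mod_cast hN
    have hk := u.kap_nonneg
    have hα := Real.rpow_pos_of_pos hNpos α
    have hβ := Real.rpow_pos_of_pos hNpos β
    have hp := Real.rpow_pos_of_pos hl s
    have h2 := (twoBody_bounds hU α hN hm).2.2
    have h3 := (threeBody_bounds hW β hN hm).2.2
    have hmU := modU_le hU hxU (t := u.kap / (N : ℝ) ^ α) (by positivity)
    have hmW := modW_le hW hxW (t := u.kap / (N : ℝ) ^ β) (by positivity)
    have r1 : 0 ≤ 4 * cU * (ℓ N ^ (1 : ℝ) * (N : ℝ) ^ α)⁻¹ := by positivity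
    have r2 : 0 ≤ 8 * cW * (ℓ N ^ (s + 3) * (N : ℝ) ^ β)⁻¹ := by positivity
    constructor
    · calc ℓ N * ((∫ x, u.dens x ^ 2) - twoBody U α N u)
          ≤ ℓ N * (4 * u.kap * (cU * (u.kap / (N : ℝ) ^ α))) :=
            mul_le_mul_of_nonneg_left (h2.trans (mul_le_mul_of_nonneg_left hmU (by positivity))) hl.le
        _ = (ℓ N * u.kap) ^ 2 * (4 * cU * (ℓ N ^ (1 : ℝ) * (N : ℝ) ^ α)⁻¹) := by
            rw [Real.rpow_one]; field_simp
        _ ≤ _ := mul_le_mul_of_nonneg_left (by linarith) (by positivity)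
    · calc ℓ N ^ 2 * ((∫ x, u.dens x ^ 3) - threeBody W β N u)
          ≤ ℓ N ^ 2 * (8 * u.kap ^ 2 * (cW * (u.kap / (N : ℝ) ^ β))) :=
            mul_le_mul_of_nonneg_left (h3.trans (mul_le_mul_of_nonneg_left hmW (by positivity)))
              (by positivity)
        _ = (ℓ N * u.kap) ^ 3 * (ℓ N ^ (s + 2) *
              (8 * cW * (ℓ N ^ (s + 3) * (N : ℝ) ^ β)⁻¹)) := by
            rw [Real.rpow_add hl, Real.rpow_add hl, Real.rpow_ofNat, Real.rpow_ofNat]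
            field_simp
        _ ≤ _ := by
            have := Real.rpow_pos_of_pos hl (s + 2)
            refine mul_le_mul_of_nonneg_left (mul_le_mul_of_nonneg_left ?_ this.le) (by positivity)
            linarith
  · intro h0
    obtain ⟨C, hC, hCb⟩ := exists_threeBody_le hW β
    set M := bCrit / 6 * C + 1
    have hM : 0 ≤ M := by positivity
    refine ⟨fun N => 4 * cU * √M * (N : ℝ) ^ (-(α - β)), ?_, ?_⟩
    · have := ((tendsto_rpow_neg_atTop (sub_pos.mpr (hζ h0))).comp
        tendsto_natCast_atTop_atTop).const_mul (4 * cU * √M)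
      simpa [Function.comp_def] using this
    -- Since ℓ N^β ≥ 1 eventually, the additive 1 of the a priori hypothesis is absorbed into ℓ² M
    -- N^(2β). This gives κ ≤ √M N^β, far below N^α.
    · have hlβ := (tendsto_rpow_mul_rpow_atTop (γ := β) one_pos (by nlinarith) hpos
        hℓ).eventually_ge_atTop 1
      filter_upwards [hpos, eventually_ge_atTop 1, hlβ] with N hl hN h1 u hm h2
      rw [Real.rpow_one] at h1
      have hNpos : (0 : ℝ) < N := by exact_mod_cast hN
      have hk := u.kap_nonneg
      have hα := Real.rpow_pos_of_pos hNpos α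
      have hβ := Real.rpow_pos_of_pos hNpos β
      have h3 : u.kap ≤ √M * (N : ℝ) ^ β := by
        refine abs_le_of_sq_le_sq' ?_ (by positivity) |>.2
        rw [mul_pow, Real.sq_sqrt hM, H1.kap_sq]
        have h4 : (1 : ℝ) ≤ ℓ N ^ 2 * ((N : ℝ) ^ β) ^ 2 := by
          rw [← mul_pow]; exact one_le_pow₀ h1
        have h5 : ℓ N ^ 2 * kinetic u ≤ ℓ N ^ 2 * (M * ((N : ℝ) ^ β) ^ 2) := by
          refine h2.trans ?_
          have := mul_le_mul_of_nonneg_left (hCb N hN u hm)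
            (by positivity : 0 ≤ bCrit / 6 * ℓ N ^ 2)
          have e : ℓ N ^ 2 * (M * ((N : ℝ) ^ β) ^ 2) = bCrit / 6 * ℓ N ^ 2 * (C * ((N : ℝ) ^ β) ^ 2) +
            ℓ N ^ 2 * ((N : ℝ) ^ β) ^ 2 := by ring
          rw [e]
          linarith
        exact le_of_mul_le_mul_left h5 (by positivity)
      have hmU := modU_le hU hxU (t := u.kap / (N : ℝ) ^ α) (by positivity)
      calc (∫ x, u.dens x ^ 2) - twoBody U α N u ≤ 4 * u.kap * (cU * (u.kap / (N : ℝ) ^ α)) :=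
            (twoBody_bounds hU α hN hm).2.2.trans (mul_le_mul_of_nonneg_left hmU (by positivity))
        _ ≤ 4 * u.kap * (cU * (√M * (N : ℝ) ^ β / (N : ℝ) ^ α)) := by gcongr
        _ = _ := by
          rw [neg_sub, Real.rpow_sub hNpos]; ring

section regime

variable {s ζ : ℝ} {a b ℓ : ℕ → ℝ}

theorem CollapseRegime.gap_nonneg (h : CollapseRegime s ζ a b ℓ) :
    ∀ᶠ N in atTop, 0 ≤ bCrit - b N :=
  (eventually_ge_atTop 3).mono fun N hN => sub_nonneg.mpr (h.b_le N hN)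

theorem CollapseRegime.tendsto_gap (h : CollapseRegime s ζ a b ℓ) :
    Tendsto (fun N => bCrit - b N) atTop (𝓝 0) := by
  simpa using h.tendsto_b.const_sub bCrit

theorem coe_mul_ofReal_rpow {a x p : ℝ} (hx : 0 < x) :
    (a : EReal) * ((ENNReal.ofReal x ^ p : ℝ≥0∞) : EReal) = ((a * x ^ p : ℝ) : EReal) := by
  rw [ENNReal.ofReal_rpow_of_pos hx, EReal.coe_ennreal_ofReal, max_eq_left (by positivity),
    EReal.coe_mul]

theorem coe_mul_ofReal_zero_rpow {a p : ℝ} (ha : 0 < a) (hp : p < 0) :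
    (a : EReal) * ((ENNReal.ofReal 0 ^ p : ℝ≥0∞) : EReal) = ⊤ := by
  rw [ENNReal.ofReal_zero, ENNReal.zero_rpow_of_neg hp, EReal.coe_ennreal_top,
    EReal.coe_mul_top_of_pos ha]

/-- If the gap vanished, stability would force a N > 0 and the ratio would be +∞, contrary to its
finite limit. Hence the gap is eventually positive and the limit is one of real numbers. -/
theorem CollapseRegime.ratio_of_pos (h : CollapseRegime s ζ a b ℓ) (hs : 0 < s) (hζ : 0 < ζ) :
    (∀ᶠ N in atTop, 0 < bCrit - b N) ∧
    Tendsto (fun N => a N / (bCrit - b N) ^ ((s + 1) / (s + 2))) atTop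
      (𝓝 (Real.pi * ((6 - ζ) / 6) * Qs s / (ζ * Qs s) ^ ((s + 1) / (s + 2)))) := by
  have hQ := Qs_pos hs
  have hp : -(s + 1) / (s + 2) < 0 := div_neg_of_neg_of_pos (by linarith) (by linarith)
  have hlim := h.tendsto_ratio
  rw [coe_mul_ofReal_rpow hζ] at hlim
  have hpos : ∀ᶠ N in atTop, 0 < bCrit - b N := by
    filter_upwards [hlim.eventually_ne (EReal.coe_ne_top _), eventually_ge_atTop 3] with N h1 h2
    refine lt_of_le_of_ne (sub_nonneg.mpr (h.b_le N h2)) fun h0 => h1 ?_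
    have h3 := h.stable N h2
    rw [← h0, add_zero, lt_max_iff] at h3
    rw [← h0]
    exact coe_mul_ofReal_zero_rpow (h3.resolve_left (lt_irrefl _)) hp
  refine ⟨hpos, ?_⟩
  have h1 : Tendsto (fun N => ((a N * (bCrit - b N) ^ (-(s + 1) / (s + 2)) : ℝ) : EReal)) atTop
      (𝓝 ((Real.pi * ((6 - ζ) / 6) * Qs s ^ (1 / (s + 2)) * ζ ^ (-(s + 1) / (s + 2)) : ℝ) : EReal)) :=
    hlim.congr' (hpos.mono fun N hN => coe_mul_ofReal_rpow hN)
  rw [EReal.tendsto_coe] at h1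
  have e : -(s + 1) / (s + 2) = -((s + 1) / (s + 2)) := neg_div _ _
  have e1 : Qs s ^ (1 / (s + 2)) * Qs s ^ ((s + 1) / (s + 2)) = Qs s := by
    rw [← Real.rpow_add hQ, ← add_div, div_eq_one_iff_eq (by positivity) |>.mpr (by ring),
      Real.rpow_one]
  have hq := Real.rpow_pos_of_pos hζ ((s + 1) / (s + 2))
  have hq' := Real.rpow_pos_of_pos hQ ((s + 1) / (s + 2))
  have e2 : Real.pi * ((6 - ζ) / 6) * Qs s ^ (1 / (s + 2)) * ζ ^ (-(s + 1) / (s + 2)) =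
      Real.pi * ((6 - ζ) / 6) * Qs s / (ζ * Qs s) ^ ((s + 1) / (s + 2)) := by
    rw [Real.mul_rpow hζ.le hQ.le, e, Real.rpow_neg hζ.le, eq_div_iff (by positivity)]
    nth_rewrite 3 [← e1]
    field_simp
  rw [← e2]
  refine h1.congr' ?_
  filter_upwards [hpos] with N hN
  rw [e, Real.rpow_neg hN.le, ← div_eq_mul_inv]

/-- An infinite limit forces a N > 0 eventually. The inverted ratio avoids the value +∞ and also
makes sense where the gap is zero. -/
theorem CollapseRegime.ratio_of_zero (h : CollapseRegime s 0 a b ℓ) (hs : 0 < s) :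
    (∀ᶠ N in atTop, 0 < a N) ∧
    Tendsto (fun N => (bCrit - b N) ^ ((s + 1) / (s + 2)) / a N) atTop (𝓝 0) := by
  have hQ := Qs_pos hs
  have hp : -(s + 1) / (s + 2) < 0 := div_neg_of_neg_of_pos (by linarith) (by linarith)
  have hlim := h.tendsto_ratio
  rw [coe_mul_ofReal_zero_rpow (by positivity) hp] at hlim
  have hM := EReal.tendsto_nhds_top_iff_real.mp hlim
  have ha : ∀ᶠ N in atTop, 0 < a N := by
    filter_upwards [hM 0] with N hN
    by_contra! hle
    refine absurd hN (not_lt.mpr ?_)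
    exact mul_nonpos_of_nonpos_of_nonneg (by exact_mod_cast hle) (EReal.coe_ennreal_nonneg _)
  refine ⟨ha, tendsto_order.mpr ⟨fun y hy => ?_, fun y hy => ?_⟩⟩
  · filter_upwards [ha, h.gap_nonneg] with N h1 h2
    exact hy.trans_le (by positivity)
  · filter_upwards [ha, h.gap_nonneg, hM y⁻¹] with N h1 h2 h3
    rcases h2.eq_or_lt with h0 | h0
    · rw [← h0, Real.zero_rpow (by positivity), zero_div]; exact hy
    · rw [coe_mul_ofReal_rpow h0, EReal.coe_lt_coe_iff, neg_div, Real.rpow_neg h0.le,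
        ← div_eq_mul_inv, lt_div_iff₀ (by positivity), inv_mul_lt_iff₀ hy] at h3
      rwa [div_lt_iff₀ h1]

theorem rescaledRegime_of_two_body_length (hs : 0 < s) (hζ : 0 ≤ ζ) (hζ6 : ζ ≠ 6)
    (h : CollapseRegime s ζ a b ℓ)
    (hℓ : ∀ N, 3 ≤ N → ℓ N = (6 * a N / ((6 - ζ) * Real.pi * Qs s)) ^ (1 / (s + 1)))
    (hg : ∀ᶠ N in atTop, 0 < 6 * a N / ((6 - ζ) * Real.pi * Qs s))
    (hlim : Tendsto (fun N => (bCrit - b N) ^ ((s + 1) / (s + 2)) /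
      (6 * a N / ((6 - ζ) * Real.pi * Qs s))) atTop (𝓝 ((ζ * Qs s) ^ ((s + 1) / (s + 2))))) :
    RescaledRegime s ζ a b ℓ := by
  have hQ := Qs_pos hs
  have h6 : 6 - ζ ≠ 0 := sub_ne_zero.mpr hζ6.symm
  have hpos : ∀ᶠ N in atTop, 0 < ℓ N ∧ ℓ N ^ (s + 1) = 6 * a N / ((6 - ζ) * Real.pi * Qs s) ∧
      ℓ N ^ (s + 2) = (6 * a N / ((6 - ζ) * Real.pi * Qs s)) ^ ((s + 2) / (s + 1)) := by
    filter_upwards [hg, eventually_ge_atTop 3] with N h1 h2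
    rw [hℓ N h2]
    refine ⟨by positivity, ?_, ?_⟩
    · rw [← Real.rpow_mul h1.le, one_div_mul_cancel (by positivity), Real.rpow_one]
    · rw [← Real.rpow_mul h1.le, one_div_mul_eq_div]
  refine ⟨hpos.mono fun N hN => hN.1, ?_, h.gap_nonneg.mono fun N hN => sub_nonneg.mp hN, ?_, ?_⟩
  · have h1 : Tendsto (fun N => (6 * a N / ((6 - ζ) * Real.pi * Qs s)) ^ (1 / (s + 1))) atTop
        (𝓝 ((6 * 0 / ((6 - ζ) * Real.pi * Qs s)) ^ (1 / (s + 1)))) :=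
      ((h.tendsto_a.const_mul 6).div_const _).rpow_const (Or.inr (by positivity))
    rw [mul_zero, zero_div, Real.zero_rpow (by positivity)] at h1
    refine h1.congr' ?_
    filter_upwards [eventually_ge_atTop 3] with N hN
    rw [hℓ N hN]
  · refine tendsto_const_nhds.congr' ?_
    filter_upwards [hpos, hg] with N h1 h2
    have ha : a N ≠ 0 := by rintro h0; rw [h0] at h2; simp at h2
    rw [h1.2.1]
    field_simp
  · have h1 := hlim.rpow_const (p := (s + 2) / (s + 1)) (Or.inr (by positivity))
    rw [← Real.rpow_mul (by positivity), div_mul_div_cancel₀ (by positivity),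
      div_self (by positivity), Real.rpow_one] at h1
    refine h1.congr' ?_
    filter_upwards [hpos, hg, h.gap_nonneg] with N h2 h3 h4
    rw [h2.2.2, Real.div_rpow (by positivity) h3.le, ← Real.rpow_mul h4,
      div_mul_div_cancel₀ (by positivity), div_self (by positivity), Real.rpow_one]

theorem rescaledRegime_of_gap_length (hs : 0 < s) (hζ : 0 < ζ) (h : CollapseRegime s ζ a b ℓ)
    (hℓ : ∀ N, 3 ≤ N → ℓ N = ((bCrit - b N) / (ζ * Qs s)) ^ (1 / (s + 2))) :
    RescaledRegime s ζ a b ℓ := by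
  have hQ := Qs_pos hs
  obtain ⟨hgap, hlim⟩ := h.ratio_of_pos hs hζ
  have hpos : ∀ᶠ N in atTop, 0 < ℓ N ∧ ℓ N ^ (s + 2) = (bCrit - b N) / (ζ * Qs s) ∧
      ℓ N ^ (s + 1) = ((bCrit - b N) / (ζ * Qs s)) ^ ((s + 1) / (s + 2)) := by
    filter_upwards [hgap, eventually_ge_atTop 3] with N h1 h2
    have h3 : 0 ≤ (bCrit - b N) / (ζ * Qs s) := by positivity
    rw [hℓ N h2]
    refine ⟨by positivity, ?_, ?_⟩
    · rw [← Real.rpow_mul h3, one_div_mul_cancel (by positivity), Real.rpow_one]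
    · rw [← Real.rpow_mul h3, one_div_mul_eq_div]
  refine ⟨hpos.mono fun N hN => hN.1, ?_, h.gap_nonneg.mono fun N hN => sub_nonneg.mp hN, ?_, ?_⟩
  · have h1 := (h.tendsto_gap.div_const (ζ * Qs s)).rpow_const (p := 1 / (s + 2))
      (Or.inr (by positivity))
    rw [zero_div, Real.zero_rpow (by positivity)] at h1
    refine h1.congr' ?_
    filter_upwards [eventually_ge_atTop 3] with N hN
    rw [hℓ N hN]
  · have h1 := hlim.mul_const ((ζ * Qs s) ^ ((s + 1) / (s + 2)))
    rw [div_mul_cancel₀ _ (by positivity)] at h1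
    refine h1.congr' ?_
    filter_upwards [hpos, hgap] with N h2 h3
    rw [h2.2.2, Real.div_rpow h3.le (by positivity)]
    field_simp
  · refine tendsto_const_nhds.congr' ?_
    filter_upwards [hpos, hgap] with N h1 h2
    rw [h1.2.1]
    field_simp

theorem CollapseRegime.rescaled (h : CollapseRegime s ζ a b ℓ) (hs : 0 < s) (hζ : 0 ≤ ζ) :
    RescaledRegime s ζ a b ℓ := by
  have hQ := Qs_pos hs
  rcases h.length with ⟨h6, hℓ⟩ | ⟨h0, hℓ⟩
  · have h6' : 6 - ζ ≠ 0 := sub_ne_zero.mpr h6.symm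
    rcases hζ.eq_or_lt with rfl | hpos
    · obtain ⟨ha, hlim⟩ := h.ratio_of_zero hs
      refine rescaledRegime_of_two_body_length hs hζ h6 h hℓ ?_ ?_
      · filter_upwards [ha] with N hN
        rw [sub_zero]; positivity
      · have h1 := hlim.const_mul ((6 - 0) * Real.pi * Qs s / 6)
        rw [mul_zero] at h1
        rw [zero_mul, Real.zero_rpow (by positivity)]
        refine h1.congr fun N => ?_
        rw [div_div_eq_mul_div]
        ring
    · obtain ⟨hgap, hlim⟩ := h.ratio_of_pos hs hpos
      have hq : 0 < (ζ * Qs s) ^ ((s + 1) / (s + 2)) := by positivity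
      have h1 : Tendsto (fun N => 6 * a N / ((6 - ζ) * Real.pi * Qs s) /
          (bCrit - b N) ^ ((s + 1) / (s + 2))) atTop (𝓝 ((ζ * Qs s) ^ ((s + 1) / (s + 2)))⁻¹) := by
        have h2 := hlim.const_mul (6 / ((6 - ζ) * Real.pi * Qs s))
        convert h2 using 2
        · ring
        · field_simp
      refine rescaledRegime_of_two_body_length hs hζ h6 h hℓ ?_ ?_
      -- The base of the power defining ℓ N is positive because its ratio to a power of the gap has
      -- a positive limit. This includes ζ > 6, where a N is eventually negative.
      · filter_upwards [h1.eventually (lt_mem_nhds (inv_pos.mpr hq)), hgap] with N h2 h3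
        have h4 := Real.rpow_pos_of_pos h3 ((s + 1) / (s + 2))
        exact (div_pos_iff_of_pos_right h4).mp h2
      · have h2 := h1.inv₀ (inv_ne_zero hq.ne')
        simpa only [inv_inv, inv_div] using h2
  · exact rescaledRegime_of_gap_length hs (lt_of_le_of_ne hζ h0.symm) h hℓ

end regime

end HartreeNLS

/-! ### Fixed couplings. -/

namespace HartreeNLS

section interaction

variable {U : ℝ → ℝ} {W : ℝ × ℝ → ℝ} {α β : ℝ} {ns : ℕ → ℕ} {u : ℕ → H1} {C : ℝ}

theorem tendsto_div_rpow_natCast (hα : 0 < α) (hns : Tendsto ns atTop atTop) {t : ℕ → ℝ}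
    (h0 : ∀ᶠ n in atTop, 0 ≤ t n) (hC : ∀ᶠ n in atTop, t n ≤ C) :
    Tendsto (fun n => t n / (ns n : ℝ) ^ α) atTop (𝓝 0) := by
  have h1 : Tendsto (fun n => C / (ns n : ℝ) ^ α) atTop (𝓝 0) :=
    tendsto_const_nhds.div_atTop
      ((tendsto_rpow_atTop hα).comp (tendsto_natCast_atTop_atTop.comp hns))
  refine squeeze_zero' ?_ ?_ h1
  · filter_upwards [h0] with n hn
    positivity
  · filter_upwards [hC] with n hn
    gcongr

theorem tendsto_twoBody_error (hU : TwoBodyPotential U) (hα : 0 < α)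
    (hns : Tendsto ns atTop atTop) (hm : ∀ᶠ n in atTop, mass (u n) = 1)
    (hC : ∀ᶠ n in atTop, (u n).kap ≤ C) :
    Tendsto (fun n => (∫ x, (u n).dens x ^ 2) - twoBody U α (ns n) (u n)) atTop (𝓝 0) := by
  have hk : ∀ n, 0 ≤ (u n).kap := fun n => (u n).kap_nonneg
  have h1 := tendsto_modU hU (tendsto_div_rpow_natCast hα hns (Eventually.of_forall hk) hC)
    (Eventually.of_forall fun n => div_nonneg (hk n) (by positivity))
  have h2 := (h1.abs.const_mul (4 * C))
  rw [abs_zero, mul_zero] at h2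
  refine squeeze_zero' ?_ ?_ h2
  · filter_upwards [hm, hns.eventually_ge_atTop 1] with n h3 h4
    exact sub_nonneg.mpr (twoBody_bounds hU α h4 h3).2.1
  · filter_upwards [hm, hns.eventually_ge_atTop 1, hC] with n h3 h4 h5
    refine (twoBody_bounds hU α h4 h3).2.2.trans ?_
    have := hk n
    exact (mul_le_mul_of_nonneg_left (le_abs_self _) (by positivity)).trans
      (mul_le_mul_of_nonneg_right (by linarith) (abs_nonneg _))

theorem tendsto_threeBody_error (hW : ThreeBodyPotential W) (hβ : 0 < β)
    (hns : Tendsto ns atTop atTop) (hm : ∀ᶠ n in atTop, mass (u n) = 1)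
    (hC : ∀ᶠ n in atTop, (u n).kap ≤ C) :
    Tendsto (fun n => (∫ x, (u n).dens x ^ 3) - threeBody W β (ns n) (u n)) atTop (𝓝 0) := by
  have hk : ∀ n, 0 ≤ (u n).kap := fun n => (u n).kap_nonneg
  have h1 := tendsto_modW hW (tendsto_div_rpow_natCast hβ hns (Eventually.of_forall hk) hC)
    (Eventually.of_forall fun n => div_nonneg (hk n) (by positivity))
  have h2 := (h1.abs.const_mul (8 * C ^ 2))
  rw [abs_zero, mul_zero] at h2
  refine squeeze_zero' ?_ ?_ h2
  · filter_upwards [hm, hns.eventually_ge_atTop 1] with n h3 h4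
    exact sub_nonneg.mpr (threeBody_bounds hW β h4 h3).2.1
  · filter_upwards [hm, hns.eventually_ge_atTop 1, hC] with n h3 h4 h5
    refine (threeBody_bounds hW β h4 h3).2.2.trans ?_
    have := hk n
    refine (mul_le_mul_of_nonneg_left (le_abs_self _) (by positivity)).trans
      (mul_le_mul_of_nonneg_right ?_ (abs_nonneg _))
    gcongr

end interaction

variable {U : ℝ → ℝ} {W : ℝ × ℝ → ℝ} {s α β a b : ℝ}

theorem hartree_le_iff {N : ℕ} {u : H1} {c : ℝ} : hartree U W s α β a b N u ≤ (c : EReal) ↔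
    trapping s u ≠ ⊤ ∧ (trapping s u).toReal +
      (kinetic u + a / 2 * twoBody U α N u - b / 6 * threeBody W β N u) ≤ c :=
  coe_add_coe_le_iff

theorem nls_le_iff {u : H1} {c : ℝ} : nls s a b u ≤ (c : EReal) ↔
    trapping s u ≠ ⊤ ∧ (trapping s u).toReal +
      (kinetic u + a / 2 * (∫ x, u.dens x ^ 2) - b / 6 * ∫ x, u.dens x ^ 3) ≤ c := by
  rw [nls_eq_genEnergy]
  exact coe_add_coe_le_iff

theorem hartree_exists_bound (hβ : 0 < β) (hU : TwoBodyPotential U)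
    (hW : ThreeBodyPotential W) (hb : 0 < b) (hab : b < bCrit ∨ (b = bCrit ∧ 0 < a ∧ β < α))
    {E : ℝ} (hE : 0 ≤ E) {ns : ℕ → ℕ} (hns : Tendsto ns atTop atTop) {u : ℕ → H1}
    (hu : ∀ᶠ n in atTop, mass (u n) = 1 ∧ hartree U W s α β a b (ns n) (u n) ≤ (E : EReal)) :
    ∃ C, ∀ᶠ n in atTop, (u n).kap ≤ C ∧ trapping s (u n) ≤ ENNReal.ofReal C := by
  have hbc := bCrit_pos
  suffices hsuff : ∃ C D, ∀ᶠ n in atTop, (u n).kap ≤ C ∧ (trapping s (u n)).toReal ≤ D by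
    obtain ⟨C, D, hCD⟩ := hsuff
    refine ⟨max C D, ?_⟩
    filter_upwards [hCD, hu] with n hn hn'
    refine ⟨hn.1.trans (le_max_left _ _), ?_⟩
    rw [← ENNReal.ofReal_toReal (hartree_le_iff.mp hn'.2).1]
    exact ENNReal.ofReal_le_ofReal (hn.2.trans (le_max_right _ _))
  rcases hab with hlt | ⟨rfl, ha, hβα⟩
  · have h0 : 0 < bCrit - b := sub_pos.mpr hlt
    refine ⟨1 + (|a| + E) / ((bCrit - b) / bCrit),
      |a| * (1 + (|a| + E) / ((bCrit - b) / bCrit)) + E, ?_⟩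
    filter_upwards [hu, hns.eventually_ge_atTop 1] with n ⟨hm, he⟩ hN
    have h2 := twoBody_bounds hU α hN hm
    have h3 := threeBody_bounds hW β hN hm
    -- With unit prefactor, the difference `bCrit` − b plays the role of the gap B.
    have := kap_le_of_coercive (lam := 1) (A := a) (A1 := |a|) hm
      (ENNReal.toReal_nonneg (a := trapping s (u n)))
      (H1.kap_sq _).symm h0 le_rfl le_rfl hE (by linarith) h2.1 h2.2.1 h3.2.1
      (by linarith [(hartree_le_iff.mp he).2])
    exact ⟨this.1, this.2.trans (by gcongr; exact this.1)⟩
  · obtain ⟨C, hC, hCb⟩ := exists_threeBody_le hW β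
    set M := bCrit / 6 * C + E
    have hM : 0 ≤ M := by positivity
    -- The cap √M N^β makes t tend to zero unconditionally. Once the energy bound gives κ ≤ √M N^β,
    -- the cap is inactive and t is the true ratio κ / N^α.
    set t : ℕ → ℝ := fun n => min (u n).kap (√M * (ns n : ℝ) ^ β) / (ns n : ℝ) ^ α
    have ht0 : ∀ n, 0 ≤ t n := fun n =>
      div_nonneg (le_min (u n).kap_nonneg (by positivity)) (by positivity)
    have ht : Tendsto t atTop (𝓝 0) := by
      have h1 := (((tendsto_rpow_neg_atTop (sub_pos.mpr hβα)).comp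
        tendsto_natCast_atTop_atTop).comp hns).const_mul √M
      rw [mul_zero] at h1
      refine squeeze_zero' (Eventually.of_forall ht0) ?_ h1
      filter_upwards [hns.eventually_ge_atTop 1] with n hn
      have hN : (0 : ℝ) < ns n := by exact_mod_cast hn
      simp only [t, Function.comp_apply]
      rw [neg_sub, Real.rpow_sub hN, ← mul_div_assoc]
      gcongr
      exact min_le_right _ _
    have hδ : Tendsto (fun n => bCrit * (4 * modU U (t n)) / 3) atTop (𝓝 0) := by
      simpa using (((tendsto_modU hU ht (Eventually.of_forall ht0)).const_mul 4).const_mul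
        bCrit).div_const 3
    refine ⟨1 + (bCrit / 3 * (2 * E / a) + E) / (1 / 2), E, ?_⟩
    filter_upwards [hu, hns.eventually_ge_atTop 1, hδ.eventually (ge_mem_nhds (half_pos one_pos))]
      with n ⟨hm, he⟩ hN hδ1
    have h2 := twoBody_bounds hU α hN hm
    have h3 := threeBody_bounds hW β hN hm
    refine kap_le_of_repulsive (lam := 1) (B := 0) hm
      (ENNReal.toReal_nonneg (a := trapping s (u n))) (H1.kap_sq _).symm ha le_rfl le_rfl hE one_pos
      hE (by linarith) h2.1 h3.1 h3.2.1 hδ1 (fun hK => ?_)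
      (by linarith [(hartree_le_iff.mp he).2])
    have hN' : (1 : ℝ) ≤ (ns n : ℝ) ^ β := Real.one_le_rpow (by exact_mod_cast hN) hβ.le
    have h4 : (u n).kap ≤ √M * (ns n : ℝ) ^ β := by
      refine (abs_le_of_sq_le_sq' ?_ (by positivity)).2
      rw [mul_pow, Real.sq_sqrt hM, H1.kap_sq]
      have h5 := mul_le_mul_of_nonneg_left (hCb _ hN _ hm) (by positivity : 0 ≤ bCrit / 6)
      have h6 : E * 1 ≤ E * ((ns n : ℝ) ^ β) ^ 2 := by
        gcongr
        exact one_le_pow₀ hN'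
      simp only [M]
      linarith
    have h5 : t n = (u n).kap / (ns n : ℝ) ^ α := by simp only [t]; rw [min_eq_left h4]
    rw [h5]
    linarith [h2.2.2]

/-- Bounded states have a weak limit along which the nonlocal terms become local, while trapping and
kinetic energies are lower semicontinuous. If the limit has at least the limiting energy, neither
can drop, so the kinetic energy converges and the convergence is strong. -/
theorem hartree_subseq (hs : 0 < s) (hα : 0 < α) (hβ : 0 < β) (hU : TwoBodyPotential U)
    (hW : ThreeBodyPotential W) (hb : 0 < b) (hab : b < bCrit ∨ (b = bCrit ∧ 0 < a ∧ β < α))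
    {ns : ℕ → ℕ} (hns : Tendsto ns atTop atTop) {u : ℕ → H1} {e : ℕ → ℝ} {e' : ℝ}
    (he : Tendsto e atTop (𝓝 e'))
    (hu : ∀ᶠ n in atTop, mass (u n) = 1 ∧ hartree U W s α β a b (ns n) (u n) ≤ (e n : EReal)) :
    ∃ (k : ℕ → ℕ) (φ : H1), StrictMono k ∧ mass φ = 1 ∧ nls s a b φ ≤ (e' : EReal) ∧
      ((e' : EReal) ≤ nls s a b φ → TendstoInH1 (fun n => u (k n)) φ) := by
  have hE : ∀ᶠ n in atTop, mass (u n) = 1 ∧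
      hartree U W s α β a b (ns n) (u n) ≤ ((|e'| + 1 : ℝ) : EReal) := by
    filter_upwards [hu, he.eventually
      (ge_mem_nhds (lt_of_le_of_lt (le_abs_self _) (lt_add_one _)))] with n h1 h2
    exact ⟨h1.1, h1.2.trans (by exact_mod_cast h2)⟩
  obtain ⟨C, hC⟩ := hartree_exists_bound hβ hU hW hb hab (by positivity) hns hE
  obtain ⟨n₀, hn₀⟩ := eventually_atTop.mp (hC.and hu)
  set w : ℕ → H1 := fun n => u (n + n₀)
  have hw : ∀ n, ((w n).kap ≤ C ∧ trapping s (w n) ≤ ENNReal.ofReal C) ∧ mass (w n) = 1 ∧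
      hartree U W s α β a b (ns (n + n₀)) (w n) ≤ (e (n + n₀) : EReal) :=
    fun n => hn₀ _ (by omega)
  obtain ⟨φ, k, hk, hpt, hkin⟩ := H1.exists_weak_limit (fun n => (hw n).2.1) (fun n => (hw n).1.1)
  obtain ⟨hmφ, l2, l3, lL⟩ := H1.dens_pow_tendsto hs (fun n => (hw (k n)).2.1)
    (fun n => (hw (k n)).1.1) (fun n => (hw (k n)).1.2) hpt
  have hm : Tendsto (fun n => k n + n₀) atTop atTop :=
    tendsto_atTop_mono (fun n => Nat.le_add_right _ _) hk.tendsto_atTop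
  have hN : Tendsto (fun n => ns (k n + n₀)) atTop atTop := hns.comp hm
  have hmass : ∀ᶠ n in atTop, mass (w (k n)) = 1 := Eventually.of_forall fun n => (hw (k n)).2.1
  have hkap : ∀ᶠ n in atTop, (w (k n)).kap ≤ C := Eventually.of_forall fun n => (hw (k n)).1.1
  have ld2 : Tendsto (fun n => twoBody U α (ns (k n + n₀)) (w (k n))) atTop
      (𝓝 (∫ x, φ.dens x ^ 2)) := by
    simpa using l2.sub (tendsto_twoBody_error hU hα hN hmass hkap)
  have ld3 : Tendsto (fun n => threeBody W β (ns (k n + n₀)) (w (k n))) atTop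
      (𝓝 (∫ x, φ.dens x ^ 3)) := by
    simpa using l3.sub (tendsto_threeBody_error hW hβ hN hmass hkap)
  set R : ℕ → ℝ := fun n => e (k n + n₀) - a / 2 * twoBody U α (ns (k n + n₀)) (w (k n)) +
    b / 6 * threeBody W β (ns (k n + n₀)) (w (k n)) with hR
  set R' := e' - a / 2 * (∫ x, φ.dens x ^ 2) + b / 6 * ∫ x, φ.dens x ^ 3 with hR'
  have lR : Tendsto R atTop (𝓝 R') :=
    ((he.comp hm).sub (ld2.const_mul _)).add (ld3.const_mul _)
  have hTK : ∀ n, trapping s (w (k n)) ≠ ⊤ ∧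
      (trapping s (w (k n))).toReal + kinetic (w (k n)) ≤ R n := fun n => by
    have h1 := hartree_le_iff.mp (hw (k n)).2.2
    exact ⟨h1.1, by simp only [hR]; linarith [h1.2]⟩
  set g : ℕ → ℝ := fun n =>
    kinetic (w (k n)) - ∫ x, ‖(w (k n)).weakDeriv x - φ.weakDeriv x‖ ^ 2 with hg
  have hgK : ∀ n, g n ≤ kinetic (w (k n)) := fun n =>
    sub_le_self _ (integral_nonneg fun x => sq_nonneg _)
  have lRg : Tendsto (fun n => R n - g n) atTop (𝓝 (R' - kinetic φ)) := lR.sub hkin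
  have hTg : ∀ n, (trapping s (w (k n))).toReal ≤ R n - g n := fun n => by
    linarith [(hTK n).2, hgK n]
  have hnn : 0 ≤ R' - kinetic φ :=
    ge_of_tendsto' lRg fun n => ENNReal.toReal_nonneg.trans (hTg n)
  have hTliminf := H1.trapping_le_liminf (s := s) hpt
  have hTφ : trapping s φ ≤ ENNReal.ofReal (R' - kinetic φ) := by
    refine hTliminf.trans ?_
    rw [← ((ENNReal.continuous_ofReal.tendsto _).comp lRg).liminf_eq]
    refine liminf_le_liminf (Eventually.of_forall fun n => ?_)
    change trapping s (w (k n)) ≤ ENNReal.ofReal (R n - g n)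
    rw [← ENNReal.ofReal_toReal (hTK n).1]
    exact ENNReal.ofReal_le_ofReal (hTg n)
  have hTtop : trapping s φ ≠ ⊤ := (hTφ.trans_lt ENNReal.ofReal_lt_top).ne
  refine ⟨fun n => k n + n₀, φ, fun i j hij => Nat.add_lt_add_right (hk hij) _, hmφ, ?_, ?_⟩
  · refine nls_le_iff.mpr ⟨hTtop, ?_⟩
    have := ENNReal.toReal_le_of_le_ofReal hnn hTφ
    linarith
  · intro hge
    -- Equality of energies: the trapping and kinetic energies of φ exhaust the limit R' of the
    -- upper bounds for their sum. Combined with lower semicontinuity of the trap, this bounds the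
    -- kinetic energies from above.
    have hTeq : R' - kinetic φ ≤ (trapping s φ).toReal := by
      by_contra! hlt
      have h1 : nls s a b φ ≤
          ((e' - (R' - kinetic φ - (trapping s φ).toReal) : ℝ) : EReal) :=
        nls_le_iff.mpr ⟨hTtop, by linarith⟩
      have h2 := EReal.coe_le_coe_iff.mp (hge.trans h1)
      linarith
    have lK : Tendsto (fun n => kinetic (w (k n))) atTop (𝓝 (kinetic φ)) := by
      refine tendsto_order.mpr ⟨fun y hy => ?_, fun y hy => ?_⟩
      · filter_upwards [hkin.eventually (lt_mem_nhds hy)] with n hn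
        exact hn.trans_le (hgK n)
      · have hε : 0 < (y - kinetic φ) / 2 := by linarith
        filter_upwards [toReal_tendsto_lower (Eventually.of_forall fun n => (hTK n).1) hTtop
          hTliminf hε, lR.eventually (gt_mem_nhds (lt_add_of_pos_right R' hε))] with n h1 h2
        linarith [(hTK n).2]
    obtain ⟨h1, h2⟩ := H1.tendstoInH1_of_kinetic lL hkin lK
    exact H1.tendstoInH1 h1 h2

theorem nls_lower_bound (hb : 0 < b) (hab : b < bCrit ∨ (b = bCrit ∧ 0 < a ∧ β < α)) :
    ∃ m : ℝ, (m : EReal) ≤ nlsEnergy s a b := by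
  have hbc := bCrit_pos
  suffices hsuff : ∃ m : ℝ, ∀ u : H1, mass u = 1 →
      m ≤ kinetic u + a / 2 * (∫ x, u.dens x ^ 2) - b / 6 * ∫ x, u.dens x ^ 3 by
    obtain ⟨m, hm⟩ := hsuff
    refine ⟨m, le_iInf₂ fun u hu => ?_⟩
    rw [nls_eq_genEnergy, genEnergy]
    refine (EReal.coe_le_coe_iff.mpr (hm u hu)).trans ?_
    exact le_add_of_nonneg_left (EReal.coe_ennreal_nonneg _)
  rcases hab with hlt | ⟨rfl, ha, -⟩
  · have h0 : 0 < 1 - b / bCrit := by rw [sub_pos, div_lt_one hbc]; exact hlt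
    refine ⟨-(a ^ 2 / (4 * (1 - b / bCrit))), fun u hu => ?_⟩
    have hGN := H1.gagliardo_nirenberg' hu
    have hP2 := H1.integral_dens_sq_le hu
    have hP2' := u.integral_dens_sq_nonneg
    have hk := u.kap_nonneg
    rw [← H1.kap_sq]
    have h1 : b / 6 * ∫ x, u.dens x ^ 3 ≤ b / bCrit * u.kap ^ 2 := by
      have := mul_le_mul_of_nonneg_left hGN (by positivity : 0 ≤ b / bCrit)
      refine le_trans (le_of_eq ?_) this
      field_simp
    have h2 : -(|a| * u.kap) ≤ a / 2 * ∫ x, u.dens x ^ 2 := by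
      have h3 := neg_abs_le a
      have h4 := abs_nonneg a
      have h5 : -(|a| / 2 * ∫ x, u.dens x ^ 2) ≤ a / 2 * ∫ x, u.dens x ^ 2 := by nlinarith
      nlinarith
    -- Completing the square shows that the remaining kinetic share dominates the possibly
    -- attractive two-body term.
    have h3 : |a| * u.kap ≤ (1 - b / bCrit) * u.kap ^ 2 + a ^ 2 / (4 * (1 - b / bCrit)) := by
      rw [← sub_nonneg]
      have : (1 - b / bCrit) * u.kap ^ 2 + a ^ 2 / (4 * (1 - b / bCrit)) - |a| * u.kap =
          (1 - b / bCrit) * (u.kap - |a| / (2 * (1 - b / bCrit))) ^ 2 := by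
        rw [← sq_abs a]
        set q := 1 - b / bCrit
        field_simp
        ring
      rw [this]
      positivity
    linarith
  · refine ⟨0, fun u hu => ?_⟩
    have hGN := H1.gagliardo_nirenberg' hu
    have hP2' := mul_nonneg (half_pos ha).le u.integral_dens_sq_nonneg
    rw [← H1.kap_sq]
    linarith

/-- A fixed trial state with NLS energy below c suffices, since its Hartree energies converge to its
NLS energy. -/
theorem eventually_hartreeEnergy_lt (hα : 0 < α) (hβ : 0 < β) (hU : TwoBodyPotential U)
    (hW : ThreeBodyPotential W) {c : EReal} (hc : nlsEnergy s a b < c) :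
    ∀ᶠ N in atTop, hartreeEnergy U W s α β a b N < c := by
  simp only [nlsEnergy, groundEnergy, iInf_lt_iff, exists_prop] at hc
  obtain ⟨u, hu, hlt⟩ := hc
  obtain ⟨y, hy1, hy2⟩ := EReal.lt_iff_exists_real_btwn.mp hlt
  obtain ⟨y', hy1', hy2'⟩ := EReal.lt_iff_exists_real_btwn.mp hy2
  obtain ⟨ht, hle⟩ := nls_le_iff.mp hy1.le
  have e2 := tendsto_twoBody_error (u := fun _ => u) hU hα tendsto_id
    (Eventually.of_forall fun _ => hu) (Eventually.of_forall fun _ => le_rfl)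
  have e3 := tendsto_threeBody_error (u := fun _ => u) hW hβ tendsto_id
    (Eventually.of_forall fun _ => hu) (Eventually.of_forall fun _ => le_rfl)
  have hlim : Tendsto (fun N => (trapping s u).toReal +
      (kinetic u + a / 2 * twoBody U α N u - b / 6 * threeBody W β N u)) atTop
      (𝓝 ((trapping s u).toReal +
        (kinetic u + a / 2 * (∫ x, u.dens x ^ 2) - b / 6 * ∫ x, u.dens x ^ 3))) := by
    have := ((((e2.const_sub (∫ x, u.dens x ^ 2)).const_mul (a / 2)).const_add (kinetic u)).sub
      ((e3.const_sub (∫ x, u.dens x ^ 3)).const_mul (b / 6))).const_add (trapping s u).toReal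
    simpa using this
  filter_upwards [hlim.eventually
    (ge_mem_nhds (lt_of_le_of_lt hle (EReal.coe_lt_coe_iff.mp hy1')))] with N hN
  exact ((groundEnergy_le hu).trans (hartree_le_iff.mpr ⟨ht, hN⟩)).trans_lt hy2'

theorem fixed_couplings (hs : 0 < s) (hα : 0 < α) (hβ : 0 < β) (hU : TwoBodyPotential U)
    (hW : ThreeBodyPotential W) (hb : 0 < b) (hab : b < bCrit ∨ (b = bCrit ∧ 0 < a ∧ β < α)) :
    (∀ u : ℕ → H1, IsApproxGroundStates (hartree U W s α β a b) (fun _ => 1) u →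
        ∀ n : ℕ → ℕ, StrictMono n → ∃ k : ℕ → ℕ, StrictMono k ∧
          ∃ φ : H1, IsGroundState (nls s a b) φ ∧ TendstoInH1 (fun j => u (n (k j))) φ) ∧
      (∃ E : ℝ, nlsEnergy s a b = (E : EReal) ∧
        Tendsto (fun N => hartreeEnergy U W s α β a b N) atTop (𝓝 (E : EReal))) := by
  obtain ⟨m, hm⟩ := nls_lower_bound (s := s) hb hab
  have htop : nlsEnergy s a b < ⊤ := by
    refine (groundEnergy_le mass_soliton).trans_lt ?_
    have hd : ∀ x, soliton.dens x = (1 : ℝ) * Q₀ (1 * (x - 0)) ^ 2 := fun x => by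
      rw [soliton_dens]; simp
    exact (nls_le_iff.mpr ⟨by rw [trapping_of_bubble hs one_pos hd]; exact ENNReal.ofReal_ne_top,
      le_rfl⟩).trans_lt (EReal.coe_lt_top _)
  obtain ⟨E, hE⟩ : ∃ E : ℝ, nlsEnergy s a b = (E : EReal) :=
    ⟨_, (EReal.coe_toReal htop.ne ((EReal.bot_lt_coe m).trans_le hm).ne').symm⟩
  have hlim : Tendsto (fun N => hartreeEnergy U W s α β a b N) atTop (𝓝 (E : EReal)) := by
    refine tendsto_order.mpr ⟨fun c hc => ?_, fun c hc =>
      eventually_hartreeEnergy_lt hα hβ hU hW (hE.trans_lt hc)⟩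
    obtain ⟨y, hy1, hy2⟩ := EReal.lt_iff_exists_real_btwn.mp hc
    obtain ⟨y', hy1', hy2'⟩ := EReal.lt_iff_exists_real_btwn.mp hy2
    suffices hev : ∀ᶠ N in atTop, (y : EReal) ≤ hartreeEnergy U W s α β a b N from
      hev.mono fun N hN => hy1.trans_le hN
    by_contra hcon
    rw [not_eventually] at hcon
    obtain ⟨ns, hns, hP⟩ := extraction_of_frequently_atTop hcon
    have hex : ∀ n, ∃ u, mass u = 1 ∧ hartree U W s α β a b (ns n) u ≤ (y : EReal) := fun n => by
      have := hP n
      rw [hartreeEnergy, groundEnergy, le_iInf₂_iff] at this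
      push Not at this
      obtain ⟨u, hm, hu⟩ := this
      exact ⟨u, hm, hu.le⟩
    choose u hu using hex
    -- Hartree states with energy at most y along a subsequence would produce a normalized limit
    -- with NLS energy at most y, below the infimum E.
    obtain ⟨k, φ, -, hφ, hle, -⟩ := hartree_subseq hs hα hβ hU hW hb hab hns.tendsto_atTop
      tendsto_const_nhds (Eventually.of_forall hu)
    have h1 : (E : EReal) ≤ (y : EReal) := by
      rw [← hE]; exact (groundEnergy_le hφ).trans hle
    exact absurd h1 (not_le.mpr hy2)
  refine ⟨fun u hu n hn => ?_, E, hE, hlim⟩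
  obtain ⟨δ, hδ, hu⟩ := hu
  have hδ0 : Tendsto δ atTop (𝓝 0) := (isLittleO_one_iff ℝ).mp hδ
  have hreal : ∀ᶠ N in atTop, ((hartreeEnergy U W s α β a b N).toReal : EReal) =
      hartreeEnergy U W s α β a b N := by
    filter_upwards [hlim.eventually_ne (EReal.coe_ne_top E),
      hlim.eventually_ne (EReal.coe_ne_bot E)] with N h1 h2
    exact EReal.coe_toReal h1 h2
  have hlim' : Tendsto (fun N => (hartreeEnergy U W s α β a b N).toReal + δ N) atTop (𝓝 E) := by
    simpa using ((EReal.tendsto_toReal (EReal.coe_ne_top E) (EReal.coe_ne_bot E)).comp hlim).add hδ0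
  obtain ⟨k, φ, hk, hφ, hle, hconv⟩ := hartree_subseq hs hα hβ hU hW hb hab hn.tendsto_atTop
    (u := fun j => u (n j)) (hlim'.comp hn.tendsto_atTop) (by
      filter_upwards [hn.tendsto_atTop.eventually hreal,
        hn.tendsto_atTop.eventually_ge_atTop 3] with j h1 h2
      refine ⟨(hu _ h2).1, (hu _ h2).2.trans ?_⟩
      simp only [Function.comp_apply]
      rw [EReal.coe_add, h1]
      exact le_rfl)
  have hge : (E : EReal) ≤ nls s a b φ := hE.symm.trans_le (groundEnergy_le hφ)
  exact ⟨k, hk, φ, ⟨hφ, le_antisymm (hle.trans hE.symm.le) (groundEnergy_le hφ)⟩, hconv hge⟩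

end HartreeNLS

/-! ### Comparison of the two energies and assembly. -/

namespace HartreeNLS

/-- Two energies with the same nonzero leading order are asymptotically equivalent. -/
theorem exists_ratio {c q : ℝ} (hc : c ≠ 0) (hq : q ≠ 0) {p : ℕ → ℝ} (hp : ∀ᶠ N in atTop, p N ≠ 0)
    {E F : ℕ → EReal} {ε δ : ℕ → ℝ} (hε : Tendsto ε atTop (𝓝 0)) (hδ : Tendsto δ atTop (𝓝 0))
    (hE : ∀ᶠ N in atTop, E N = (((c + ε N) * q * p N : ℝ) : EReal))
    (hF : ∀ᶠ N in atTop, F N = (((c + δ N) * q * p N : ℝ) : EReal)) :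
    ∃ r : ℕ → ℝ, Tendsto r atTop (𝓝 0) ∧ ∀ᶠ N in atTop, E N = F N * ((1 + r N : ℝ) : EReal) := by
  have h1 : Tendsto (fun N => c + δ N) atTop (𝓝 c) := by simpa using hδ.const_add c
  have h2 : Tendsto (fun N => c + ε N) atTop (𝓝 c) := by simpa using hε.const_add c
  refine ⟨fun N => (c + ε N) / (c + δ N) - 1, ?_, ?_⟩
  · have := (h2.div h1 hc).sub_const 1
    rwa [div_self hc, sub_self] at this
  · filter_upwards [hE, hF, h1.eventually_ne hc, hp] with N h3 h4 h5 h6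
    rw [h3, h4, ← EReal.coe_mul]
    congr 1
    field_simp
    ring

end HartreeNLS

theorem theorem3 (s α β : ℝ) (hs : 0 < s) (hα : 0 < α) (hβ : 0 < β)
    (U : ℝ → ℝ) (W : ℝ × ℝ → ℝ) (hU : TwoBodyPotential U) (hW : ThreeBodyPotential W) :
    -- (i) fixed couplings
    (∀ a b : ℝ, 0 < b → (b < bCrit ∨ (b = bCrit ∧ 0 < a ∧ β < α)) →
      (∀ u : ℕ → H1, IsApproxGroundStates (hartree U W s α β a b) (fun _ => 1) u →
        ∀ n : ℕ → ℕ, StrictMono n → ∃ k : ℕ → ℕ, StrictMono k ∧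
          ∃ φ : H1, IsGroundState (nls s a b) φ ∧ TendstoInH1 (fun j => u (n (k j))) φ) ∧
      (∃ E : ℝ, nlsEnergy s a b = (E : EReal) ∧
        Tendsto (fun N => hartreeEnergy U W s α β a b N) atTop (𝓝 (E : EReal)))) ∧
    -- (ii) collapse regime
    (Integrable (fun x => x * U x) → Integrable (fun p : ℝ × ℝ => p.1 * W p) →
      ∀ (ζ η : ℝ) (a b ℓ : ℕ → ℝ), 0 ≤ ζ → CollapseRegime s ζ a b ℓ →
        0 < η → η < min (β / (s + 3)) α → ℓ =Θ[atTop] (fun N : ℕ => (N : ℝ) ^ (-η)) →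
        (ζ = 0 → β < α) →
      (∀ u : ℕ → H1,
        IsApproxGroundStates (fun N => hartree U W s α β (a N) (b N) N) (fun N => ℓ N ^ s) u →
        (∃ θ : ℕ → ℝ, TendstoInH1
          (fun N x => Complex.exp (θ N * Complex.I) * rescale (ℓ N) (u N) x) (fun x => (Q₀ x : ℂ))) ∧
        ((∀ N, 3 ≤ N → ∀ᵐ x, u N x = (‖u N x‖ : ℂ)) →
          TendstoInH1 (fun N => rescale (ℓ N) (u N)) (fun x => (Q₀ x : ℂ)))) ∧
      (∃ ε : ℕ → ℝ, Tendsto ε atTop (𝓝 0) ∧ ∀ᶠ N in atTop,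
        hartreeEnergy U W s α β (a N) (b N) N =
          ((((s + 1) / s - ζ / 12 + ε N) * Qs s * ℓ N ^ s : ℝ) : EReal)) ∧
      (∃ ε : ℕ → ℝ, Tendsto ε atTop (𝓝 0) ∧ ∀ᶠ N in atTop,
        nlsEnergy s (a N) (b N) =
          ((((s + 1) / s - ζ / 12 + ε N) * Qs s * ℓ N ^ s : ℝ) : EReal)) ∧
      (ζ ≠ 12 * (s + 1) / s → ∃ ε : ℕ → ℝ, Tendsto ε atTop (𝓝 0) ∧ ∀ᶠ N in atTop,
        hartreeEnergy U W s α β (a N) (b N) N =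
          nlsEnergy s (a N) (b N) * ((1 + ε N : ℝ) : EReal))) := by
  refine ⟨fun a b hb hab => fixed_couplings hs hα hβ hU hW hb hab, ?_⟩
  intro hxU hxW ζ η a b ℓ hζ hreg hη0 hη hℓ hαβ
  have h := hreg.rescaled hs hζ
  have hH := localApprox_hartree hs hU hW hxU hxW h.pos hη hη0 hℓ hαβ
  obtain ⟨ε, hε, hEH⟩ := collapse_groundEnergy hs hζ h hH
  -- NLS enters the same scheme with zero approximation error, so both energies have the same
  -- leading term and the same ℓ.
  obtain ⟨δ, hδ, hEN⟩ := collapse_groundEnergy hs hζ h (localApprox_nls s ζ ℓ)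
  have hEN' : ∀ᶠ N in atTop, nlsEnergy s (a N) (b N) =
      ((((s + 1) / s - ζ / 12 + δ N) * Qs s * ℓ N ^ s : ℝ) : EReal) := by
    filter_upwards [hEN] with N hN
    rw [nlsEnergy, nls_eq_genEnergy, hN]
  refine ⟨fun u hu => ⟨exists_phases hs hζ h hH hu, fun hpos =>
    tendsto_of_nonneg hs hζ h hH hu hpos⟩, ⟨ε, hε, hEH⟩, ⟨δ, hδ, hEN'⟩, fun hne => ?_⟩
  refine exists_ratio (fun h0 => hne ?_) (Qs_pos hs).ne'
    (h.pos.mono fun N hN => (Real.rpow_pos_of_pos hN s).ne') hε hδ hEH hEN'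
  field_simp at h0 ⊢
  linarith
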